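/- Let $k$ be a field of characteristic zero (for example $\mathbb{C}$), let $n,m\ge 0$, let $a_0=1,a_1,\dots,a_m$ be positive integers such that the weighted projective space $\mathbb{P}(1,a_1,\dots,a_m)$ is well-formed, i.e. $\gcd(a_j : j\neq i)=1$ for every $0\le i\le m$ (with $\gcd(\varnothing)=0$, so that $m\geq 1$), and let $\omega_0,\dots,\omega_m$ be non-negative integers. The weighted bundle $\mathcal{F}=\mathcal{F}_{\mathbb{P}}(\omega_0,\dots,\omega_m)$ over $\mathbb{P}^n$ is the geometric quotient of $\mathbb{A}^{n+m+2}_k\setminus V(I)$, with coordinates $x_0,\dots,x_n,y_0,\dots,y_m$ and $I=(x_0,\dots,x_n)\cap(y_0,\dots,y_m)$, by the action of $\mathbb{G}_m^2$ with weight matrix \[A=\begin{pmatrix}1&\cdots&1&-\omega_0&-\omega_1&\cdots&-\omega_m\\0&\cdots&0&1&a_1&\cdots&a_m\end{pmatrix},\] i.e. $(\mu,\lambda)\cdot(x_j,y_i)=(\mu x_j,\ \mu^{-\omega_i}\lambda^{a_i}y_i)$. Let $\beta_1,\dots,\beta_m,\alpha_1,\dots,\alpha_n$ be the standard basis of $N=\mathbb{Z}^{n+m}$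 and put \[\beta_0=-\sum_{i=1}^m a_i\beta_i,\qquad \alpha_0=-\sum_{j=1}^n\alpha_j+\sum_{i=0}^m\omega_i\beta_i .\] For $0\le r\le m$ and $0\le s\le n$ let $\sigma_{rs}\subset N_{\mathbb{R}}$ be the cone generated by all $\beta_i$ with $i\ne r$ and all $\alpha_j$ with $j\neq s$, and let $\Sigma$ be the set of all faces of the cones $\sigma_{rs}$. Then: 1. $\Sigma$ is a fan in $N_{\mathbb{R}}$, and its maximal cones are exactly the $\sigma_{rs}$. 2. If $n\ge 1$, the primitive generators of the rays of $\Sigma$ are exactly $\alpha_0,\dots,\alpha_n,\beta_0,\dots,\beta_m$. 3. $\mathcal{F}\cong T(\Sigma)$ over $k$, where $T(\Sigma)$ is the toric variety of $\Sigma$. More precisely, there is a $k$-morphism $q:\mathbb{A}^{n+m+2}_k\setminus V(I)\to T(\Sigma)$ that is a geometric quotient for this action, and for every geometric quotient $\pi:\mathbb{A}^{n+m+2}_k\setminus V(I)\to\mathcal{F}$ over $k$ there is a $k$-isomorphism $e:\mathcal{F}\to T(\Sigma)$ with $e\circ\pi=q$. -/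

import Mathlib

open CategoryTheory CategoryTheory.Limits AlgebraicGeometry

universe u

noncomputable section

namespace WeightedBundle

section Cones

variable {ι : Type} [Fintype ι]

/-- Rational polyhedral cones live in `N_ℝ = ℝ^ι`, where `N = ℤ^ι`. -/
abbrev Cone (ι : Type) := PointedCone ℝ (ι → ℝ)

/-- The pairing `⟨u, v⟩` of `u ∈ M = Hom(N, ℤ) = ℤ^ι` with `v ∈ N_ℝ`. -/
def pairing (u : ι → ℤ) (v : ι → ℝ) : ℝ := ∑ i, (u i : ℝ) * v i

/-- The inclusion `N → N_ℝ`. -/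
def latticeVec (v : ι → ℤ) : ι → ℝ := fun i => (v i : ℝ)

/-- The cone in `N_ℝ` generated by a set of lattice vectors. -/
def coneOf (S : Set (ι → ℤ)) : Cone ι := PointedCone.hull ℝ (latticeVec '' S)

/-- Rational polyhedral cones: those generated by finitely many lattice vectors. -/
def IsRationalPolyhedral (σ : Cone ι) : Prop :=
  ∃ S : Set (ι → ℤ), S.Finite ∧ σ = coneOf S

/-- The semigroup `S_σ = σ^∨ ∩ M`. -/
def dualMonoid (σ : Cone ι) : AddSubmonoid (ι → ℤ) where
  carrier := {u | ∀ v ∈ σ, 0 ≤ pairing u v}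
  zero_mem' := fun v _ => by simp [pairing]
  add_mem' := fun {a b} ha hb v hv => by
    have : pairing (a + b) v = pairing a v + pairing b v := by
      simp [pairing, add_mul, Finset.sum_add_distrib]
    rw [this]
    exact add_nonneg (ha v hv) (hb v hv)

/-- `τ` is a face of the (rational polyhedral) cone `σ`: `τ = σ ∩ u^⊥` for some
`u ∈ σ^∨ ∩ M`. -/
def IsFace (τ σ : Cone ι) : Prop :=
  ∃ u ∈ dualMonoid σ, ∀ v, v ∈ τ ↔ v ∈ σ ∧ pairing u v = 0

/-- A fan in `N_ℝ`: a finite set of strongly convex rational polyhedral cones, closed under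
taking faces, in which any two cones meet in a common face. -/
structure IsFan (F : Set (Cone ι)) : Prop where
  finite : F.Finite
  rational : ∀ σ ∈ F, IsRationalPolyhedral σ
  stronglyConvex : ∀ σ ∈ F, ∀ v ∈ σ, -v ∈ σ → v = 0
  face_mem : ∀ σ ∈ F, ∀ τ, IsFace τ σ → τ ∈ F
  inter_face : ∀ σ ∈ F, ∀ τ ∈ F, IsFace (σ ⊓ τ) σ ∧ IsFace (σ ⊓ τ) τ

/-- A primitive lattice vector: it is nonzero and not a proper multiple of a lattice vector. -/
def IsPrimitive (v : ι → ℤ) : Prop := v ≠ 0 ∧ ∀ (d : ℤ) (w : ι → ℤ), v = d • w → IsUnit d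

lemma pairing_add (a b : ι → ℤ) (v : ι → ℝ) : pairing (a + b) v = pairing a v + pairing b v := by
  simp [pairing, add_mul, Finset.sum_add_distrib]

lemma pairing_nsmul (N : ℕ) (a : ι → ℤ) (v : ι → ℝ) : pairing (N • a) v = N * pairing a v := by
  simp [pairing, Finset.mul_sum, mul_assoc]

lemma pairing_neg (a : ι → ℤ) (v : ι → ℝ) : pairing (-a) v = - pairing a v := by
  simp [pairing]

lemma dualMonoid_anti {τ σ : Cone ι} (h : τ ≤ σ) : dualMonoid σ ≤ dualMonoid τ :=
  fun _ hu v hv => hu v (h hv)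

lemma mem_dualMonoid_coneOf {S : Set (ι → ℤ)} {u : ι → ℤ} :
    u ∈ dualMonoid (coneOf S) ↔ ∀ s ∈ S, 0 ≤ pairing u (latticeVec s) := by
  constructor
  · intro h s hs
    exact h _ (Submodule.subset_span ⟨s, hs, rfl⟩)
  · intro h v hv
    induction hv using Submodule.span_induction with
    | mem x hx => obtain ⟨s, hs, rfl⟩ := hx; exact h s hs
    | zero => simp [pairing]
    | add x y _ _ hx hy =>
      have : pairing u (x + y) = pairing u x + pairing u y := by
        simp [pairing, mul_add, Finset.sum_add_distrib]
      rw [this]; exact add_nonneg hx hy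
    | smul c x _ hx =>
      have : pairing u (c • x) = (c : ℝ) * pairing u x := by
        simp only [pairing, Finset.mul_sum]
        refine Finset.sum_congr rfl fun i _ => ?_
        change (u i : ℝ) * ((c : ℝ) * x i) = _
        ring
      rw [this]; exact mul_nonneg c.2 hx

lemma pairing_latticeVec (u s : ι → ℤ) :
    pairing u (latticeVec s) = ((∑ i, u i * s i : ℤ) : ℝ) := by
  simp [pairing, latticeVec]

/-- If `τ = σ ∩ u^⊥`, then `S_τ = S_σ + ℕ·(-u)`. -/
lemma exists_nsmul_add_mem {τ σ : Cone ι} (hσ : IsRationalPolyhedral σ) {u : ι → ℤ}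
    (hu : u ∈ dualMonoid σ) (hτ : ∀ v, v ∈ τ ↔ v ∈ σ ∧ pairing u v = 0)
    {w : ι → ℤ} (hw : w ∈ dualMonoid τ) : ∃ N : ℕ, ∀ N' ≥ N, N' • u + w ∈ dualMonoid σ := by
  obtain ⟨S, hS, rfl⟩ := hσ
  have key : ∀ s ∈ S, ∃ N : ℕ, ∀ N' ≥ N, 0 ≤ pairing (N' • u + w) (latticeVec s) := by
    intro s hs
    have hsσ : latticeVec s ∈ coneOf S := Submodule.subset_span ⟨s, hs, rfl⟩
    by_cases h0 : pairing u (latticeVec s) = 0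
    · refine ⟨0, fun N' _ => ?_⟩
      rw [pairing_add, pairing_nsmul, h0, mul_zero, zero_add]
      exact hw _ ((hτ _).2 ⟨hsσ, h0⟩)
    · have hpos : 0 < pairing u (latticeVec s) := lt_of_le_of_ne (hu _ hsσ) (Ne.symm h0)
      obtain ⟨N, hN⟩ := Archimedean.arch (-pairing w (latticeVec s)) hpos
      refine ⟨N, fun N' hN' => ?_⟩
      rw [pairing_add, pairing_nsmul]
      have h1 : (N : ℝ) * pairing u (latticeVec s) ≤ N' * pairing u (latticeVec s) :=
        mul_le_mul_of_nonneg_right (by exact_mod_cast hN') hpos.le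
      rw [nsmul_eq_mul] at hN
      linarith
  choose! f hf using key
  refine ⟨hS.toFinset.sup f, fun N' hN' => mem_dualMonoid_coneOf.2 fun s hs => hf s hs N' ?_⟩
  exact (Finset.le_sup (hS.mem_toFinset.2 hs)).trans hN'

end Cones

section ToricVariety

variable (k : Type u) [Field k] {ι : Type} [Fintype ι]

/-- The semigroup algebra `k[S_σ]`. -/
abbrev coneAlgebra (σ : Cone ι) : Type u := AddMonoidAlgebra k (dualMonoid σ)

/-- The inclusion `k[S_σ] → k[S_τ]` for `τ ⊆ σ`. -/
def coneAlgebraMap {τ σ : Cone ι} (h : τ ≤ σ) : coneAlgebra k σ →ₐ[k] coneAlgebra k τ :=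
  AddMonoidAlgebra.mapDomainAlgHom k k (AddSubmonoid.inclusion (dualMonoid_anti h))

lemma coneAlgebraMap_single {τ σ : Cone ι} (h : τ ≤ σ) (w : dualMonoid σ) (c : k) :
    coneAlgebraMap k h (AddMonoidAlgebra.single w c) =
      AddMonoidAlgebra.single (⟨w.1, dualMonoid_anti h w.2⟩ : dualMonoid τ) c := by
  simp [coneAlgebraMap]
  rfl

lemma coneAlgebraMap_injective {τ σ : Cone ι} (h : τ ≤ σ) :
    Function.Injective (coneAlgebraMap k h) :=
  AddMonoidAlgebra.mapDomain_injective (AddSubmonoid.inclusion_injective (dualMonoid_anti h))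

lemma coneAlgebraMap_refl (σ : Cone ι) :
    coneAlgebraMap k (le_refl σ) = AlgHom.id k (coneAlgebra k σ) := by
  refine AlgHom.ext fun x => ?_
  induction x using AddMonoidAlgebra.induction_linear with
  | zero => simp
  | add f g hf hg => rw [map_add, map_add, hf, hg]
  | single w c => exact coneAlgebraMap_single k le_rfl w c

lemma coneAlgebraMap_trans {ρ τ σ : Cone ι} (h : ρ ≤ τ) (h' : τ ≤ σ) :
    coneAlgebraMap k (h.trans h') = (coneAlgebraMap k h).comp (coneAlgebraMap k h') := by
  refine AlgHom.ext fun x => ?_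
  induction x using AddMonoidAlgebra.induction_linear with
  | zero => simp
  | add f g hf hg => rw [map_add, map_add, hf, hg]
  | single w c => simp only [AlgHom.comp_apply, coneAlgebraMap_single]

/-- For a face `τ = σ ∩ u^⊥`, the algebra `k[S_τ]` is the localization of `k[S_σ]` at `χ^u`. -/
lemma isLocalization_coneAlgebraMap {τ σ : Cone ι} (h : τ ≤ σ) (hσ : IsRationalPolyhedral σ)
    {u : ι → ℤ} (hu : u ∈ dualMonoid σ) (hτ : ∀ v, v ∈ τ ↔ v ∈ σ ∧ pairing u v = 0) :
    letI := (coneAlgebraMap k h).toRingHom.toAlgebra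
    IsLocalization.Away (AddMonoidAlgebra.single (⟨u, hu⟩ : dualMonoid σ) (1 : k))
      (coneAlgebra k τ) := by
  let := (coneAlgebraMap k h).toRingHom.toAlgebra
  have hmap : ∀ x, algebraMap (coneAlgebra k σ) (coneAlgebra k τ) x = coneAlgebraMap k h x :=
    fun _ => rfl
  have hnu : -u ∈ dualMonoid τ := fun v hv => by
    rw [pairing_neg, ((hτ v).1 hv).2, neg_zero]
  have hpow : ∀ N : ℕ, algebraMap (coneAlgebra k σ) (coneAlgebra k τ)
      (AddMonoidAlgebra.single (⟨u, hu⟩ : dualMonoid σ) (1 : k) ^ N) =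
      AddMonoidAlgebra.single (N • ⟨u, dualMonoid_anti h hu⟩ : dualMonoid τ) (1 : k) := by
    intro N
    rw [map_pow, hmap, coneAlgebraMap_single, AddMonoidAlgebra.single_pow, one_pow]
  have hunit : IsUnit (algebraMap (coneAlgebra k σ) (coneAlgebra k τ)
      (AddMonoidAlgebra.single (⟨u, hu⟩ : dualMonoid σ) (1 : k))) := by
    rw [hmap, coneAlgebraMap_single]
    refine IsUnit.of_mul_eq_one (AddMonoidAlgebra.single (⟨-u, hnu⟩ : dualMonoid τ) (1 : k)) ?_
    rw [AddMonoidAlgebra.single_mul_single, one_mul, AddMonoidAlgebra.one_def]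
    congr 1
    exact Subtype.ext (add_neg_cancel u)
  refine ⟨⟨?_, ?_, ?_⟩⟩
  · rintro ⟨_, N, rfl⟩
    rw [map_pow]
    exact hunit.pow N
  · intro z
    have hz : ∃ N : ℕ, ∀ N' ≥ N, ∃ x, z * algebraMap (coneAlgebra k σ) (coneAlgebra k τ)
        (AddMonoidAlgebra.single (⟨u, hu⟩ : dualMonoid σ) (1 : k) ^ N') =
        algebraMap (coneAlgebra k σ) (coneAlgebra k τ) x := by
      induction z using AddMonoidAlgebra.induction_linear with
      | zero => exact ⟨0, fun _ _ => ⟨0, by simp⟩⟩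
      | add f g hf hg =>
        obtain ⟨N₁, h₁⟩ := hf
        obtain ⟨N₂, h₂⟩ := hg
        refine ⟨max N₁ N₂, fun N' hN' => ?_⟩
        obtain ⟨x, hx⟩ := h₁ N' (le_of_max_le_left hN')
        obtain ⟨y, hy⟩ := h₂ N' (le_of_max_le_right hN')
        exact ⟨x + y, by rw [add_mul, hx, hy, map_add]⟩
      | single w c =>
        obtain ⟨N, hN⟩ := exists_nsmul_add_mem hσ hu hτ w.2
        refine ⟨N, fun N' hN' => ⟨AddMonoidAlgebra.single ⟨_, hN N' hN'⟩ c, ?_⟩⟩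
        rw [hpow, hmap, coneAlgebraMap_single, AddMonoidAlgebra.single_mul_single, mul_one]
        congr 1
        exact Subtype.ext (add_comm _ _)
    obtain ⟨N, hN⟩ := hz
    obtain ⟨x, hx⟩ := hN N le_rfl
    exact ⟨⟨x, ⟨_, N, rfl⟩⟩, hx⟩
  · intro x y hxy
    exact ⟨1, by rw [coneAlgebraMap_injective k h hxy]⟩

variable {F : Set (Cone ι)}

/-- The affine toric varieties `U_σ = Spec k[S_σ]`, for `σ` in a fan ordered by inclusion, with
the morphisms `U_τ → U_σ` for `τ ⊆ σ`. -/
def toricDiagram (F : Set (Cone ι)) : F ⥤ Scheme.{u} where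
  obj σ := Spec (.of (coneAlgebra k σ.1))
  map {τ σ} h := Spec.map (CommRingCat.ofHom (coneAlgebraMap k (leOfHom h)).toRingHom)
  map_id σ := by
    rw [← Spec.map_id]
    exact congrArg (fun f => Spec.map (CommRingCat.ofHom f))
      (congrArg AlgHom.toRingHom (coneAlgebraMap_refl k σ.1))
  map_comp {ρ τ σ} f g := by
    rw [← Spec.map_comp]
    exact congrArg (fun f => Spec.map (CommRingCat.ofHom f))
      (congrArg AlgHom.toRingHom (coneAlgebraMap_trans k (leOfHom f) (leOfHom g)))

lemma IsFan.isFace_of_le (hF : IsFan F) {τ σ : Cone ι} (hτ : τ ∈ F) (hσ : σ ∈ F) (h : τ ≤ σ) :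
    IsFace τ σ := by
  have := (hF.inter_face τ hτ σ hσ).2
  rwa [inf_eq_left.2 h] at this

lemma IsFan.isOpenImmersion (hF : IsFan F) {τ σ : F} (h : τ ⟶ σ) :
    IsOpenImmersion ((toricDiagram k F).map h) := by
  obtain ⟨u, hu, hτ⟩ := hF.isFace_of_le τ.2 σ.2 (leOfHom h)
  let := (coneAlgebraMap k (leOfHom h)).toRingHom.toAlgebra
  have := isLocalization_coneAlgebraMap k (leOfHom h) (hF.rational _ σ.2) hu hτ
  exact IsOpenImmersion.of_isLocalization
    (AddMonoidAlgebra.single (⟨u, hu⟩ : dualMonoid σ.1) (1 : k))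

lemma range_toricDiagram_map {τ σ : F} (h : τ ⟶ σ) (hσ : IsRationalPolyhedral σ.1)
    {u : ι → ℤ} (hu : u ∈ dualMonoid σ.1)
    (hτ : ∀ v, v ∈ τ.1 ↔ v ∈ σ.1 ∧ pairing u v = 0) :
    Set.range ((toricDiagram k F).map h) =
      ((PrimeSpectrum.basicOpen
        (AddMonoidAlgebra.single (⟨u, hu⟩ : dualMonoid σ.1) (1 : k)) :
        TopologicalSpace.Opens (PrimeSpectrum (coneAlgebra k σ.1))) :
        Set (PrimeSpectrum (coneAlgebra k σ.1))) := by
  let := (coneAlgebraMap k (leOfHom h)).toRingHom.toAlgebra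
  have := isLocalization_coneAlgebraMap k (leOfHom h) hσ hu hτ
  exact PrimeSpectrum.localization_away_comap_range (coneAlgebra k τ.1)
    (AddMonoidAlgebra.single (⟨u, hu⟩ : dualMonoid σ.1) (1 : k))

lemma IsFan.isLocallyDirected (hF : IsFan F) :
    (toricDiagram k F ⋙ Scheme.forget).IsLocallyDirected where
  cond {σ τ ρ} f g x y hxy := by
    have hxy' : (toricDiagram k F).map f x = (toricDiagram k F).map g y := hxy
    obtain ⟨u, hu, hσ⟩ := hF.isFace_of_le σ.2 ρ.2 (leOfHom f)
    obtain ⟨w, hw, hτ⟩ := hF.isFace_of_le τ.2 ρ.2 (leOfHom g)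
    have hmem : σ.1 ⊓ τ.1 ∈ F := hF.face_mem _ σ.2 _ (hF.inter_face _ σ.2 _ τ.2).1
    let l : F := ⟨σ.1 ⊓ τ.1, hmem⟩
    let a : l ⟶ σ := homOfLE (inf_le_left : σ.1 ⊓ τ.1 ≤ σ.1)
    let b : l ⟶ τ := homOfLE (inf_le_right : σ.1 ⊓ τ.1 ≤ τ.1)
    have huw : u + w ∈ dualMonoid ρ.1 := add_mem hu hw
    have hl : ∀ v, v ∈ l.1 ↔ v ∈ ρ.1 ∧ pairing (u + w) v = 0 := by
      intro v
      change v ∈ σ.1 ∧ v ∈ τ.1 ↔ _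
      rw [hσ, hτ, pairing_add]
      constructor
      · rintro ⟨⟨h1, h2⟩, -, h3⟩
        exact ⟨h1, by rw [h2, h3, add_zero]⟩
      · rintro ⟨h1, h2⟩
        have h3 := hu v h1
        have h4 := hw v h1
        exact ⟨⟨h1, by linarith⟩, h1, by linarith⟩
    have hx : (toricDiagram k F).map f x ∈ Set.range ((toricDiagram k F).map f) := ⟨x, rfl⟩
    have hy : (toricDiagram k F).map f x ∈ Set.range ((toricDiagram k F).map g) :=
      ⟨y, hxy'.symm⟩
    rw [range_toricDiagram_map k f (hF.rational _ ρ.2) hu hσ] at hx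
    rw [range_toricDiagram_map k g (hF.rational _ ρ.2) hw hτ] at hy
    have hz : (toricDiagram k F).map f x ∈ Set.range ((toricDiagram k F).map (a ≫ f)) := by
      rw [range_toricDiagram_map k (a ≫ f) (hF.rational _ ρ.2) huw hl]
      have e : AddMonoidAlgebra.single (⟨u + w, huw⟩ : dualMonoid ρ.1) (1 : k) =
          AddMonoidAlgebra.single (⟨u, hu⟩ : dualMonoid ρ.1) (1 : k) *
            AddMonoidAlgebra.single (⟨w, hw⟩ : dualMonoid ρ.1) (1 : k) := by
        rw [AddMonoidAlgebra.single_mul_single, one_mul]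
        rfl
      rw [e, PrimeSpectrum.basicOpen_mul]
      exact ⟨hx, hy⟩
    obtain ⟨z, hz⟩ := hz
    have := hF.isOpenImmersion k f
    have := hF.isOpenImmersion k g
    refine ⟨l, a, b, z, ?_, ?_⟩
    · change (toricDiagram k F).map a z = x
      apply ((toricDiagram k F).map f).isOpenEmbedding.injective
      rw [← Scheme.Hom.comp_apply, ← Functor.map_comp, hz]
    · change (toricDiagram k F).map b z = y
      apply ((toricDiagram k F).map g).isOpenEmbedding.injective
      rw [← Scheme.Hom.comp_apply, ← Functor.map_comp, ← hxy', ← hz]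
      rfl

lemma IsFan.hasColimit (hF : IsFan F) : HasColimit (toricDiagram k F) := by
  have : ∀ {i j : F} (f : i ⟶ j), IsOpenImmersion ((toricDiagram k F).map f) :=
    fun f => hF.isOpenImmersion k f
  have := hF.isLocallyDirected k
  infer_instance

/-- The structure morphisms `U_σ → Spec k`. -/
def toricCocone (F : Set (Cone ι)) : Cocone (toricDiagram k F) where
  pt := Spec (.of k)
  ι :=
    { app := fun σ => Spec.map (CommRingCat.ofHom (algebraMap k (coneAlgebra k σ.1)))
      naturality := fun τ σ h => by
        change Spec.map _ ≫ Spec.map _ = _ ≫ 𝟙 _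
        rw [Category.comp_id, ← Spec.map_comp]
        exact congrArg (fun f => Spec.map (CommRingCat.ofHom f))
          (coneAlgebraMap k (leOfHom h)).comp_algebraMap }

/-- The toric variety `T(Σ)` over `k` of a fan `Σ`: the affine schemes `U_σ`, `σ ∈ Σ`, glued
along the open immersions `U_τ → U_σ` for `τ ⊆ σ`. -/
def toricVariety {F : Set (Cone ι)} (hF : IsFan F) : Over (Spec (.of k)) :=
  haveI := hF.hasColimit k
  Over.mk (colimit.desc (toricDiagram k F) (toricCocone k F))

end ToricVariety

section Quotients

/-- A section `f` of `O_X` over `V` is invariant for a groupoid (such as an action)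
`pr, act : R ⇉ X` if its two pullbacks to `R` agree. -/
def IsInvariant {R X : Scheme.{u}} (pr act : R ⟶ X) (V : X.Opens) (f : Γ(X, V)) : Prop :=
  pr.appLE V (pr ⁻¹ᵁ V ⊓ act ⁻¹ᵁ V) inf_le_left f =
    act.appLE V (pr ⁻¹ᵁ V ⊓ act ⁻¹ᵁ V) inf_le_right f

/-- `π : X → Y` is a geometric quotient (in the sense of Mumford) for the action of a group `G`
on `X` with `R = G × X`, second projection `pr : G × X → X` and action map
`act : G × X → X`. -/
structure IsGeometricQuotient {R X Y : Scheme.{u}} (pr act : R ⟶ X) (π : X ⟶ Y) : Prop where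
  /-- `π` is constant on orbits -/
  invariant : pr ≫ π = act ≫ π
  /-- `π` is surjective, and a subset of `Y` is open iff its preimage is -/
  isQuotientMap : Topology.IsQuotientMap π
  /-- two geometric points of `X` with the same image in `Y` lie in one orbit -/
  orbit : ∀ (K : Type u) [Field K] [IsAlgClosed K] (x y : Spec (.of K) ⟶ X),
    x ≫ π = y ≫ π → ∃ g : Spec (.of K) ⟶ R, g ≫ pr = x ∧ g ≫ act = y
  /-- functions on `Y` are the invariant functions on `X` -/
  functions : ∀ V : Y.Opens, Function.Injective (π.app V) ∧
    ∀ f : Γ(X, π ⁻¹ᵁ V), IsInvariant pr act (π ⁻¹ᵁ V) f → ∃ g : Γ(Y, V), π.app V g = f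

variable (k : Type u) [Field k] {r : ℕ} {ν : Type}

/-- The coordinate ring `k[x_j][t_1^±, …, t_r^±]` of `𝔾_m^r × 𝔸^ν`. -/
abbrev TorusTimesAffine (r : ℕ) (ν : Type) : Type u :=
  AddMonoidAlgebra (MvPolynomial ν k) (Fin r → ℤ)

/-- The comorphism `x_j ↦ x_j` of the projection `𝔾_m^r × 𝔸^ν → 𝔸^ν`. -/
def prHom (r : ℕ) (ν : Type) : MvPolynomial ν k →+* TorusTimesAffine k r ν :=
  AddMonoidAlgebra.singleZeroRingHom

/-- The comorphism `x_j ↦ ∏ᵢ tᵢ ^ (A i j) * x_j` of the action of `𝔾_m^r` on `𝔸^ν` with weight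
matrix `A`. -/
def actHom (A : Matrix (Fin r) ν ℤ) : MvPolynomial ν k →ₐ[k] TorusTimesAffine k r ν :=
  MvPolynomial.aeval fun j => AddMonoidAlgebra.single (fun i => A i j) (MvPolynomial.X j)

/-- The projection `𝔾_m^r × 𝔸^ν → 𝔸^ν`. -/
def affinePr (r : ℕ) (ν : Type) :
    Spec (.of (TorusTimesAffine k r ν)) ⟶ Spec (.of (MvPolynomial ν k)) :=
  Spec.map (CommRingCat.ofHom (prHom k r ν))

/-- The action `𝔾_m^r × 𝔸^ν → 𝔸^ν`,
`(t, x) ↦ (∏ᵢ tᵢ ^ (A i j) * x_j)_j`, with weight matrix `A`. -/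
def affineAct (A : Matrix (Fin r) ν ℤ) :
    Spec (.of (TorusTimesAffine k r ν)) ⟶ Spec (.of (MvPolynomial ν k)) :=
  Spec.map (CommRingCat.ofHom (actHom k A).toRingHom)

variable {k}

/-- The open subscheme `𝔸^ν ∖ V(I)`. -/
def complement (I : Ideal (MvPolynomial ν k)) : (Spec (.of (MvPolynomial ν k))).Opens :=
  ⟨(PrimeSpectrum.zeroLocus (I : Set (MvPolynomial ν k)))ᶜ,
    (PrimeSpectrum.isClosed_zeroLocus _).isOpen_compl⟩

/-- `𝔸^ν ∖ V(I)` as a scheme over `k`. -/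
def complementOver (I : Ideal (MvPolynomial ν k)) : Over (Spec (.of k)) :=
  Over.mk ((complement I).ι ≫
    Spec.map (CommRingCat.ofHom (algebraMap k (MvPolynomial ν k))))

/-- `𝔸^ν ∖ V(I)` is stable under the action of `𝔾_m^r` with weights `A`. -/
def IsStable (A : Matrix (Fin r) ν ℤ) (I : Ideal (MvPolynomial ν k)) : Prop :=
  affinePr k r ν ⁻¹ᵁ complement I ≤ affineAct k A ⁻¹ᵁ complement I

/-- The projection `𝔾_m^r × (𝔸^ν ∖ V(I)) → 𝔸^ν ∖ V(I)`. -/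
def complementPr (r : ℕ) (I : Ideal (MvPolynomial ν k)) :
    (affinePr k r ν ⁻¹ᵁ complement I).toScheme ⟶ (complement I).toScheme :=
  affinePr k r ν ∣_ complement I

/-- The action `𝔾_m^r × (𝔸^ν ∖ V(I)) → 𝔸^ν ∖ V(I)` with weights `A`. -/
def complementAct {A : Matrix (Fin r) ν ℤ} {I : Ideal (MvPolynomial ν k)} (h : IsStable A I) :
    (affinePr k r ν ⁻¹ᵁ complement I).toScheme ⟶ (complement I).toScheme :=
  (affineAct k A).resLE _ _ h

/-- `(X, π)` is the variety `(A, I)`: the geometric quotient over `k` of `𝔸^ν ∖ V(I)` by the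
action of `𝔾_m^r` with weights `A`. -/
def IsQuotientVariety {A : Matrix (Fin r) ν ℤ} {I : Ideal (MvPolynomial ν k)} (h : IsStable A I)
    (X : Over (Spec (.of k))) (π : complementOver I ⟶ X) : Prop :=
  IsGeometricQuotient (complementPr r I) (complementAct h) π.left

end Quotients

section Bundle

/-- `P(a_0, …, a_m)` is a well-formed weighted projective space: the weights are positive, and
any `m` of the `m + 1` weights have highest common factor `1`. -/
def IsWellFormed {m : ℕ} (a : Fin (m + 1) → ℕ) : Prop :=
  (∀ i, 0 < a i) ∧ ∀ i, (Finset.univ.erase i).gcd a = 1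

/-- The weight matrix with columns `(1, 0)` (for `x_0, …, x_n`) and `(-ω_i, a_i)`
(for `y_0, …, y_m`). -/
def weights (n : ℕ) {m : ℕ} (a ω : Fin (m + 1) → ℕ) :
    Matrix (Fin 2) (Fin (n + 1) ⊕ Fin (m + 1)) ℤ :=
  Matrix.of ![Sum.elim (fun _ => 1) (fun i => -(ω i : ℤ)), Sum.elim (fun _ => 0) (fun i => (a i : ℤ))]

/-- The irrelevant ideal `(x_0, …, x_n) ∩ (y_0, …, y_m)`. -/
def irrelevantIdeal (k : Type u) [Field k] (n m : ℕ) :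
    Ideal (MvPolynomial (Fin (n + 1) ⊕ Fin (m + 1)) k) :=
  Ideal.span (Set.range fun j : Fin (n + 1) => MvPolynomial.X (Sum.inl j)) ⊓
    Ideal.span (Set.range fun i : Fin (m + 1) => MvPolynomial.X (Sum.inr i))

lemma mem_complement_irrelevantIdeal {k : Type u} [Field k] {n m : ℕ}
    (P : PrimeSpectrum (MvPolynomial (Fin (n + 1) ⊕ Fin (m + 1)) k)) :
    P ∈ complement (irrelevantIdeal k n m) ↔
      (∃ j, MvPolynomial.X (Sum.inl j) ∉ P.asIdeal) ∧
        ∃ i, MvPolynomial.X (Sum.inr i) ∉ P.asIdeal := by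
  change P ∉ PrimeSpectrum.zeroLocus _ ↔ _
  rw [irrelevantIdeal, PrimeSpectrum.zeroLocus_inf, Set.mem_union, not_or]
  simp only [PrimeSpectrum.mem_zeroLocus, SetLike.coe_subset_coe, Ideal.span_le,
    Set.range_subset_iff, not_forall, SetLike.mem_coe]

lemma isStable (k : Type u) [Field k] (n : ℕ) {m : ℕ} (a ω : Fin (m + 1) → ℕ) :
    IsStable (weights n a ω) (irrelevantIdeal k n m) := by
  have key : ∀ (P : PrimeSpectrum (TorusTimesAffine k 2 (Fin (n + 1) ⊕ Fin (m + 1)))) j,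
      prHom k 2 _ (MvPolynomial.X j) ∉ P.asIdeal →
        actHom k (weights n a ω) (MvPolynomial.X j) ∉ P.asIdeal := by
    intro P j hj h
    apply hj
    have := P.asIdeal.mul_mem_left
      (AddMonoidAlgebra.single (-fun i => weights n a ω i j) 1) h
    rwa [actHom, MvPolynomial.aeval_X, AddMonoidAlgebra.single_mul_single, one_mul,
      neg_add_cancel] at this
  intro P hP
  have hP' := (mem_complement_irrelevantIdeal (affinePr k 2 _ P)).1 hP
  obtain ⟨⟨j, hj⟩, i, hi⟩ := hP'
  exact (mem_complement_irrelevantIdeal (affineAct k (weights n a ω) P)).2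
    ⟨⟨j, key P _ hj⟩, i, key P _ hi⟩

/-- The vectors `β_0, …, β_m` of `ℤ^{m+n}`: `β_1, …, β_m` are standard basis vectors and
`β_0 = -∑_{i=1}^m a_i β_i`. -/
def beta (n : ℕ) {m : ℕ} (a : Fin (m + 1) → ℕ) : Fin (m + 1) → (Fin m ⊕ Fin n → ℤ) :=
  Fin.cons (-∑ i : Fin m, a i.succ • Pi.single (Sum.inl i) 1) fun i => Pi.single (Sum.inl i) 1

/-- The vectors `α_0, …, α_n` of `ℤ^{m+n}`: `α_1, …, α_n` are standard basis vectors and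
`α_0 = -∑_{j=1}^n α_j + ∑_{i=0}^m ω_i β_i`. -/
def alpha (n : ℕ) {m : ℕ} (a ω : Fin (m + 1) → ℕ) : Fin (n + 1) → (Fin m ⊕ Fin n → ℤ) :=
  Fin.cons (-∑ j : Fin n, Pi.single (Sum.inr j) 1 + ∑ i : Fin (m + 1), ω i • beta n a i)
    fun j => Pi.single (Sum.inr j) 1

/-- The cone `σ_{rs}` generated by all `β_i`, `i ≠ r`, and all `α_j`, `j ≠ s`. -/
def sigma (n : ℕ) {m : ℕ} (a ω : Fin (m + 1) → ℕ) (r : Fin (m + 1)) (s : Fin (n + 1)) :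
    Cone (Fin m ⊕ Fin n) :=
  coneOf (beta n a '' {i | i ≠ r} ∪ alpha n a ω '' {j | j ≠ s})

/-- The set `Σ` of all faces of the cones `σ_{rs}`. -/
def bundleFan (n : ℕ) {m : ℕ} (a ω : Fin (m + 1) → ℕ) : Set (Cone (Fin m ⊕ Fin n)) :=
  {τ | ∃ r s, IsFace τ (sigma n a ω r s)}

end Bundle

end WeightedBundle

end

open WeightedBundle

/-! Cox's quotient construction. Let `ρ` be the matrix whose rows are the ray generators, so that
`0 → M → ℤ^ν → ℤ²` is exact with maps `ρ` and `A`. On the open set of `𝔸^ν` where the coordinates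
of the rays outside `S` do not vanish, a Laurent monomial is invariant iff its exponent lies in
`ker A = M`, and it is regular iff that exponent pairs nonnegatively with the rays in `S`; the
invariants are therefore `k[S_σ]` for the cone `σ` spanned by `S`, and these charts glue to a map
`q` to the toric variety. As the rays of a cone are linearly independent, some multiple of every
weight is the weight of a unit on the chart, which makes `q` open. Two points of one fibre become
equivalent over an algebraically closed field, because there the torus is divisible. Finally a
geometric quotient is a categorical quotient, hence unique up to a unique isomorphism. -/

noncomputable section

namespace WeightedBundle

section CategoricalQuotient

lemma exists_comp_eq_of_mem_range {A B C : Type*} [CommRing A] [CommRing B] [CommRing C]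
    {f : A →+* B} {g : C →+* B} (hf : Function.Injective f) (h : ∀ c, g c ∈ f.range) :
    ∃ t : C →+* A, f.comp t = g := by
  let e : A ≃+* f.range :=
    RingEquiv.ofBijective f.rangeRestrict
      ⟨fun _ _ h => hf (congrArg Subtype.val h), f.rangeRestrict_surjective⟩
  refine ⟨(e.symm : f.range →+* A).comp (g.codRestrict f.range h), RingHom.ext fun c => ?_⟩
  exact congrArg Subtype.val (e.apply_symm_apply ⟨g c, h c⟩)

lemma exists_desc_of_app {X Y Z : Scheme.{u}} {π : X ⟶ Y} {ψ : X ⟶ Z}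
    (hπ : Function.Surjective π) (hinj : ∀ U, Function.Injective (π.app U)) (b : C(Y, Z))
    (hb : ∀ x, b (π x) = ψ x) (hle : ∀ V : Z.Opens, π ⁻¹ᵁ V.comap b ≤ ψ ⁻¹ᵁ V)
    (T : ∀ V : Z.Opens, Γ(Z, V) ⟶ Γ(Y, V.comap b))
    (hT : ∀ V, T V ≫ π.app _ = ψ.appLE V (π ⁻¹ᵁ V.comap b) (hle V)) :
    ∃ g : Y ⟶ Z, π ≫ g = ψ := by
  have mono : ∀ U, Mono (π.app U) := fun U => ConcreteCategory.mono_of_injective _ (hinj U)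
  let g₀ : Y.toPresheafedSpace.Hom Z.toPresheafedSpace :=
    { base := TopCat.ofHom b
      c :=
        { app := fun V => T V.unop
          naturality := fun V V' i => by
            change Z.presheaf.map i ≫ T V'.unop = T V.unop ≫ Y.presheaf.map
              (homOfLE (fun y hy => i.unop.le hy) : V'.unop.comap b ⟶ V.unop.comap b).op
            rw [← cancel_mono (π.app (V'.unop.comap b)), Category.assoc, hT, Category.assoc,
              Scheme.Hom.naturality, ← Category.assoc, hT, Scheme.Hom.map_appLE,
              Scheme.Hom.appLE_map] } }
  have isLocalHom_stalkMap : ∀ y, IsLocalHom (g₀.stalkMap y).hom := by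
    intro y
    obtain ⟨x, rfl⟩ := hπ y
    refine ⟨fun a ha => ?_⟩
    obtain ⟨V, hV, s, rfl⟩ := TopCat.Presheaf.exists_germ_eq Z.presheaf a
    rw [PresheafedSpace.stalkMap_germ_apply g₀ V (π x) hV] at ha
    have hY : π x ∈ Y.basicOpen (T V s) := (Y.mem_basicOpen _ _ _).2 ha
    have hX : x ∈ X.basicOpen (ψ.appLE V (π ⁻¹ᵁ V.comap b) (hle V) s) := by
      rw [← hT, CommRingCat.comp_apply, ← Scheme.preimage_basicOpen]
      exact hY
    rw [Scheme.basicOpen_appLE] at hX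
    have hZ : b (π x) ∈ Z.basicOpen s := (hb x).symm ▸ hX.2
    exact (Z.mem_basicOpen _ _ _).1 hZ
  let g : Y ⟶ Z := ⟨⟨g₀, isLocalHom_stalkMap⟩⟩
  have hbase : (π ≫ g).base = ψ.base := by
    ext x
    exact hb x
  refine ⟨g, Scheme.Hom.ext hbase fun V => ?_⟩
  have happ : (π ≫ g).app V = ψ.appLE V (π ⁻¹ᵁ V.comap b) (hle V) := hT V
  exact (congrArg (· ≫ X.presheaf.map (eqToHom _).op) happ).trans
    ((Scheme.Hom.appLE_map ψ (hle V) _).trans (Scheme.Hom.app_eq_appLE ψ).symm)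

namespace IsGeometricQuotient

variable {R X Y Z : Scheme.{u}} {pr act : R ⟶ X} {π : X ⟶ Y}

lemma apply_eq (h : IsGeometricQuotient pr act π) {ψ : X ⟶ Z} (hψ : pr ≫ ψ = act ≫ ψ)
    {x x' : X} (hx : π x = π x') : ψ x = ψ x' := by
  obtain ⟨z, hz, hz'⟩ := Scheme.Pullback.exists_preimage_pullback x x' hx
  let K := AlgebraicClosure ((pullback π π).residueField z)
  let p : Spec (.of K) ⟶ pullback π π :=
    Spec.map (CommRingCat.ofHom (algebraMap ((pullback π π).residueField z) K)) ≫
      (pullback π π).fromSpecResidueField z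
  let y : Spec (.of K) := (default : PrimeSpectrum K)
  have hp : p y = z := by
    simp only [p, Scheme.Hom.comp_apply]
    exact Scheme.fromSpecResidueField_apply z _
  obtain ⟨g, hg, hg'⟩ := h.orbit K (p ≫ pullback.fst π π) (p ≫ pullback.snd π π)
    (by simp only [Category.assoc, pullback.condition])
  have e : (p ≫ pullback.fst π π) ≫ ψ = (p ≫ pullback.snd π π) ≫ ψ := by
    rw [← hg, ← hg', Category.assoc, Category.assoc, hψ]
  have := congrArg (fun f : Spec (.of K) ⟶ Z => f y) e
  simpa only [Scheme.Hom.comp_apply, hp, hz, hz'] using this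

lemma surjective (h : IsGeometricQuotient pr act π) : Function.Surjective π :=
  h.isQuotientMap.surjective

lemma epi (h : IsGeometricQuotient pr act π) : Epi π where
  left_cancellation {Z} f g hfg := by
    have hbase : f.base = g.base := by
      ext y
      obtain ⟨x, rfl⟩ := h.surjective y
      simpa using congrArg (fun f : X ⟶ Z => f x) hfg
    refine Scheme.Hom.ext hbase fun U => ?_
    have : Mono (π.app (g ⁻¹ᵁ U)) :=
      ConcreteCategory.mono_of_injective _ (h.functions (g ⁻¹ᵁ U)).1
    rw [← cancel_mono (π.app (g ⁻¹ᵁ U)), Scheme.Hom.app_eq_appLE π, Category.assoc,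
      Scheme.Hom.map_appLE, Scheme.Hom.app_eq_appLE f, Scheme.Hom.appLE_comp_appLE,
      Scheme.Hom.app_eq_appLE g, Scheme.Hom.appLE_comp_appLE]
    congr 1

lemma exists_base (h : IsGeometricQuotient pr act π) {ψ : X ⟶ Z} (hψ : pr ≫ ψ = act ≫ ψ) :
    ∃ b : C(Y, Z), ∀ x, b (π x) = ψ x := by
  let f : C(X, Y) := ⟨π, π.continuous⟩
  have hf : Topology.IsQuotientMap f := h.isQuotientMap
  let g : C(X, Z) := ⟨ψ, ψ.continuous⟩
  have hg : Function.FactorsThrough g f := fun x x' hx => h.apply_eq hψ hx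
  exact ⟨hf.lift g hg, fun x => congrArg (fun k : C(X, Z) => k x) (hf.lift_comp g hg)⟩

lemma isInvariant_appLE {ψ : X ⟶ Z} (hψ : pr ≫ ψ = act ≫ ψ) (V : Z.Opens)
    (U : X.Opens) (e : U ≤ ψ ⁻¹ᵁ V) (s : Γ(Z, V)) : IsInvariant pr act U (ψ.appLE V U e s) := by
  have h : ψ.appLE V U e ≫ pr.appLE U (pr ⁻¹ᵁ U ⊓ act ⁻¹ᵁ U) inf_le_left =
      ψ.appLE V U e ≫ act.appLE U (pr ⁻¹ᵁ U ⊓ act ⁻¹ᵁ U) inf_le_right := by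
    simp only [Scheme.Hom.appLE_comp_appLE, hψ]
  exact congrArg (fun k => k.hom s) h

lemma exists_desc (h : IsGeometricQuotient pr act π) {ψ : X ⟶ Z} (hψ : pr ≫ ψ = act ≫ ψ) :
    ∃ g : Y ⟶ Z, π ≫ g = ψ := by
  obtain ⟨b, hb⟩ := h.exists_base hψ
  have hle (V : Z.Opens) : π ⁻¹ᵁ V.comap b ≤ ψ ⁻¹ᵁ V := fun x hx => by
    change ψ x ∈ V
    rw [← hb]
    exact hx
  have exists_app (V : Z.Opens) :
      ∃ t : Γ(Z, V) →+* Γ(Y, V.comap b), (π.app _).hom.comp t = (ψ.appLE V _ (hle V)).hom :=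
    exists_comp_eq_of_mem_range (h.functions _).1
      fun s => (h.functions _).2 _ (isInvariant_appLE hψ V _ (hle V) s)
  choose t ht using exists_app
  exact exists_desc_of_app h.surjective (fun U => (h.functions U).1) b hb hle
    (fun V => CommRingCat.ofHom (t V)) fun V => CommRingCat.hom_ext (ht V)

end IsGeometricQuotient

lemma exists_iso_of_isGeometricQuotient {S R : Scheme.{u}} {X Y Z : Over S}
    {pr act : R ⟶ X.left} {π : X ⟶ Y} {ρ : X ⟶ Z} (h : IsGeometricQuotient pr act π.left)
    (h' : IsGeometricQuotient pr act ρ.left) : ∃ e : Y ≅ Z, π ≫ e.hom = ρ := by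
  obtain ⟨f, hf⟩ := h.exists_desc h'.invariant
  obtain ⟨g, hg⟩ := h'.exists_desc h.invariant
  have := h.epi
  have := h'.epi
  have hfg : f ≫ g = 𝟙 _ := by rw [← cancel_epi π.left, reassoc_of% hf, hg, Category.comp_id]
  have hgf : g ≫ f = 𝟙 _ := by rw [← cancel_epi ρ.left, reassoc_of% hg, hf, Category.comp_id]
  have hw : f ≫ Z.hom = Y.hom := by
    rw [← cancel_epi π.left, reassoc_of% hf, Over.w, Over.w]
  refine ⟨Over.isoMk ⟨f, g, hfg, hgf⟩ hw, ?_⟩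
  ext1
  exact hf

end CategoricalQuotient

section GradedChart

/-- The coaction `act : B → B[G]` is a grading of `B` by the characters `G` of a diagonalizable
group, its invariants are the image of `i`, and for every occurring weight `χ` some positive
multiple of `-χ` is the weight of a unit. This is the algebra of an affine chart of a quotient. -/
structure IsGradedChart {A B G : Type*} [CommRing A] [CommRing B] [AddCommGroup G]
    (i : A →+* B) (act : B →+* AddMonoidAlgebra B G) : Prop where
  injective : Function.Injective i
  act_apply : ∀ a, act (i a) = AddMonoidAlgebra.single 0 (i a)
  coeff_zero_mem : ∀ b, (act b).coeff 0 ∈ i.range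
  act_coeff : ∀ b χ, act ((act b).coeff χ) = AddMonoidAlgebra.single χ ((act b).coeff χ)
  sum_coeff : ∀ b, ((act b).coeff.sum fun _ c => c) = b
  exists_unit : ∀ b χ, (act b).coeff χ ≠ 0 → ∃ N : ℕ, N ≠ 0 ∧ ∃ w : Bˣ,
    act w = AddMonoidAlgebra.single (-(N • χ)) (w : B)

namespace IsGradedChart

variable {A B G : Type*} [CommRing A] [CommRing B] [AddCommGroup G]
  {i : A →+* B} {act : B →+* AddMonoidAlgebra B G}

lemma mem_range (h : IsGradedChart i act) {b : B} (hb : act b = AddMonoidAlgebra.single 0 b) :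
    b ∈ i.range := by
  have := h.coeff_zero_mem b
  rwa [hb, AddMonoidAlgebra.coeff_single, Finsupp.single_eq_same] at this

lemma coeff_zero_mul (h : IsGradedChart i act) (a : A) (b : B) :
    (act (i a * b)).coeff 0 = i a * (act b).coeff 0 := by
  rw [map_mul, h.act_apply, AddMonoidAlgebra.coeff_single_zero_mul]

lemma exists_retraction (h : IsGradedChart i act) :
    ∃ E : B →+ A, (∀ a b, E (i a * b) = a * E b) ∧ ∀ a, E (i a) = a := by
  choose E hE using h.coeff_zero_mem
  refine ⟨AddMonoidHom.mk' E fun x y => h.injective ?_, fun a x => h.injective ?_,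
    fun a => h.injective ?_⟩
  · rw [hE, map_add, map_add, hE, hE, AddMonoidAlgebra.coeff_add, Finsupp.add_apply]
  · change i (E (i a * x)) = i (a * E x)
    rw [map_mul, hE, hE, h.coeff_zero_mul]
  · rw [AddMonoidHom.mk'_apply, hE, h.act_apply, AddMonoidAlgebra.coeff_single,
      Finsupp.single_eq_same]

lemma comap_map (h : IsGradedChart i act) (I : Ideal A) : (I.map i).comap i = I := by
  obtain ⟨E, hEmul, hEi⟩ := h.exists_retraction
  have retraction_mem : ∀ b ∈ I.map i, ∀ c, E (c * b) ∈ I := by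
    intro b hb
    induction hb using Submodule.span_induction with
    | mem x hx =>
      obtain ⟨a, ha, rfl⟩ := hx
      intro c
      rw [mul_comm, hEmul]
      exact I.mul_mem_right _ ha
    | zero => intro c; rw [mul_zero, map_zero]; exact I.zero_mem
    | add x y _ _ hx hy => intro c; rw [mul_add, map_add]; exact I.add_mem (hx c) (hy c)
    | smul d x _ hx => intro c; rw [smul_eq_mul, ← mul_assoc]; exact hx _
  refine le_antisymm (fun a ha => ?_) Ideal.le_comap_map
  simpa only [one_mul, hEi] using retraction_mem _ ha 1

lemma comap_surjective (h : IsGradedChart i act) :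
    Function.Surjective (PrimeSpectrum.comap i) := fun p =>
  (PrimeSpectrum.mem_range_comap_iff i).2 (h.comap_map p.asIdeal)

lemma isOpen_image_basicOpen_coeff (h : IsGradedChart i act) (b : B) (χ : G) :
    IsOpen (PrimeSpectrum.comap i ''
      (PrimeSpectrum.basicOpen ((act b).coeff χ) : Set (PrimeSpectrum B))) := by
  set c := (act b).coeff χ
  rcases eq_or_ne c 0 with hc | hc
  · simp [hc]
  obtain ⟨N, hN, w, hw⟩ := h.exists_unit b χ hc
  obtain ⟨a, ha⟩ : c ^ N * w ∈ i.range := h.mem_range (by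
    rw [map_mul, map_pow, h.act_coeff, hw, AddMonoidAlgebra.single_pow,
      AddMonoidAlgebra.single_mul_single, add_neg_cancel])
  have e : (PrimeSpectrum.basicOpen c : Set (PrimeSpectrum B)) =
      PrimeSpectrum.comap i ⁻¹' (PrimeSpectrum.basicOpen a) := by
    ext P
    change c ∉ P.asIdeal ↔ i a ∉ P.asIdeal
    rw [ha, not_iff_not, Ideal.mul_unit_mem_iff_mem _ w.isUnit]
    exact ⟨fun h => P.asIdeal.pow_mem_of_mem h _ (Nat.pos_of_ne_zero hN),
      fun h => P.2.mem_of_pow_mem _ h⟩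
  rw [e, Set.image_preimage_eq _ h.comap_surjective]
  exact (PrimeSpectrum.basicOpen a).isOpen

-- For a prime `P`, the kernel of `B → (B ⧸ P)[G]` is a prime over the same point of `Spec A`; it
-- contains `b` iff `P` contains all homogeneous components of `b`.
lemma image_basicOpen_eq [UniqueSums G] (h : IsGradedChart i act) (b : B) :
    PrimeSpectrum.comap i '' (PrimeSpectrum.basicOpen b : Set (PrimeSpectrum B)) =
      ⋃ χ, PrimeSpectrum.comap i ''
        (PrimeSpectrum.basicOpen ((act b).coeff χ) : Set (PrimeSpectrum B)) := by
  refine subset_antisymm ?_ (Set.iUnion_subset fun χ => ?_)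
  · rintro _ ⟨P, hP, rfl⟩
    obtain ⟨χ, hχ⟩ : ∃ χ, (act b).coeff χ ∉ P.asIdeal := by
      by_contra! hcon
      refine hP ?_
      rw [← h.sum_coeff b]
      exact Submodule.sum_mem _ fun χ _ => hcon χ
    exact Set.mem_iUnion.2 ⟨χ, P, hχ, rfl⟩
  · rintro _ ⟨P, hP, rfl⟩
    let f : B →+* AddMonoidAlgebra (B ⧸ P.asIdeal) G :=
      (AddMonoidAlgebra.mapRingHom G (Ideal.Quotient.mk P.asIdeal)).comp act
    let Q : PrimeSpectrum B := ⟨RingHom.ker f, RingHom.ker_isPrime f⟩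
    refine ⟨Q, fun hQ => hP ?_, ?_⟩
    · have hfb : f b = 0 := hQ
      have hcoeff := congrArg (fun x => AddMonoidAlgebra.coeff x χ) hfb
      exact Ideal.Quotient.eq_zero_iff_mem.1 (by simpa [f] using hcoeff)
    · ext a
      change f (i a) = 0 ↔ i a ∈ P.asIdeal
      rw [RingHom.comp_apply, h.act_apply, AddMonoidAlgebra.mapRingHom_single,
        AddMonoidAlgebra.single_eq_zero, Ideal.Quotient.eq_zero_iff_mem]

lemma isOpenMap_comap [UniqueSums G] (h : IsGradedChart i act) :
    IsOpenMap (PrimeSpectrum.comap i) := by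
  rw [PrimeSpectrum.isTopologicalBasis_basic_opens.isOpenMap_iff]
  rintro _ ⟨b, rfl⟩
  rw [h.image_basicOpen_eq]
  exact isOpen_iUnion fun χ => h.isOpen_image_basicOpen_coeff b χ

lemma exists_act_localization (h : IsGradedChart i act)
    (f : A) (B' : Type*) [CommRing B'] [Algebra B B'] [IsLocalization.Away (i f) B'] :
    ∃ act' : B' →+* AddMonoidAlgebra B' G, ∀ b, act' (algebraMap B B' b) =
      AddMonoidAlgebra.mapRingHom G (algebraMap B B') (act b) := by
  have hact : IsUnit ((AddMonoidAlgebra.mapRingHom G (algebraMap B B')).comp act (i f)) := by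
    rw [RingHom.comp_apply, h.act_apply, AddMonoidAlgebra.mapRingHom_single]
    exact (IsLocalization.Away.algebraMap_isUnit (S := B') (i f)).map
      (AddMonoidAlgebra.singleZeroRingHom : B' →+* AddMonoidAlgebra B' G)
  exact ⟨IsLocalization.Away.lift (i f) hact, fun b => IsLocalization.Away.lift_eq (i f) hact b⟩

lemma mem_range_of_localization (h : IsGradedChart i act) (f : A) {A' B' : Type*} [CommRing A']
    [CommRing B'] [Algebra A A'] [Algebra B B'] [IsLocalization.Away f A']
    [IsLocalization.Away (i f) B'] {i' : A' →+* B'} {act' : B' →+* AddMonoidAlgebra B' G}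
    (hi' : ∀ a, i' (algebraMap A A' a) = algebraMap B B' (i a))
    (hact' : ∀ b, act' (algebraMap B B' b) =
      AddMonoidAlgebra.mapRingHom G (algebraMap B B') (act b))
    {x : B'} (hx : act' x = AddMonoidAlgebra.single 0 x) : x ∈ i'.range := by
  obtain ⟨N, b, hb⟩ := IsLocalization.Away.surj (i f) x
  obtain ⟨a, ha⟩ := h.coeff_zero_mem b
  have e : algebraMap B B' (i a) = algebraMap B B' b := by
    have h₁ := congrArg (fun y => AddMonoidAlgebra.coeff (act' y) 0) hb
    simp only [map_mul, map_pow, hx, hact', h.act_apply, AddMonoidAlgebra.mapRingHom_single,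
      AddMonoidAlgebra.single_pow, AddMonoidAlgebra.single_mul_single, smul_zero, add_zero,
      AddMonoidAlgebra.coeff_mapRingHom] at h₁
    rw [ha, ← hb]
    simpa using h₁.symm
  obtain ⟨u, hu⟩ := (IsLocalization.Away.algebraMap_isUnit (S := A') f).pow N
  refine ⟨algebraMap A A' a * ↑u⁻¹, ?_⟩
  have hu' : i' (u : A') = algebraMap B B' (i f) ^ N := by rw [hu, map_pow, hi']
  rw [map_mul, hi', e, ← hb, ← hu', mul_assoc, ← map_mul, Units.mul_inv, map_one, mul_one]

end IsGradedChart

end GradedChart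

section Functions

variable {R X Y : Scheme.{u}} {pr act : R ⟶ X} {π : X ⟶ Y}

lemma IsInvariant.restrict {U U' : X.Opens} (h : U' ≤ U) {f : Γ(X, U)}
    (hf : IsInvariant pr act U f) :
    IsInvariant pr act U' (X.presheaf.map (homOfLE h).op f) := by
  have hle : pr ⁻¹ᵁ U' ⊓ act ⁻¹ᵁ U' ≤ pr ⁻¹ᵁ U ⊓ act ⁻¹ᵁ U :=
    inf_le_inf (fun _ hx => h hx) (fun _ hx => h hx)
  have := congrArg (R.presheaf.map (homOfLE hle).op) hf
  rw [← CommRingCat.comp_apply, ← CommRingCat.comp_apply, Scheme.Hom.appLE_map,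
    Scheme.Hom.appLE_map] at this
  rw [IsInvariant, ← CommRingCat.comp_apply, ← CommRingCat.comp_apply, Scheme.Hom.map_appLE,
    Scheme.Hom.map_appLE]
  exact this

lemma IsInvariant.appLE_eq {Z : Scheme.{u}} {U : X.Opens} {f : Γ(X, U)}
    (hf : IsInvariant pr act U f) (J : Z ⟶ R) (V : Z.Opens) (h : V ≤ (J ≫ pr) ⁻¹ᵁ U)
    (h' : V ≤ (J ≫ act) ⁻¹ᵁ U) : (J ≫ pr).appLE U V h f = (J ≫ act).appLE U V h' f := by
  have hV : V ≤ J ⁻¹ᵁ (pr ⁻¹ᵁ U ⊓ act ⁻¹ᵁ U) := le_inf h h'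
  have := congrArg (J.appLE _ V hV) hf
  rwa [← CommRingCat.comp_apply, ← CommRingCat.comp_apply, Scheme.Hom.appLE_comp_appLE,
    Scheme.Hom.appLE_comp_appLE] at this

variable (pr act π) in
/-- The sections of `O_Y` over `V` are the invariant sections of `O_X` over `π⁻¹ V`. -/
def SectionsAreInvariants (V : Y.Opens) : Prop :=
  Function.Injective (π.app V) ∧
    ∀ f : Γ(X, π ⁻¹ᵁ V), IsInvariant pr act (π ⁻¹ᵁ V) f → ∃ g : Γ(Y, V), π.app V g = f

lemma injective_app_of_basis
    (h : ∀ (V : Y.Opens), ∀ y ∈ V, ∃ W ≤ V, y ∈ W ∧ Function.Injective (π.app W))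
    (V : Y.Opens) : Function.Injective (π.app V) := by
  intro s t hst
  choose W hWV hyW hW using fun y : V => h V y y.2
  refine Y.sheaf.eq_of_locally_eq' W V (fun y => homOfLE (hWV y))
    (fun y hy => TopologicalSpace.Opens.mem_iSup.2 ⟨⟨y, hy⟩, hyW _⟩) s t fun y => hW y ?_
  change π.app (W y) (Y.presheaf.map (homOfLE (hWV y)).op s) =
    π.app (W y) (Y.presheaf.map (homOfLE (hWV y)).op t)
  rw [← CommRingCat.comp_apply, ← CommRingCat.comp_apply, Scheme.Hom.naturality,
    CommRingCat.comp_apply, CommRingCat.comp_apply, hst]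

lemma sectionsAreInvariants_of_basis
    (h : ∀ (V : Y.Opens), ∀ y ∈ V, ∃ W ≤ V, y ∈ W ∧ SectionsAreInvariants pr act π W)
    (V : Y.Opens) : SectionsAreInvariants pr act π V := by
  have inj : ∀ V : Y.Opens, Function.Injective (π.app V) := injective_app_of_basis
    fun V y hy => (h V y hy).imp fun W hW => ⟨hW.1, hW.2.1, hW.2.2.1⟩
  refine ⟨inj V, fun f hf => ?_⟩
  choose W hWV hyW hW using fun y : V => h V y y.2
  have hle : ∀ y, π ⁻¹ᵁ W y ≤ π ⁻¹ᵁ V := fun y x hx => hWV y hx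
  choose g hg using fun y => (hW y).2 _ (hf.restrict (hle y))
  have hcover : V ≤ iSup W := fun y hy => TopologicalSpace.Opens.mem_iSup.2 ⟨⟨y, hy⟩, hyW _⟩
  obtain ⟨(s : Γ(Y, V)), (hs : ∀ y, Y.presheaf.map (homOfLE (hWV y)).op s = g y), -⟩ :=
    Y.sheaf.existsUnique_gluing' W V (fun y => homOfLE (hWV y)) hcover g
    (fun y z => inj _ (by
      change π.app _ (Y.presheaf.map _ (g y)) = π.app _ (Y.presheaf.map _ (g z))
      rw [← CommRingCat.comp_apply, ← CommRingCat.comp_apply, Scheme.Hom.naturality,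
        Scheme.Hom.naturality, CommRingCat.comp_apply, CommRingCat.comp_apply, hg, hg,
        ← CommRingCat.comp_apply, ← CommRingCat.comp_apply, ← Functor.map_comp,
        ← Functor.map_comp]
      rfl))
  refine ⟨s, X.sheaf.eq_of_locally_eq' (fun y => π ⁻¹ᵁ W y) (π ⁻¹ᵁ V)
    (fun y => homOfLE (hle y)) (fun x hx => ?_) _ _ fun y => ?_⟩
  · exact TopologicalSpace.Opens.mem_iSup.2 ⟨⟨π x, hx⟩, hyW ⟨π x, hx⟩⟩
  · refine Eq.trans ?_ (hg y)
    rw [← hs y]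
    change X.presheaf.map _ (π.app V s) = π.app (W y) (Y.presheaf.map _ s)
    rw [← CommRingCat.comp_apply, ← CommRingCat.comp_apply, Scheme.Hom.naturality]
    rfl

lemma bijective_appLE_top {Z : Scheme.{u}} (j : Z ⟶ X) [IsOpenImmersion j] (U : X.Opens)
    (hU : U ≤ j.opensRange) (e : ⊤ ≤ j ⁻¹ᵁ U) : Function.Bijective (j.appLE U ⊤ e) := by
  have := j.isIso_app U hU
  have h : j ⁻¹ᵁ U = ⊤ := top_le_iff.1 e
  have : IsIso (j.appLE U ⊤ e) := by
    have e' : ((homOfLE e).op : Opposite.op (j ⁻¹ᵁ U) ⟶ Opposite.op ⊤) = (eqToHom h.symm).op := rfl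
    rw [Scheme.Hom.appLE, e']
    infer_instance
  exact ConcreteCategory.bijective_of_isIso _

lemma appLE_comp_appTop {Z : Scheme.{u}} (g : Z ⟶ X) (f : X ⟶ Y) (U : Y.Opens) (e : ⊤ ≤ f ⁻¹ᵁ U)
    (e' : ⊤ ≤ (g ≫ f) ⁻¹ᵁ U) : f.appLE U ⊤ e ≫ g.appTop = (g ≫ f).appLE U ⊤ e' := by
  have h : ⊤ ≤ g ⁻¹ᵁ ⊤ := le_rfl
  have : g.appTop = g.appLE ⊤ ⊤ h := Scheme.Hom.app_eq_appLE g
  rw [this, Scheme.Hom.appLE_comp_appLE]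

lemma ΓSpecIso_hom_apply_appTop {A B : Type u} [CommRing A] [CommRing B] (φ : A →+* B)
    (s : Γ(Spec (.of A), ⊤)) :
    (Scheme.ΓSpecIso (.of B)).hom ((Spec.map (CommRingCat.ofHom φ)).appTop s) =
      φ ((Scheme.ΓSpecIso (.of A)).hom s) :=
  congrArg (fun k => k.hom s) (Scheme.ΓSpecIso_naturality (CommRingCat.ofHom φ))

lemma sectionsAreInvariants_of_bijective {Y' X' R' : Scheme.{u}} {i : Y' ⟶ Y} {j : X' ⟶ X}
    {π' : X' ⟶ Y'} {p α : R' ⟶ X'} {J : R' ⟶ R} {V : Y.Opens} {hi : ⊤ ≤ i ⁻¹ᵁ V}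
    {hj : ⊤ ≤ j ⁻¹ᵁ π ⁻¹ᵁ V} (bi : Function.Bijective (i.appLE V ⊤ hi))
    (bj : Function.Bijective (j.appLE (π ⁻¹ᵁ V) ⊤ hj)) (hπ : Function.Injective π'.appTop)
    (hij : j ≫ π = π' ≫ i) (hp : J ≫ pr = p ≫ j) (hα : J ≫ act = α ≫ j)
    (hinv : ∀ x, p.appTop x = α.appTop x → ∃ y, π'.appTop y = x) :
    SectionsAreInvariants pr act π V := by
  have hle (k : R' ⟶ X') : ⊤ ≤ (k ≫ j) ⁻¹ᵁ π ⁻¹ᵁ V := by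
    rw [Scheme.Hom.comp_preimage, top_le_iff.1 hj]
    exact le_rfl
  have appLE_app (s) : j.appLE _ ⊤ hj (π.app V s) = π'.appTop (i.appLE V ⊤ hi s) := by
    have hjV : ⊤ ≤ (j ≫ π) ⁻¹ᵁ V := hj
    have hiV : ⊤ ≤ (π' ≫ i) ⁻¹ᵁ V := hij ▸ hjV
    have happ : π.app V ≫ j.appLE _ ⊤ hj = i.appLE V ⊤ hi ≫ π'.appTop := by
      rw [← Scheme.Hom.comp_appLE _ _ _ _ hjV, appLE_comp_appTop _ _ _ _ hiV]
      congr 1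
    exact congrArg (fun k => k.hom s) happ
  have appLE_apply (k : R' ⟶ X') (f) :
      (k ≫ j).appLE (π ⁻¹ᵁ V) ⊤ (hle k) f = k.appTop (j.appLE _ ⊤ hj f) := by
    rw [← appLE_comp_appTop k j _ hj, CommRingCat.comp_apply]
  refine ⟨fun s t hst => bi.1 (hπ ?_), fun f hf => ?_⟩
  · rw [← appLE_app, ← appLE_app, hst]
  · have hpα : (p ≫ j).appLE _ ⊤ (hle p) f = (α ≫ j).appLE _ ⊤ (hle α) f := by
      simpa only [hp, hα] using
        hf.appLE_eq J ⊤ (by rw [hp]; exact hle p) (by rw [hα]; exact hle α)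
    rw [appLE_apply, appLE_apply] at hpα
    obtain ⟨y, hy⟩ := hinv _ hpα
    obtain ⟨s, rfl⟩ := bi.2 y
    exact ⟨s, bj.1 (by rw [appLE_app, hy])⟩

lemma sectionsAreInvariants_of_chart {A B C : Type u} [CommRing A] [CommRing B] [CommRing C]
    {i : Spec (.of A) ⟶ Y} {j : Spec (.of B) ⟶ X} [IsOpenImmersion i] [IsOpenImmersion j]
    {φ : A →+* B} (hφ : Function.Injective φ)
    (hij : j ≫ π = Spec.map (CommRingCat.ofHom φ) ≫ i)
    (hrange : π ⁻¹ᵁ i.opensRange ≤ j.opensRange)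
    {p α : B →+* C} {J : Spec (.of C) ⟶ R}
    (hp : J ≫ pr = Spec.map (CommRingCat.ofHom p) ≫ j)
    (hα : J ≫ act = Spec.map (CommRingCat.ofHom α) ≫ j)
    (hinv : ∀ x, p x = α x → x ∈ φ.range) :
    SectionsAreInvariants pr act π i.opensRange := by
  have hj : j ⁻¹ᵁ π ⁻¹ᵁ i.opensRange = ⊤ := by
    rw [← Scheme.Hom.comp_preimage, hij, Scheme.Hom.comp_preimage, Scheme.Hom.preimage_opensRange]
    rfl
  have hi : i ⁻¹ᵁ i.opensRange = ⊤ := i.preimage_opensRange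
  have bA := ConcreteCategory.bijective_of_isIso (Scheme.ΓSpecIso (.of A)).hom
  have bB := ConcreteCategory.bijective_of_isIso (Scheme.ΓSpecIso (.of B)).hom
  refine sectionsAreInvariants_of_bijective (bijective_appLE_top i i.opensRange le_rfl hi.ge)
    (bijective_appLE_top j (π ⁻¹ᵁ i.opensRange) hrange hj.ge) (fun s t hst => ?_) hij hp hα
    fun x hx => ?_
  · apply bA.1
    apply hφ
    rw [← ΓSpecIso_hom_apply_appTop, ← ΓSpecIso_hom_apply_appTop, hst]
  · obtain ⟨a, ha⟩ := hinv ((Scheme.ΓSpecIso (.of B)).hom x) (by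
      rw [← ΓSpecIso_hom_apply_appTop, ← ΓSpecIso_hom_apply_appTop, hx])
    obtain ⟨y, rfl⟩ := bA.2 a
    exact ⟨y, bB.1 (by rw [ΓSpecIso_hom_apply_appTop, ha])⟩

end Functions

section SimplicialFan

open scoped Matrix

variable {ν ι : Type}

/-- The cone generated by the rays `ρ v` with `v ∈ S`. Here and below the rays are the rows of an
integer matrix, so that `ρ *ᵥ u` lists the values of `u ∈ M` on the rays. -/
def rayCone (ρ : Matrix ν ι ℤ) (S : Set ν) : Cone ι := coneOf (ρ.row '' S)

/-- The combination `∑ b_v ρ_v` of the rays, as a linear map in the coefficients. -/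
def rayComb [Fintype ν] (ρ : Matrix ν ι ℤ) : (ν → ℝ) →ₗ[ℝ] (ι → ℝ) :=
  Fintype.linearCombination ℝ fun v => latticeVec (ρ v)

/-- The cones generated by the sets of rays in `𝒮`. -/
def rayFan (ρ : Matrix ν ι ℤ) (𝒮 : Set (Set ν)) : Set (Cone ι) := rayCone ρ '' 𝒮

/-- The sets in `𝒮` are the faces of a simplicial fan with rays `ρ`: faces are closed under passing
to subsets, and a point of the support is in a unique way a nonnegative combination of the rays of
a face. -/
structure IsSimplicial [Fintype ν] (ρ : Matrix ν ι ℤ) (𝒮 : Set (Set ν)) : Prop where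
  isLowerSet : IsLowerSet 𝒮
  injOn : Set.InjOn (rayComb ρ) {b | 0 ≤ b ∧ Function.support b ∈ 𝒮}

variable {ρ : Matrix ν ι ℤ} {S T : Set ν}

lemma pairing_latticeVec_row [Fintype ι] (u : ι → ℤ) (v : ν) :
    pairing u (latticeVec (ρ v)) = ((ρ *ᵥ u) v : ℤ) := by
  rw [pairing_latticeVec, Matrix.mulVec, dotProduct_comm]
  rfl

lemma pairing_rayComb [Fintype ν] [Fintype ι] (u : ι → ℤ) (b : ν → ℝ) :
    pairing u (rayComb ρ b) = ∑ v, b v * ((ρ *ᵥ u) v : ℤ) := by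
  simp only [← pairing_latticeVec_row, pairing, rayComb, Fintype.linearCombination_apply,
    Finset.sum_apply, Pi.smul_apply, smul_eq_mul, Finset.mul_sum]
  rw [Finset.sum_comm]
  exact Finset.sum_congr rfl fun _ _ => Finset.sum_congr rfl fun _ _ => by ring

lemma latticeVec_mem_rayCone {v : ν} (hv : v ∈ S) : latticeVec (ρ v) ∈ rayCone ρ S :=
  Submodule.subset_span ⟨_, ⟨v, hv, rfl⟩, rfl⟩

lemma mem_rayCone [Fintype ν] {w : ι → ℝ} :
    w ∈ rayCone ρ S ↔ ∃ b, 0 ≤ b ∧ Function.support b ⊆ S ∧ rayComb ρ b = w := by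
  classical
  constructor
  · intro h
    induction h using Submodule.span_induction with
    | mem x hx =>
      obtain ⟨_, ⟨v, hv, rfl⟩, rfl⟩ := hx
      refine ⟨Pi.single v 1, Pi.single_nonneg.2 zero_le_one,
        Pi.support_single_subset.trans (Set.singleton_subset_iff.2 hv), ?_⟩
      rw [rayComb, Fintype.linearCombination_apply_single, one_smul, Matrix.row]
    | zero => exact ⟨0, le_rfl, by simp, map_zero _⟩
    | add x y _ _ hx hy =>
      obtain ⟨b, hb, hbS, rfl⟩ := hx
      obtain ⟨c, hc, hcS, rfl⟩ := hy
      exact ⟨b + c, add_nonneg hb hc, (Function.support_add b c).trans (Set.union_subset hbS hcS),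
        map_add _ b c⟩
    | smul c x _ hx =>
      obtain ⟨b, hb, hbS, rfl⟩ := hx
      exact ⟨(c : ℝ) • b, smul_nonneg c.2 hb, (Function.support_const_smul_subset _ b).trans hbS,
        map_smul _ _ b⟩
  · rintro ⟨b, hb, hbS, rfl⟩
    refine Submodule.sum_mem _ fun v _ => ?_
    by_cases hv : b v = 0
    · rw [hv, zero_smul]
      exact Submodule.zero_mem _
    · exact Submodule.smul_mem (rayCone ρ S) (⟨b v, hb v⟩ : {c : ℝ // 0 ≤ c})
        (latticeVec_mem_rayCone (hbS hv))

lemma rayCone_mono (h : S ⊆ T) : rayCone ρ S ≤ rayCone ρ T :=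
  Submodule.span_mono (Set.image_mono (Set.image_mono h))

lemma mem_dualMonoid_rayCone [Fintype ι] {u : ι → ℤ} :
    u ∈ dualMonoid (rayCone ρ S) ↔ ∀ v ∈ S, 0 ≤ (ρ *ᵥ u) v := by
  rw [rayCone, mem_dualMonoid_coneOf, Set.forall_mem_image]
  refine forall₂_congr fun v _ => ?_
  rw [Matrix.row, pairing_latticeVec_row]
  exact Int.cast_nonneg_iff

lemma mem_rayCone_sep [Finite ν] [Fintype ι] {u : ι → ℤ} (hu : ∀ v ∈ S, 0 ≤ (ρ *ᵥ u) v)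
    (w : ι → ℝ) :
    w ∈ rayCone ρ {v ∈ S | (ρ *ᵥ u) v = 0} ↔ w ∈ rayCone ρ S ∧ pairing u w = 0 := by
  cases nonempty_fintype ν
  constructor
  · intro hw
    refine ⟨rayCone_mono (Set.sep_subset _ _) hw, ?_⟩
    obtain ⟨b, -, hbS, rfl⟩ := mem_rayCone.1 hw
    rw [pairing_rayComb]
    refine Finset.sum_eq_zero fun v _ => ?_
    by_cases hv : b v = 0
    · rw [hv, zero_mul]
    · rw [(hbS hv).2, Int.cast_zero, mul_zero]
  · rintro ⟨hw, hu₀⟩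
    obtain ⟨b, hb, hbS, rfl⟩ := mem_rayCone.1 hw
    rw [pairing_rayComb, Finset.sum_eq_zero_iff_of_nonneg] at hu₀
    · refine mem_rayCone.2 ⟨b, hb, fun v hv => ⟨hbS hv, ?_⟩, rfl⟩
      exact_mod_cast (mul_eq_zero.1 (hu₀ v (Finset.mem_univ v))).resolve_left hv
    · intro v _
      by_cases hv : b v = 0
      · rw [hv, zero_mul]
      · exact mul_nonneg (hb v) (by exact_mod_cast hu v (hbS hv))

lemma exists_eq_rayCone_of_isFace [Finite ν] [Fintype ι] {τ : Cone ι}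
    (h : IsFace τ (rayCone ρ S)) :
    ∃ T ⊆ S, τ = rayCone ρ T := by
  obtain ⟨u, hu, hτ⟩ := h
  refine ⟨{v ∈ S | (ρ *ᵥ u) v = 0}, Set.sep_subset _ _, ?_⟩
  ext w
  rw [hτ, mem_rayCone_sep (mem_dualMonoid_rayCone.1 hu)]

namespace IsSimplicial

variable [Fintype ν] {𝒮 : Set (Set ν)}

lemma eq_zero_of_rayComb_eq_zero (h : IsSimplicial ρ 𝒮) (hS : S ∈ 𝒮) {c : ν → ℝ}
    (hcS : Function.support c ⊆ S) (hc : rayComb ρ c = 0) : c = 0 := by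
  have hpos : Function.support c⁺ ⊆ S := fun v hv => hcS fun hv₀ => hv (by simp [hv₀])
  have hneg : Function.support c⁻ ⊆ S := fun v hv => hcS fun hv₀ => hv (by simp [hv₀])
  rw [← posPart_sub_negPart c, map_sub, sub_eq_zero] at hc
  rw [← posPart_sub_negPart c, sub_eq_zero]
  exact h.injOn ⟨posPart_nonneg c, h.isLowerSet hpos hS⟩ ⟨negPart_nonneg c, h.isLowerSet hneg hS⟩ hc

lemma linearIndependent_row (h : IsSimplicial ρ 𝒮) (hS : S ∈ 𝒮) :
    LinearIndependent ℚ ((ρ.submatrix ((↑) : S → ν) id).map (Int.cast : ℤ → ℚ)).row := by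
  classical
  rw [Fintype.linearIndependent_iff]
  intro x hx v
  let c : ν → ℝ := Function.extend ((↑) : S → ν) (fun v => (x v : ℝ)) 0
  have hc (v : S) : c v = x v := Subtype.val_injective.extend_apply _ _ v
  have hc₀ (v) (hv : v ∉ S) : c v = 0 :=
    Function.extend_apply' _ _ _ fun ⟨w, hw⟩ => hv (hw ▸ w.2)
  have hcomb : rayComb ρ c = 0 := by
    ext i
    rw [rayComb, Fintype.linearCombination_apply, ← Fintype.sum_of_injective ((↑) : S → ν)
      Subtype.val_injective (fun v => (x v : ℝ) • latticeVec (ρ v)) _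
      (fun w hw => by rw [hc₀ w (by simpa using hw), zero_smul]) fun v => by rw [hc]]
    have hxi := congrArg (Rat.cast : ℚ → ℝ) (congrFun hx i)
    simpa [latticeVec] using hxi
  have hcz := h.eq_zero_of_rayComb_eq_zero hS (fun v hv => not_imp_comm.1 (hc₀ v) hv) hcomb
  exact Rat.cast_eq_zero.1 ((hc v).symm.trans (congrFun hcz v))

lemma exists_mulVec_eq [Fintype ι] (h : IsSimplicial ρ 𝒮) (hS : S ∈ 𝒮) (f : ν → ℤ) :
    ∃ N : ℕ, N ≠ 0 ∧ ∃ u : ι → ℤ, ∀ v ∈ S, (ρ *ᵥ u) v = N * f v := by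
  classical
  set M := (ρ.submatrix ((↑) : S → ν) id).map (Int.cast : ℤ → ℚ)
  have hsurj : LinearMap.range M.mulVecLin = ⊤ := Submodule.eq_top_of_finrank_eq <| by
    rw [Module.finrank_fintype_fun_eq_card]
    exact (h.linearIndependent_row hS).rank_matrix
  obtain ⟨x, hx⟩ := LinearMap.range_eq_top.1 hsurj fun v => (f v : ℚ)
  obtain ⟨d, hd⟩ := IsLocalization.exist_integer_multiples (nonZeroDivisors ℤ) Finset.univ x
  choose y hy using fun i => hd i (Finset.mem_univ i)
  have hdx (v : S) : (ρ *ᵥ y) v = d * f v := by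
    have hxv : ∑ i, (ρ v i : ℚ) * x i = f v := congrFun hx v
    have hcast : (((ρ *ᵥ y) v : ℤ) : ℚ) = ((d * f v : ℤ) : ℚ) := by
      simp only [Matrix.mulVec, dotProduct, Int.cast_sum, Int.cast_mul, ← hxv, Finset.mul_sum]
      refine Finset.sum_congr rfl fun i _ => ?_
      have hyi : (y i : ℚ) = d * x i := by simpa [Submonoid.smul_def] using hy i
      rw [hyi]
      ring
    exact_mod_cast hcast
  refine ⟨(d : ℤ).natAbs, Int.natAbs_ne_zero.2 (nonZeroDivisors.coe_ne_zero d),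
    (d : ℤ).sign • y, fun v hv => ?_⟩
  rw [Matrix.mulVec_smul, Pi.smul_apply, hdx ⟨v, hv⟩, smul_eq_mul, ← mul_assoc,
    Int.sign_mul_self_eq_natAbs]

lemma isFace_rayCone [Fintype ι] (h : IsSimplicial ρ 𝒮) (hT : T ∈ 𝒮) (hST : S ⊆ T) :
    IsFace (rayCone ρ S) (rayCone ρ T) := by
  classical
  obtain ⟨N, hN, u, hu⟩ := h.exists_mulVec_eq hT fun v => if v ∈ S then 0 else 1
  have nonneg_and_eq_zero_iff : ∀ v ∈ T, 0 ≤ (ρ *ᵥ u) v ∧ ((ρ *ᵥ u) v = 0 ↔ v ∈ S) := by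
    intro v hv
    rw [hu v hv]
    split_ifs with hS <;> simp [hS, hN]
  refine ⟨u, mem_dualMonoid_rayCone.2 fun v hv => (nonneg_and_eq_zero_iff v hv).1, fun w => ?_⟩
  rw [← mem_rayCone_sep fun v hv => (nonneg_and_eq_zero_iff v hv).1]
  have hsep : {v ∈ T | (ρ *ᵥ u) v = 0} = S := Set.ext fun v =>
    ⟨fun hv => (nonneg_and_eq_zero_iff v hv.1).2.1 hv.2,
      fun hv => ⟨hST hv, (nonneg_and_eq_zero_iff v (hST hv)).2.2 hv⟩⟩
  rw [hsep]

lemma rayCone_inf (h : IsSimplicial ρ 𝒮) (hS : S ∈ 𝒮) (hT : T ∈ 𝒮) :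
    rayCone ρ S ⊓ rayCone ρ T = rayCone ρ (S ∩ T) := by
  refine le_antisymm ?_
    (le_inf (rayCone_mono Set.inter_subset_left) (rayCone_mono Set.inter_subset_right))
  rintro w ⟨hwS, hwT⟩
  obtain ⟨b, hb, hbS, rfl⟩ := mem_rayCone.1 hwS
  obtain ⟨c, hc, hcT, hcb⟩ := mem_rayCone.1 hwT
  obtain rfl := h.injOn ⟨hc, h.isLowerSet hcT hT⟩ ⟨hb, h.isLowerSet hbS hS⟩ hcb
  exact mem_rayCone.2 ⟨c, hc, Set.subset_inter hbS hcT, rfl⟩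

lemma mem_of_latticeVec_mem (h : IsSimplicial ρ 𝒮) (hS : S ∈ 𝒮) (hT : T ∈ 𝒮) {v : ν} (hv : v ∈ S)
    (hvT : latticeVec (ρ v) ∈ rayCone ρ T) : v ∈ T := by
  classical
  obtain ⟨b, hb, hbT, hbv⟩ := mem_rayCone.1 hvT
  have hsingle : rayComb ρ b = rayComb ρ (Pi.single v 1) := by
    rw [hbv, rayComb, Fintype.linearCombination_apply_single, one_smul]
  have hsupp : Function.support (Pi.single v 1 : ν → ℝ) ⊆ S :=
    Pi.support_single_subset.trans (Set.singleton_subset_iff.2 hv)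
  have hb₁ := h.injOn ⟨hb, h.isLowerSet hbT hT⟩
    ⟨Pi.single_nonneg.2 zero_le_one, h.isLowerSet hsupp hS⟩ hsingle
  exact hbT (by simp [hb₁])

lemma rayCone_le_iff (h : IsSimplicial ρ 𝒮) (hS : S ∈ 𝒮) (hT : T ∈ 𝒮) :
    rayCone ρ S ≤ rayCone ρ T ↔ S ⊆ T :=
  ⟨fun hle _ hv => h.mem_of_latticeVec_mem hS hT hv (hle (latticeVec_mem_rayCone hv)),
    rayCone_mono⟩

lemma isFan [Fintype ι] (h : IsSimplicial ρ 𝒮) : IsFan (rayFan ρ 𝒮) where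
  finite := 𝒮.toFinite.image _
  rational := by
    rintro _ ⟨S, -, rfl⟩
    exact ⟨_, S.toFinite.image _, rfl⟩
  stronglyConvex := by
    rintro _ ⟨S, hS, rfl⟩ v hv hv'
    obtain ⟨b, hb, hbS, rfl⟩ := mem_rayCone.1 hv
    obtain ⟨c, hc, hcS, hcb⟩ := mem_rayCone.1 hv'
    have hbc : b + c = 0 := h.eq_zero_of_rayComb_eq_zero hS
      ((Function.support_add b c).trans (Set.union_subset hbS hcS))
      (by rw [map_add, hcb, add_neg_cancel])
    rw [((add_eq_zero_iff_of_nonneg hb hc).1 hbc).1, map_zero]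
  face_mem := by
    rintro _ ⟨S, hS, rfl⟩ τ hτ
    obtain ⟨T, hT, rfl⟩ := exists_eq_rayCone_of_isFace hτ
    exact ⟨T, h.isLowerSet hT hS, rfl⟩
  inter_face := by
    rintro _ ⟨S, hS, rfl⟩ _ ⟨T, hT, rfl⟩
    rw [h.rayCone_inf hS hT]
    exact ⟨h.isFace_rayCone hS Set.inter_subset_left, h.isFace_rayCone hT Set.inter_subset_right⟩

lemma maximal_rayFan_iff (h : IsSimplicial ρ 𝒮) {σ : Cone ι} :
    Maximal (· ∈ rayFan ρ 𝒮) σ ↔ ∃ S, Maximal (· ∈ 𝒮) S ∧ σ = rayCone ρ S := by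
  constructor
  · rintro ⟨⟨S, hS, rfl⟩, hmax⟩
    exact ⟨S, ⟨hS, fun T hT hST => (h.rayCone_le_iff hT hS).1 (hmax ⟨T, hT, rfl⟩
      (rayCone_mono hST))⟩, rfl⟩
  · rintro ⟨S, ⟨hS, hmax⟩, rfl⟩
    refine ⟨⟨S, hS, rfl⟩, ?_⟩
    rintro _ ⟨T, hT, rfl⟩ hST
    exact rayCone_mono (hmax hT ((h.rayCone_le_iff hS hT).1 hST))

end IsSimplicial

lemma isPrimitive_of_isUnit {v : ι → ℤ} (l : ι) (h : IsUnit (v l)) : IsPrimitive v := by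
  refine ⟨fun hv => ?_, fun d w hd => ?_⟩
  · rw [hv] at h
    exact not_isUnit_zero h
  · rw [hd] at h
    exact isUnit_of_mul_isUnit_left (show IsUnit (d * w l) from h)

lemma IsPrimitive.exists_sum_mul_eq_one [Fintype ι] {v : ι → ℤ} (hv : IsPrimitive v) :
    ∃ u : ι → ℤ, ∑ l, u l * v l = 1 := by
  obtain ⟨d, hd⟩ := (IsPrincipalIdealRing.principal (Ideal.span (Set.range v))).principal
  have hdvd (l) : d ∣ v l := Ideal.mem_span_singleton.1
    (hd.le (Ideal.subset_span ⟨l, rfl⟩))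
  choose w hw using hdvd
  have hunit : IsUnit d := hv.2 d w (funext hw)
  have htop : Ideal.span (Set.range v) = ⊤ := hd.trans (Ideal.span_singleton_eq_top.2 hunit)
  exact Ideal.mem_span_range_iff_exists_fun.1 (htop ▸ Submodule.mem_top)

lemma IsPrimitive.eq_of_smul_eq [Finite ι] {v w : ι → ℤ} (hv : IsPrimitive v)
    (hw : IsPrimitive w) {c : ℝ} (hc : 0 ≤ c) (h : c • latticeVec v = latticeVec w) : v = w := by
  cases nonempty_fintype ι
  obtain ⟨u, hu⟩ := hv.exists_sum_mul_eq_one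
  obtain ⟨d, rfl⟩ : ∃ d : ℤ, c = d := by
    refine ⟨∑ l, u l * w l, ?_⟩
    have hcw (l) : c * v l = w l := congrFun h l
    have hu' : ∑ l, (u l : ℝ) * v l = 1 := by exact_mod_cast hu
    simp only [Int.cast_sum, Int.cast_mul, ← hcw, mul_left_comm, ← Finset.mul_sum, hu', mul_one]
  have hdw : w = d • v := funext fun l => by
    have hl : (d : ℝ) * v l = w l := congrFun h l
    exact_mod_cast hl.symm
  rcases Int.isUnit_iff.1 (hw.2 d v hdw) with rfl | rfl
  · rw [hdw, one_smul]
  · norm_num at hc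

lemma setOf_isPrimitive_coneOf_mem_rayFan [Finite ι] {𝒮 : Set (Set ν)} (h𝒮 : IsLowerSet 𝒮)
    (hρ : ∀ v, IsPrimitive (ρ v)) :
    {w | IsPrimitive w ∧ coneOf {w} ∈ rayFan ρ 𝒮} = ρ.row '' {v | {v} ∈ 𝒮} := by
  ext w
  constructor
  · rintro ⟨hw, S, hS, hSw⟩
    have hwS : latticeVec w ∈ rayCone ρ S := hSw ▸ Submodule.subset_span ⟨w, rfl, rfl⟩
    obtain ⟨v, hv⟩ : S.Nonempty := by
      rw [Set.nonempty_iff_ne_empty]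
      rintro rfl
      have hw₀ : latticeVec w = 0 := by simpa [rayCone, coneOf] using hwS
      exact hw.1 (funext fun l => Int.cast_eq_zero.1 (congrFun hw₀ l))
    have hvw : latticeVec (ρ v) ∈ coneOf {w} := hSw ▸ latticeVec_mem_rayCone hv
    rw [coneOf, Set.image_singleton] at hvw
    obtain ⟨c, hc⟩ := Submodule.mem_span_singleton.1 hvw
    exact ⟨v, h𝒮 (Set.singleton_subset_iff.2 hv) hS, (hw.eq_of_smul_eq (hρ v) c.2 hc).symm⟩
  · rintro ⟨v, hv, rfl⟩
    exact ⟨hρ v, {v}, hv, by rw [rayCone, Set.image_singleton]⟩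

end SimplicialFan

section LaurentMonomial

variable {C D : Type*} [CommRing C] [CommRing D]

open Classical in
/-- `c ^ z` for an integer `z`, meaningful if `c` is a unit or `z` is nonnegative. -/
def laurentPow (c : C) (z : ℤ) : C :=
  if h : IsUnit c then ((h.unit ^ z : Cˣ) : C) else c ^ z.toNat

lemma laurentPow_unit (c : Cˣ) (z : ℤ) : laurentPow (c : C) z = ((c ^ z : Cˣ) : C) := by
  rw [laurentPow, dif_pos c.isUnit, IsUnit.unit_of_val_units]

lemma laurentPow_natCast (c : C) (N : ℕ) : laurentPow c N = c ^ N := by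
  by_cases h : IsUnit c
  · obtain ⟨c, rfl⟩ := h
    rw [laurentPow_unit, zpow_natCast, Units.val_pow_eq_pow_val]
  · rw [laurentPow, dif_neg h, Int.toNat_natCast]

@[simp]
lemma laurentPow_zero (c : C) : laurentPow c 0 = 1 := by
  simpa using laurentPow_natCast c 0

lemma laurentPow_add {c : C} {z w : ℤ} (h : IsUnit c ∨ 0 ≤ z ∧ 0 ≤ w) :
    laurentPow c (z + w) = laurentPow c z * laurentPow c w := by
  rcases h with ⟨c, rfl⟩ | ⟨hz, hw⟩
  · rw [laurentPow_unit, laurentPow_unit, laurentPow_unit, zpow_add, Units.val_mul]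
  · lift z to ℕ using hz
    lift w to ℕ using hw
    rw [← Nat.cast_add, laurentPow_natCast, laurentPow_natCast, laurentPow_natCast, pow_add]

lemma map_laurentPow (f : C →+* D) {c : C} {z : ℤ} (h : IsUnit c ∨ 0 ≤ z) :
    f (laurentPow c z) = laurentPow (f c) z := by
  rcases h with ⟨c, rfl⟩ | hz
  · have hfc : f (c : C) = ((Units.map f.toMonoidHom c : Dˣ) : D) := rfl
    rw [laurentPow_unit, hfc, laurentPow_unit, ← map_zpow]
    rfl
  · lift z to ℕ using hz
    rw [laurentPow_natCast, laurentPow_natCast, map_pow]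

lemma laurentPow_units_mul (t : Cˣ) {c : C} {z : ℤ} (h : IsUnit c ∨ 0 ≤ z) :
    laurentPow (t * c) z = ((t ^ z : Cˣ) : C) * laurentPow c z := by
  rcases h with ⟨c, rfl⟩ | hz
  · rw [← Units.val_mul, laurentPow_unit, laurentPow_unit, mul_zpow, Units.val_mul]
  · lift z to ℕ using hz
    rw [laurentPow_natCast, laurentPow_natCast, mul_pow, zpow_natCast, Units.val_pow_eq_pow_val]

lemma laurentPow_ne_zero_iff {K : Type*} [Field K] {c : K} {z : ℤ} (h : IsUnit c ∨ 0 ≤ z) :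
    laurentPow c z ≠ 0 ↔ c ≠ 0 ∨ z = 0 := by
  rcases eq_or_ne c 0 with rfl | hc
  · lift z to ℕ using h.resolve_left not_isUnit_zero
    rw [laurentPow_natCast]
    simp
  · lift c to Kˣ using hc.isUnit
    rw [laurentPow_unit]
    exact iff_of_true (Units.ne_zero _) (Or.inl hc)

variable {ν : Type*} [Fintype ν]

/-- The Laurent monomial `∏ c_v ^ e_v`. -/
def laurentMonomial (c : ν → C) (e : ν → ℤ) : C := ∏ v, laurentPow (c v) (e v)

@[simp]
lemma laurentMonomial_zero (c : ν → C) : laurentMonomial c 0 = 1 := by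
  simp [laurentMonomial]

lemma laurentMonomial_add {c : ν → C} {e f : ν → ℤ}
    (h : ∀ v, IsUnit (c v) ∨ 0 ≤ e v ∧ 0 ≤ f v) :
    laurentMonomial c (e + f) = laurentMonomial c e * laurentMonomial c f := by
  simp only [laurentMonomial, ← Finset.prod_mul_distrib]
  exact Finset.prod_congr rfl fun v _ => laurentPow_add (h v)

lemma map_laurentMonomial (f : C →+* D) {c : ν → C} {e : ν → ℤ}
    (h : ∀ v, IsUnit (c v) ∨ 0 ≤ e v) :
    f (laurentMonomial c e) = laurentMonomial (fun v => f (c v)) e := by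
  rw [laurentMonomial, map_prod]
  exact Finset.prod_congr rfl fun v _ => map_laurentPow f (h v)

lemma laurentMonomial_units_mul (t : ν → Cˣ) {c : ν → C} {e : ν → ℤ}
    (h : ∀ v, IsUnit (c v) ∨ 0 ≤ e v) :
    laurentMonomial (fun v => t v * c v) e =
      ((∏ v, t v ^ e v : Cˣ) : C) * laurentMonomial c e := by
  rw [laurentMonomial, laurentMonomial, Units.coe_prod, ← Finset.prod_mul_distrib]
  exact Finset.prod_congr rfl fun v _ => laurentPow_units_mul (t v) (h v)

lemma laurentMonomial_mul_neg {c : ν → C} {e : ν → ℤ} (h : ∀ v, IsUnit (c v) ∨ e v = 0) :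
    laurentMonomial c e * laurentMonomial c (-e) = 1 := by
  rw [← laurentMonomial_add, add_neg_cancel, laurentMonomial_zero]
  exact fun v => (h v).imp_right fun hv => by simp [hv]

lemma laurentMonomial_natCast (c : ν → C) (e : ν → ℕ) :
    laurentMonomial c (fun v => (e v : ℤ)) = ∏ v, c v ^ e v :=
  Finset.prod_congr rfl fun _ _ => laurentPow_natCast _ _

lemma laurentMonomial_ne_zero_iff {K : Type*} [Field K] {c : ν → K} {e : ν → ℤ}
    (h : ∀ v, IsUnit (c v) ∨ 0 ≤ e v) :
    laurentMonomial c e ≠ 0 ↔ ∀ v, c v ≠ 0 ∨ e v = 0 := by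
  rw [laurentMonomial, Finset.prod_ne_zero_iff]
  exact ⟨fun H v => (laurentPow_ne_zero_iff (h v)).1 (H v (Finset.mem_univ v)),
    fun H v _ => (laurentPow_ne_zero_iff (h v)).2 (H v)⟩

variable (k : Type*) [Field k] [DecidableEq ν]

/-- The coordinate functions on the torus `Spec k[ℤ^ν]`. -/
def characterUnit (v : ν) : (AddMonoidAlgebra k (ν → ℤ))ˣ :=
  (AddMonoidAlgebra.of k (ν → ℤ)).toHomUnits (Multiplicative.ofAdd (Pi.single v 1))

lemma laurentMonomial_characterUnit (e : ν → ℤ) :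
    laurentMonomial (fun v => (characterUnit k v : AddMonoidAlgebra k (ν → ℤ))) e =
      AddMonoidAlgebra.single e 1 := by
  have hprod : ∏ v, characterUnit k v ^ e v =
      (AddMonoidAlgebra.of k (ν → ℤ)).toHomUnits (Multiplicative.ofAdd e) := by
    have he : e = ∑ v, e v • Pi.single v (1 : ℤ) := by
      ext w
      simp [Finset.sum_apply, Pi.single_apply]
    conv_rhs => rw [he]
    simp only [characterUnit, ofAdd_sum, ofAdd_zsmul, map_prod, map_zpow]
  calc laurentMonomial (fun v => (characterUnit k v : AddMonoidAlgebra k (ν → ℤ))) e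
      = ((∏ v, characterUnit k v ^ e v : (AddMonoidAlgebra k (ν → ℤ))ˣ) :
          AddMonoidAlgebra k (ν → ℤ)) := by
        rw [laurentMonomial, Units.coe_prod]
        exact Finset.prod_congr rfl fun v _ => laurentPow_unit _ _
    _ = AddMonoidAlgebra.single e 1 := by
        rw [hprod]
        rfl

end LaurentMonomial

section CoxHom

open scoped Matrix

variable {k : Type*} [Field k] {ν ι : Type} {ρ : Matrix ν ι ℤ}
  {C D : Type*} [CommRing C] [CommRing D] {τ σ : Cone ι} {φ ψ : MvPolynomial ν k →+* C}

/-- Every variable is invertible for `φ`, or the corresponding ray belongs to `τ`: the condition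
under which `φ`, a `C`-point of the affine space, is mapped to the chart of `τ`. -/
def CoxCompatible (ρ : Matrix ν ι ℤ) (τ : Cone ι) (φ : MvPolynomial ν k →+* C) : Prop :=
  ∀ v, IsUnit (φ (MvPolynomial.X v)) ∨ latticeVec (ρ v) ∈ τ

namespace CoxCompatible

lemma mono (h : CoxCompatible ρ τ φ) (hle : τ ≤ σ) : CoxCompatible ρ σ φ :=
  fun v => (h v).imp_right fun hv => hle hv

lemma comp (h : CoxCompatible ρ τ φ) (f : C →+* D) : CoxCompatible ρ τ (f.comp φ) :=
  fun v => (h v).imp_left fun hv => hv.map f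

lemma of_isUnit {S : Set ν} (h : ∀ v ∉ S, IsUnit (φ (MvPolynomial.X v))) :
    CoxCompatible ρ (rayCone ρ S) φ :=
  fun v => (em (v ∈ S)).symm.imp (h v) latticeVec_mem_rayCone

end CoxCompatible

variable [Fintype ι]

lemma mulVec_nonneg_of_mem_dualMonoid {u : ι → ℤ} (hu : u ∈ dualMonoid τ) {v : ν}
    (hv : latticeVec (ρ v) ∈ τ) : 0 ≤ (ρ *ᵥ u) v := by
  have hpair := hu _ hv
  rw [pairing_latticeVec_row] at hpair
  exact_mod_cast hpair

lemma CoxCompatible.isUnit_or_nonneg (h : CoxCompatible ρ τ φ) {u : ι → ℤ}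
    (hu : u ∈ dualMonoid τ) (v : ν) : IsUnit (φ (MvPolynomial.X v)) ∨ 0 ≤ (ρ *ᵥ u) v :=
  (h v).imp_right (mulVec_nonneg_of_mem_dualMonoid hu)

variable [Fintype ν]

/-- The homomorphism `k[S_τ] → C` sending `χ^u` to the Laurent monomial `∏ φ(x_v)^⟨u, ρ_v⟩`: the
quotient morphism from the affine space to the chart of `τ`, on `C`-points. -/
def coxHom (φ : MvPolynomial ν k →+* C) (h : CoxCompatible ρ τ φ) : coneAlgebra k τ →+* C :=
  AddMonoidAlgebra.liftNCRingHom (φ.comp MvPolynomial.C)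
    { toFun := fun u => laurentMonomial (fun v => φ (MvPolynomial.X v)) (ρ *ᵥ u.toAdd.1)
      map_one' := by
        simp only [toAdd_one, ZeroMemClass.coe_zero, Matrix.mulVec_zero, laurentMonomial_zero]
      map_mul' := fun u w => by
        rw [toAdd_mul, AddSubmonoid.coe_add, Matrix.mulVec_add, laurentMonomial_add]
        exact fun v => (h v).imp_right fun hv => ⟨mulVec_nonneg_of_mem_dualMonoid u.toAdd.2 hv,
          mulVec_nonneg_of_mem_dualMonoid w.toAdd.2 hv⟩ }
    fun _ _ => mul_comm _ _

lemma coxHom_single (h : CoxCompatible ρ τ φ) (u : dualMonoid τ) (c : k) :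
    coxHom φ h (AddMonoidAlgebra.single u c) =
      φ (MvPolynomial.C c) * laurentMonomial (fun v => φ (MvPolynomial.X v)) (ρ *ᵥ u.1) :=
  AddMonoidAlgebra.liftNCRingHom_single _ _ _ _ _

lemma coneAlgebra_ringHom_ext {f g : coneAlgebra k τ →+* C}
    (h : ∀ (u : dualMonoid τ) (c : k),
      f (AddMonoidAlgebra.single u c) = g (AddMonoidAlgebra.single u c)) : f = g := by
  refine RingHom.ext fun x => ?_
  induction x using AddMonoidAlgebra.induction_linear with
  | zero => rw [map_zero, map_zero]
  | add x y hx hy => rw [map_add, map_add, hx, hy]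
  | single u c => exact h u c

lemma comp_coxHom (h : CoxCompatible ρ τ φ) (f : C →+* D) :
    f.comp (coxHom φ h) = coxHom (f.comp φ) (h.comp f) :=
  coneAlgebra_ringHom_ext fun u c => by
    rw [RingHom.comp_apply, coxHom_single, coxHom_single, map_mul,
      map_laurentMonomial f (h.isUnit_or_nonneg u.2)]
    rfl

lemma coxHom_comp_coneAlgebraMap (h : CoxCompatible ρ τ φ) (hle : τ ≤ σ) :
    (coxHom φ h).comp (coneAlgebraMap k hle).toRingHom = coxHom φ (h.mono hle) :=
  coneAlgebra_ringHom_ext fun u c => by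
    rw [coxHom_single]
    refine (congrArg (coxHom φ h) (coneAlgebraMap_single k hle u c)).trans ?_
    rw [coxHom_single]

lemma coxHom_congr (e : φ = ψ) (h : CoxCompatible ρ τ φ) (h' : CoxCompatible ρ τ ψ) :
    coxHom φ h = coxHom ψ h' := by
  subst e
  rfl

lemma coxHom_comp_algebraMap (h : CoxCompatible ρ τ φ) :
    (coxHom φ h).comp (algebraMap k (coneAlgebra k τ)) = φ.comp MvPolynomial.C := by
  refine RingHom.ext fun c => ?_
  change coxHom φ h (AddMonoidAlgebra.single 0 c) = φ (MvPolynomial.C c)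
  rw [coxHom_single, ZeroMemClass.coe_zero, Matrix.mulVec_zero, laurentMonomial_zero, mul_one]

variable {κ : Type} {A : Matrix κ ν ℤ}

/-- The value of the character `χ` at a point `T` of the torus. -/
def torusUnit (T : Multiplicative (κ → ℤ) →* C) (χ : κ → ℤ) : Cˣ :=
  T.toHomUnits (Multiplicative.ofAdd χ)

lemma prod_torusUnit (T : Multiplicative (κ → ℤ) →* C) (e : ν → ℤ) :
    ∏ v, torusUnit T (fun l => A l v) ^ e v = torusUnit T (A *ᵥ e) := by
  have hA : A *ᵥ e = ∑ v, e v • fun l => A l v := by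
    ext l
    simp [Matrix.mulVec, dotProduct, mul_comm]
  simp only [torusUnit, hA, ofAdd_sum, ofAdd_zsmul, map_prod, map_zpow]

lemma coxHom_eq_of_torus (hA : A * ρ = 0) (T : Multiplicative (κ → ℤ) →* C)
    (hC : ∀ c, ψ (MvPolynomial.C c) = φ (MvPolynomial.C c))
    (hX : ∀ v, ψ (MvPolynomial.X v) = torusUnit T (fun l => A l v) * φ (MvPolynomial.X v))
    (h : CoxCompatible ρ τ φ) (h' : CoxCompatible ρ τ ψ) : coxHom φ h = coxHom ψ h' :=
  coneAlgebra_ringHom_ext fun u c => by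
    rw [coxHom_single, coxHom_single, hC]
    simp only [hX]
    rw [laurentMonomial_units_mul _ (h.isUnit_or_nonneg u.2), prod_torusUnit,
      Matrix.mulVec_mulVec, hA, Matrix.zero_mulVec]
    simp [torusUnit]

end CoxHom

section Chart

open scoped Matrix

variable {k : Type*} [Field k] {ν ι : Type} {ρ : Matrix ν ι ℤ} {r : ℕ}
  {A : Matrix (Fin r) ν ℤ} {C : Type*} [CommRing C]

lemma actHom_C (c : k) :
    actHom k A (MvPolynomial.C c) = AddMonoidAlgebra.single 0 (MvPolynomial.C c) := by
  rw [actHom, MvPolynomial.aeval_C]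
  rfl

lemma actHom_X (v : ν) :
    actHom k A (MvPolynomial.X v) =
      AddMonoidAlgebra.single (fun l => A l v) (MvPolynomial.X v) := by
  rw [actHom, MvPolynomial.aeval_X]

/-- The coaction `x_v ↦ t^(A v) φ(x_v)` of the torus on a `C`-point `φ` of the affine space. -/
def coaction (A : Matrix (Fin r) ν ℤ) (φ : MvPolynomial ν k →+* C) :
    MvPolynomial ν k →+* AddMonoidAlgebra C (Fin r → ℤ) :=
  (AddMonoidAlgebra.mapRingHom _ φ).comp (actHom k A).toRingHom

lemma coaction_C (φ : MvPolynomial ν k →+* C) (c : k) :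
    coaction A φ (MvPolynomial.C c) = AddMonoidAlgebra.single 0 (φ (MvPolynomial.C c)) := by
  refine (congrArg (AddMonoidAlgebra.mapRingHom _ φ) (actHom_C c)).trans ?_
  rw [AddMonoidAlgebra.mapRingHom_single]

lemma coaction_X (φ : MvPolynomial ν k →+* C) (v : ν) :
    coaction A φ (MvPolynomial.X v) =
      AddMonoidAlgebra.single (fun l => A l v) (φ (MvPolynomial.X v)) := by
  refine (congrArg (AddMonoidAlgebra.mapRingHom _ φ) (actHom_X v)).trans ?_
  rw [AddMonoidAlgebra.mapRingHom_single]

lemma torusUnit_of (χ : Fin r → ℤ) :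
    (torusUnit (AddMonoidAlgebra.of C (Fin r → ℤ)) χ : AddMonoidAlgebra C (Fin r → ℤ)) =
      AddMonoidAlgebra.single χ 1 := rfl

lemma coaction_X_eq_torusUnit (φ : MvPolynomial ν k →+* C) (v : ν) :
    coaction A φ (MvPolynomial.X v) =
      torusUnit (AddMonoidAlgebra.of C (Fin r → ℤ)) (fun l => A l v) *
        (AddMonoidAlgebra.singleZeroRingHom (φ (MvPolynomial.X v)) :
          AddMonoidAlgebra C (Fin r → ℤ)) := by
  rw [coaction_X, torusUnit_of]
  change _ = _ * AddMonoidAlgebra.single 0 _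
  rw [AddMonoidAlgebra.single_mul_single, add_zero, one_mul]

section Laurent

variable [DecidableEq ν]

variable (k ν) in
/-- The inclusion of the polynomials into the Laurent polynomials. -/
def toLaurent : MvPolynomial ν k →+* AddMonoidAlgebra k (ν → ℤ) :=
  MvPolynomial.eval₂Hom AddMonoidAlgebra.singleZeroRingHom
    fun v => (characterUnit k v : AddMonoidAlgebra k (ν → ℤ))

lemma toLaurent_X (v : ν) :
    toLaurent k ν (MvPolynomial.X v) = characterUnit k v :=
  MvPolynomial.eval₂Hom_X' _ _ v

lemma toLaurent_C (c : k) :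
    toLaurent k ν (MvPolynomial.C c) = AddMonoidAlgebra.single 0 c :=
  MvPolynomial.eval₂Hom_C _ _ c

variable [Fintype ν] [Fintype ι]

lemma coxHom_toLaurent {τ : Cone ι} (h : CoxCompatible ρ τ (toLaurent k ν))
    (x : coneAlgebra k τ) :
    coxHom (toLaurent k ν) h x = AddMonoidAlgebra.mapDomain (fun u => ρ *ᵥ u.1) x := by
  induction x using AddMonoidAlgebra.induction_linear with
  | zero => rw [map_zero, AddMonoidAlgebra.mapDomain_zero]
  | add x y hx hy => rw [map_add, hx, hy, AddMonoidAlgebra.mapDomain_add]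
  | single u c =>
    rw [coxHom_single]
    simp only [toLaurent_X, toLaurent_C]
    rw [laurentMonomial_characterUnit, AddMonoidAlgebra.single_mul_single,
      AddMonoidAlgebra.mapDomain_single, zero_add, mul_one]

end Laurent

variable [Fintype ν] [Fintype ι]

open Classical in
/-- The product of the variables outside `S`; the chart of the affine space lying over the affine
toric variety of `rayCone ρ S` is its nonvanishing locus. -/
def chartVar (k : Type*) [Field k] (S : Set ν) : MvPolynomial ν k :=
  ∏ v with v ∉ S, MvPolynomial.X v

variable {S : Set ν}

lemma isUnit_chartVar_iff {φ : MvPolynomial ν k →+* C} :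
    IsUnit (φ (chartVar k S)) ↔ ∀ v ∉ S, IsUnit (φ (MvPolynomial.X v)) := by
  classical
  simp [chartVar, map_prod, IsUnit.prod_iff]

lemma isUnit_coaction_chartVar {φ : MvPolynomial ν k →+* C} (h : IsUnit (φ (chartVar k S))) :
    IsUnit (coaction A φ (chartVar k S)) := by
  refine isUnit_chartVar_iff.2 fun v hv => ?_
  rw [coaction_X_eq_torusUnit]
  exact (Units.isUnit _).mul ((isUnit_chartVar_iff.1 h v hv).map _)

variable {B : Type*} [CommRing B] [Algebra (MvPolynomial ν k) B]

variable (k B) in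
/-- The images of the variables in the coordinate ring of a chart. -/
def chartCoord (v : ν) : B := algebraMap (MvPolynomial ν k) B (MvPolynomial.X v)

/-- The Laurent monomials in the coordinate ring of a chart. -/
def chartMonomial (B : Type*) [CommRing B] [Algebra (MvPolynomial ν k) B] (c : k) (e : ν → ℤ) : B :=
  algebraMap (MvPolynomial ν k) B (MvPolynomial.C c) * laurentMonomial (chartCoord k B) e

lemma chartMonomial_one (e : ν → ℤ) :
    chartMonomial B (1 : k) e = laurentMonomial (chartCoord k B) e := by
  rw [chartMonomial, map_one, map_one, one_mul]

lemma algebraMap_monomial_mul_laurentMonomial {d : ν → ℤ}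
    (hd : ∀ v, IsUnit (chartCoord k B v) ∨ 0 ≤ d v) (c : k) (e : ν →₀ ℕ) :
    algebraMap (MvPolynomial ν k) B (MvPolynomial.monomial e c) *
        laurentMonomial (chartCoord k B) d =
      chartMonomial B c ((fun v => (e v : ℤ)) + d) := by
  rw [chartMonomial, laurentMonomial_add, laurentMonomial_natCast, MvPolynomial.monomial_eq,
    map_mul, Finsupp.prod_fintype _ _ (by simp), map_prod, mul_assoc]
  · simp only [map_pow]
    rfl
  · exact fun v => (hd v).imp_right fun hv => ⟨Int.natCast_nonneg _, hv⟩

open Classical in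
lemma algebraMap_chartVar_pow (S : Set ν) (N : ℕ) :
    algebraMap (MvPolynomial ν k) B (chartVar k S) ^ N =
      laurentMonomial (chartCoord k B) fun v => if v ∈ S then 0 else N := by
  have hN : (fun v => if v ∈ S then 0 else (N : ℤ)) = fun v => ((if v ∈ S then 0 else N : ℕ) : ℤ) :=
    funext fun v => by split_ifs <;> rfl
  rw [hN, laurentMonomial_natCast, chartVar, map_prod, ← Finset.prod_pow, Finset.prod_filter]
  refine Finset.prod_congr rfl fun v _ => ?_
  by_cases hv : v ∈ S <;> simp [hv, chartCoord]

variable (S) [IsLocalization.Away (chartVar k S) B]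

lemma isUnit_chartCoord {v : ν} (hv : v ∉ S) : IsUnit (chartCoord k B v) :=
  isUnit_chartVar_iff.1 (IsLocalization.Away.algebraMap_isUnit (chartVar k S)) v hv

lemma isUnit_chartCoord_or {P : ν → Prop} (h : ∀ v ∈ S, P v) (v : ν) :
    IsUnit (chartCoord k B v) ∨ P v :=
  (em (v ∈ S)).symm.imp (isUnit_chartCoord S) (h v)

lemma chart_induction {P : B → Prop} (add : ∀ x y, P x → P y → P (x + y))
    (monomial : ∀ (c : k) e, (∀ v ∈ S, 0 ≤ e v) → P (chartMonomial B c e)) (b : B) : P b := by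
  classical
  obtain ⟨N, p, hp⟩ := IsLocalization.Away.surj (chartVar k S) b
  let d : ν → ℤ := fun v => if v ∈ S then 0 else N
  have hd : ∀ v ∈ S, d v = 0 := fun v hv => if_pos hv
  have hb : b = algebraMap (MvPolynomial ν k) B p * laurentMonomial (chartCoord k B) (-d) := by
    rw [← hp, algebraMap_chartVar_pow, mul_assoc,
      laurentMonomial_mul_neg (isUnit_chartCoord_or S hd), mul_one]
  rw [hb]
  clear hp hb
  induction p using MvPolynomial.induction_on' with
  | monomial e c =>
    have hd' : ∀ v ∈ S, 0 ≤ (-d) v := fun v hv => by rw [Pi.neg_apply, hd v hv, neg_zero]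
    rw [algebraMap_monomial_mul_laurentMonomial (isUnit_chartCoord_or S hd')]
    exact monomial _ _ fun v hv => add_nonneg (Int.natCast_nonneg _) (hd' v hv)
  | add p q hp hq =>
    rw [map_add, add_mul]
    exact add _ _ hp hq

/-- The coaction on the coordinate ring of a chart. -/
def chartAct (A : Matrix (Fin r) ν ℤ) (B : Type*) [CommRing B] [Algebra (MvPolynomial ν k) B]
    (S : Set ν) [IsLocalization.Away (chartVar k S) B] : B →+* AddMonoidAlgebra B (Fin r → ℤ) :=
  IsLocalization.Away.lift (chartVar k S)
    (isUnit_coaction_chartVar (A := A) (φ := algebraMap (MvPolynomial ν k) B)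
      (IsLocalization.Away.algebraMap_isUnit (chartVar k S)))

lemma chartAct_algebraMap (p : MvPolynomial ν k) :
    chartAct (k := k) A B S (algebraMap (MvPolynomial ν k) B p) =
      coaction A (algebraMap (MvPolynomial ν k) B) p := IsLocalization.Away.lift_eq _ _ _

lemma chartAct_chartMonomial (c : k) {e : ν → ℤ} (he : ∀ v ∈ S, 0 ≤ e v) :
    chartAct (k := k) A B S (chartMonomial B c e) =
      AddMonoidAlgebra.single (A *ᵥ e) (chartMonomial B c e) := by
  have hunit := isUnit_chartCoord_or (k := k) (B := B) S he
  have hact : (fun v => chartAct (k := k) A B S (chartCoord k B v)) = fun v =>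
      torusUnit (AddMonoidAlgebra.of B (Fin r → ℤ)) (fun l => A l v) *
        (AddMonoidAlgebra.singleZeroRingHom (chartCoord k B v) :
          AddMonoidAlgebra B (Fin r → ℤ)) := by
    funext v
    rw [chartCoord, chartAct_algebraMap, coaction_X_eq_torusUnit]
  rw [chartMonomial, map_mul, chartAct_algebraMap, coaction_C, map_laurentMonomial _ hunit, hact,
    laurentMonomial_units_mul _ fun v => (hunit v).imp_left fun h => h.map _,
    prod_torusUnit, torusUnit_of, ← map_laurentMonomial _ hunit]
  change AddMonoidAlgebra.single 0 _ * (_ * AddMonoidAlgebra.single 0 _) = _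
  rw [AddMonoidAlgebra.single_mul_single, AddMonoidAlgebra.single_mul_single]
  simp

/-- The inclusion of the functions on the toric chart into the functions on the chart above it. -/
def chartInvariants (ρ : Matrix ν ι ℤ) (B : Type*) [CommRing B] [Algebra (MvPolynomial ν k) B]
    (S : Set ν) [IsLocalization.Away (chartVar k S) B] : coneAlgebra k (rayCone ρ S) →+* B :=
  coxHom (algebraMap (MvPolynomial ν k) B) (CoxCompatible.of_isUnit fun _ => isUnit_chartCoord S)

lemma chartInvariants_single (u : dualMonoid (rayCone ρ S)) (c : k) :
    chartInvariants ρ B S (AddMonoidAlgebra.single u c) = chartMonomial B c (ρ *ᵥ u.1) :=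
  coxHom_single _ _ _

lemma chartInvariants_injective (hρ : Function.Injective ρ.mulVec) :
    Function.Injective (chartInvariants (k := k) ρ B S) := by
  classical
  have hunit : ∀ v ∉ S, IsUnit (toLaurent k ν (MvPolynomial.X v)) := fun v _ => by
    rw [toLaurent_X]
    exact Units.isUnit _
  obtain ⟨f, hf⟩ : ∃ f : B →+* AddMonoidAlgebra k (ν → ℤ),
      f.comp (algebraMap (MvPolynomial ν k) B) = toLaurent k ν :=
    ⟨_, IsLocalization.Away.lift_comp _ (isUnit_chartVar_iff.2 hunit)⟩
  have hcomp : f.comp (chartInvariants ρ B S) =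
      coxHom (toLaurent k ν) (CoxCompatible.of_isUnit hunit) := by
    rw [chartInvariants, comp_coxHom]
    exact coxHom_congr hf _ _
  refine Function.Injective.of_comp (f := f) fun x y hxy => ?_
  rw [← RingHom.coe_comp, hcomp, coxHom_toLaurent, coxHom_toLaurent] at hxy
  exact AddMonoidAlgebra.mapDomain_injective (fun u w huw => Subtype.ext (hρ huw)) hxy

lemma chartAct_comp_chartInvariants (hA : A * ρ = 0) :
    (chartAct (k := k) A B S).comp (chartInvariants (k := k) ρ B S) =
      AddMonoidAlgebra.singleZeroRingHom.comp (chartInvariants ρ B S) := by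
  rw [chartInvariants, comp_coxHom, comp_coxHom]
  symm
  apply coxHom_eq_of_torus hA (AddMonoidAlgebra.of B (Fin r → ℤ))
  · intro c
    rw [RingHom.comp_apply, RingHom.comp_apply, chartAct_algebraMap, coaction_C]
    rfl
  · intro v
    rw [RingHom.comp_apply, RingHom.comp_apply, chartAct_algebraMap, coaction_X_eq_torusUnit]

lemma coeff_zero_chartAct_mem_range (hexact : ∀ e, A *ᵥ e = 0 → ∃ u, ρ *ᵥ u = e) (b : B) :
    (chartAct (k := k) A B S b).coeff 0 ∈ (chartInvariants (k := k) ρ B S).range := by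
  induction b using chart_induction (k := k) (B := B) S with
  | add x y hx hy =>
    rw [map_add, AddMonoidAlgebra.coeff_add, Finsupp.add_apply]
    exact add_mem hx hy
  | monomial c e he =>
    rw [chartAct_chartMonomial S c he, AddMonoidAlgebra.coeff_single, Finsupp.single_apply]
    split_ifs with hAe
    · obtain ⟨u, rfl⟩ := hexact e hAe
      exact ⟨AddMonoidAlgebra.single ⟨u, mem_dualMonoid_rayCone.2 he⟩ c,
        chartInvariants_single S _ c⟩
    · exact zero_mem _

lemma chartAct_coeff (b : B) (χ : Fin r → ℤ) :
    chartAct (k := k) A B S ((chartAct (k := k) A B S b).coeff χ) =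
      AddMonoidAlgebra.single χ ((chartAct (k := k) A B S b).coeff χ) := by
  induction b using chart_induction (k := k) (B := B) S with
  | add x y hx hy =>
    rw [map_add, AddMonoidAlgebra.coeff_add, Finsupp.add_apply, map_add, hx, hy,
      AddMonoidAlgebra.single_add]
  | monomial c e he =>
    rw [chartAct_chartMonomial S c he, AddMonoidAlgebra.coeff_single, Finsupp.single_apply]
    split_ifs with hχ
    · rw [chartAct_chartMonomial S c he, hχ]
    · simp

lemma sum_coeff_chartAct (b : B) :
    ((chartAct (k := k) A B S b).coeff.sum fun _ c => c) = b := by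
  induction b using chart_induction (k := k) (B := B) S with
  | add x y hx hy =>
    rw [map_add, AddMonoidAlgebra.coeff_add, Finsupp.sum_add_index' (by simp) (by simp), hx, hy]
  | monomial c e he =>
    rw [chartAct_chartMonomial S c he, AddMonoidAlgebra.coeff_single, Finsupp.sum_single_index rfl]

lemma exists_eq_mulVec_of_coeff_chartAct_ne_zero {b : B} {χ : Fin r → ℤ}
    (h : (chartAct (k := k) A B S b).coeff χ ≠ 0) : ∃ e, A *ᵥ e = χ := by
  induction b using chart_induction (k := k) (B := B) S with
  | add x y hx hy =>
    rw [map_add, AddMonoidAlgebra.coeff_add, Finsupp.add_apply] at h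
    by_cases hx0 : (chartAct (k := k) A B S x).coeff χ = 0
    · exact hy (by rwa [hx0, zero_add] at h)
    · exact hx hx0
  | monomial c e he =>
    rw [chartAct_chartMonomial S c he, AddMonoidAlgebra.coeff_single, Finsupp.single_apply] at h
    exact ⟨e, of_not_not fun hχ => h (if_neg hχ)⟩

lemma exists_units_chartAct_eq {e : ν → ℤ} (he : ∀ v ∈ S, e v = 0) :
    ∃ w : Bˣ, chartAct (k := k) A B S w = AddMonoidAlgebra.single (A *ᵥ e) (w : B) := by
  refine ⟨Units.mkOfMulEqOne _ _ (laurentMonomial_mul_neg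
    (isUnit_chartCoord_or (k := k) (B := B) S he)), ?_⟩
  rw [Units.val_mkOfMulEqOne, ← chartMonomial_one,
    chartAct_chartMonomial S 1 fun v hv => (he v hv).ge]

lemma isGradedChart (hρ : Function.Injective ρ.mulVec) (hA : A * ρ = 0)
    (hexact : ∀ e, A *ᵥ e = 0 → ∃ u, ρ *ᵥ u = e) {𝒮 : Set (Set ν)} (h𝒮 : IsSimplicial ρ 𝒮)
    (hS : S ∈ 𝒮) : IsGradedChart (chartInvariants (k := k) ρ B S) (chartAct (k := k) A B S) where
  injective := chartInvariants_injective S hρ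
  act_apply x := DFunLike.congr_fun (chartAct_comp_chartInvariants S hA) x
  coeff_zero_mem := coeff_zero_chartAct_mem_range S hexact
  act_coeff := chartAct_coeff S
  sum_coeff := sum_coeff_chartAct S
  exists_unit b χ hχ := by
    obtain ⟨e, rfl⟩ := exists_eq_mulVec_of_coeff_chartAct_ne_zero S hχ
    obtain ⟨N, hN, u, hu⟩ := h𝒮.exists_mulVec_eq hS e
    have hzero : ∀ v ∈ S, (ρ *ᵥ u - N • e) v = 0 := fun v hv => by
      rw [Pi.sub_apply, hu v hv, Pi.smul_apply, nsmul_eq_mul, sub_self]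
    have hweight : A *ᵥ (ρ *ᵥ u - N • e) = -(N • A *ᵥ e) := by
      rw [Matrix.mulVec_sub, Matrix.mulVec_mulVec, hA, Matrix.zero_mulVec, zero_sub,
        Matrix.mulVec_smul]
    obtain ⟨w, hw⟩ := exists_units_chartAct_eq (k := k) (A := A) (B := B) S hzero
    exact ⟨N, hN, w, hweight ▸ hw⟩

end Chart

section Orbit

open scoped Matrix

lemma exists_comp_eq_of_ker_le {H L Q : Type*} [AddCommGroup H] [AddCommGroup L] [AddCommGroup Q]
    (hQ : Module.Baer ℤ Q) (W : H →+ L) (Θ : H →+ Q) (h : W.ker ≤ Θ.ker) :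
    ∃ T : L →+ Q, T.comp W = Θ := by
  obtain ⟨T, hT⟩ := hQ.extension_property_addMonoidHom (QuotientAddGroup.kerLift W)
    (QuotientAddGroup.kerLift_injective W) (QuotientAddGroup.lift W.ker Θ h)
  exact ⟨T, AddMonoidHom.ext fun x => DFunLike.congr_fun hT (x : H ⧸ W.ker)⟩

lemma baer_additive_units (K : Type*) [Field K] [IsAlgClosed K] :
    Module.Baer ℤ (Additive Kˣ) := by
  let _ : DivisibleBy (Additive Kˣ) ℕ := divisibleByOfSMulRightSurj _ _ fun {N} hN x => by
    have : NeZero N := ⟨hN⟩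
    obtain ⟨y, hy⟩ := IsAlgClosed.exists_pow_nat_eq (x.toMul : K) (Nat.pos_of_ne_zero hN)
    have hy0 : y ≠ 0 := by
      rintro rfl
      rw [zero_pow hN] at hy
      exact x.toMul.ne_zero hy.symm
    exact ⟨.ofMul (Units.mk0 y hy0), Additive.toMul.injective (Units.ext (by simpa using hy))⟩
  let _ : DivisibleBy (Additive Kˣ) ℤ := AddGroup.divisibleByIntOfDivisibleByNat _
  exact Module.Baer.of_divisible _

variable {K : Type*} [Field K] {ν κ : Type}

lemma exists_ratio {c c' : ν → K} (h : ∀ v, c v = 0 ↔ c' v = 0) :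
    ∃ θ : ν → Kˣ, ∀ v, c' v = θ v * c v := by
  suffices ∀ v, ∃ t : Kˣ, c' v = t * c v from Classical.skolem.1 this
  intro v
  by_cases hv : c v = 0
  · exact ⟨1, by rw [hv, (h v).1 hv, mul_zero]⟩
  · exact ⟨.mk0 (c' v / c v) (div_ne_zero (fun hv' => hv ((h v).2 hv')) hv),
      (div_mul_cancel₀ _ hv).symm⟩

variable [Fintype ν]

lemma exists_character [IsAlgClosed K] (A : Matrix κ ν ℤ) (θ : ν → Kˣ) (Z : Set ν)
    (h : ∀ e, (∀ v ∈ Z, e v = 0) → A *ᵥ e = 0 → ∏ v, θ v ^ e v = 1) :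
    ∃ T : Multiplicative (κ → ℤ) →* Kˣ, ∀ v ∉ Z, T (.ofAdd fun l => A l v) = θ v := by
  classical
  let H : AddSubgroup (ν → ℤ) := AddSubgroup.pi Z fun _ => ⊥
  let Θ : (ν → ℤ) →+ Additive Kˣ :=
    { toFun := fun e => .ofMul (∏ v, θ v ^ e v)
      map_zero' := by simp
      map_add' := fun e f => by
        simp only [Pi.add_apply, zpow_add, Finset.prod_mul_distrib, ofMul_mul] }
  obtain ⟨T, hT⟩ := exists_comp_eq_of_ker_le (baer_additive_units K)
    (A.mulVecLin.toAddMonoidHom.comp H.subtype) (Θ.comp H.subtype) fun e he =>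
      congrArg Additive.ofMul (h e.1 (fun v hv => e.2 v hv) he)
  refine ⟨T.toMultiplicativeLeft, fun v hv => ?_⟩
  have hmem : Pi.single v (1 : ℤ) ∈ H := fun w hw =>
    Pi.single_eq_of_ne (ne_of_mem_of_not_mem hw hv) _
  have hcol : A *ᵥ Pi.single v (1 : ℤ) = fun l => A l v := by
    rw [Matrix.mulVec_single_one]
    rfl
  have hprod : ∏ w, θ w ^ (Pi.single v (1 : ℤ) : ν → ℤ) w = θ v := by
    simp [Pi.single_apply]
  have hval : T (A *ᵥ Pi.single v (1 : ℤ)) = .ofMul (∏ w, θ w ^ (Pi.single v (1 : ℤ) : ν → ℤ) w) :=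
    DFunLike.congr_fun hT ⟨Pi.single v 1, hmem⟩
  rw [hcol, hprod] at hval
  exact congrArg Additive.toMul hval

section Coordinates

variable {ι : Type} [Fintype ι] {ρ : Matrix ν ι ℤ} {𝒮 : Set (Set ν)} {S : Set ν} {c c' : ν → K}

lemma eq_zero_imp_of_laurentMonomial_eq (h𝒮 : IsSimplicial ρ 𝒮) (hS : S ∈ 𝒮)
    (hc : ∀ v ∉ S, c v ≠ 0) (hc' : ∀ v ∉ S, c' v ≠ 0)
    (heq : ∀ u ∈ dualMonoid (rayCone ρ S),
      laurentMonomial c (ρ *ᵥ u) = laurentMonomial c' (ρ *ᵥ u))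
    {v : ν} (hv : c v = 0) : c' v = 0 := by
  classical
  have hvS : v ∈ S := by_contra fun hvS => hc v hvS hv
  obtain ⟨N, hN, u, hu⟩ := h𝒮.exists_mulVec_eq hS (Pi.single v 1)
  have hnonneg : ∀ w ∈ S, 0 ≤ (ρ *ᵥ u) w := fun w hw => by
    rw [hu w hw, Pi.single_apply]
    split_ifs <;> simp
  have hunit : ∀ {b : ν → K}, (∀ w ∉ S, b w ≠ 0) → ∀ w, IsUnit (b w) ∨ 0 ≤ (ρ *ᵥ u) w :=
    fun hb w => (em (w ∈ S)).symm.imp (fun hw => (hb w hw).isUnit) (hnonneg w)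
  have hzero : laurentMonomial c' (ρ *ᵥ u) = 0 := by
    rw [← heq u (mem_dualMonoid_rayCone.2 hnonneg), ← not_ne_iff,
      laurentMonomial_ne_zero_iff (hunit hc)]
    exact fun H => (H v).elim (· hv) (by simp [hu v hvS, hN])
  by_contra hv'
  refine (laurentMonomial_ne_zero_iff (hunit hc')).2 (fun w => ?_) hzero
  by_cases hw : w ∈ S
  · rcases eq_or_ne w v with rfl | hwv
    · exact .inl hv'
    · exact .inr (by rw [hu w hw, Pi.single_eq_of_ne hwv, mul_zero])
  · exact .inl (hc' w hw)

variable {θ : ν → Kˣ}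

lemma prod_ratio_eq_one_of_mem_dualMonoid (hc : ∀ v ∉ S, c v ≠ 0)
    (heq : ∀ u ∈ dualMonoid (rayCone ρ S),
      laurentMonomial c (ρ *ᵥ u) = laurentMonomial (fun v => θ v * c v) (ρ *ᵥ u))
    {u : ι → ℤ} (hu : u ∈ dualMonoid (rayCone ρ S)) (hzero : ∀ v, c v = 0 → (ρ *ᵥ u) v = 0) :
    ∏ v, θ v ^ (ρ *ᵥ u) v = 1 := by
  have hunit : ∀ v, IsUnit (c v) ∨ 0 ≤ (ρ *ᵥ u) v := fun v =>
    (em (v ∈ S)).symm.imp (fun hv => (hc v hv).isUnit) (mem_dualMonoid_rayCone.1 hu v)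
  have hne : laurentMonomial c (ρ *ᵥ u) ≠ 0 :=
    (laurentMonomial_ne_zero_iff hunit).2 fun v => (em (c v = 0)).symm.imp id (hzero v)
  have hmul := heq u hu
  rw [laurentMonomial_units_mul _ hunit] at hmul
  exact Units.ext (mul_right_cancel₀ hne (hmul.symm.trans (one_mul _).symm))

lemma prod_ratio_eq_one (h𝒮 : IsSimplicial ρ 𝒮) (hS : S ∈ 𝒮) (hc : ∀ v ∉ S, c v ≠ 0)
    (heq : ∀ u ∈ dualMonoid (rayCone ρ S),
      laurentMonomial c (ρ *ᵥ u) = laurentMonomial (fun v => θ v * c v) (ρ *ᵥ u))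
    {w : ι → ℤ} (hzero : ∀ v, c v = 0 → (ρ *ᵥ w) v = 0) : ∏ v, θ v ^ (ρ *ᵥ w) v = 1 := by
  -- `w = (w + u) - u` with `u` and `w + u` both in the dual monoid and vanishing where `w` does.
  obtain ⟨N, hN, u, hu⟩ := h𝒮.exists_mulVec_eq hS fun v => |(ρ *ᵥ w) v|
  have hu_zero : ∀ v, c v = 0 → (ρ *ᵥ u) v = 0 := fun v hv => by
    rw [hu v (by_contra fun hvS => hc v hvS hv), hzero v hv, abs_zero, mul_zero]
  have hu_mem : u ∈ dualMonoid (rayCone ρ S) := mem_dualMonoid_rayCone.2 fun v hv => by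
    rw [hu v hv]
    positivity
  have hwu_mem : w + u ∈ dualMonoid (rayCone ρ S) := mem_dualMonoid_rayCone.2 fun v hv => by
    have hle : |(ρ *ᵥ w) v| ≤ N * |(ρ *ᵥ w) v| :=
      le_mul_of_one_le_left (abs_nonneg _) (by exact_mod_cast Nat.one_le_iff_ne_zero.2 hN)
    rw [Matrix.mulVec_add, Pi.add_apply, hu v hv]
    linarith [neg_abs_le ((ρ *ᵥ w) v)]
  have hwu_prod := prod_ratio_eq_one_of_mem_dualMonoid hc heq hwu_mem fun v hv => by
    rw [Matrix.mulVec_add, Pi.add_apply, hzero v hv, hu_zero v hv, add_zero]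
  simp only [Matrix.mulVec_add, Pi.add_apply, zpow_add, Finset.prod_mul_distrib] at hwu_prod
  rwa [prod_ratio_eq_one_of_mem_dualMonoid hc heq hu_mem hu_zero, mul_one] at hwu_prod

lemma exists_character_of_laurentMonomial_eq [IsAlgClosed K] {A : Matrix κ ν ℤ}
    (hexact : ∀ e, A *ᵥ e = 0 → ∃ u, ρ *ᵥ u = e) (h𝒮 : IsSimplicial ρ 𝒮) (hS : S ∈ 𝒮)
    (hc : ∀ v ∉ S, c v ≠ 0) (hc' : ∀ v ∉ S, c' v ≠ 0)
    (heq : ∀ u ∈ dualMonoid (rayCone ρ S),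
      laurentMonomial c (ρ *ᵥ u) = laurentMonomial c' (ρ *ᵥ u)) :
    ∃ T : Multiplicative (κ → ℤ) →* Kˣ, ∀ v, c' v = T (.ofAdd fun l => A l v) * c v := by
  have hzero : ∀ v, c v = 0 ↔ c' v = 0 := fun v =>
    ⟨eq_zero_imp_of_laurentMonomial_eq h𝒮 hS hc hc' heq,
      eq_zero_imp_of_laurentMonomial_eq h𝒮 hS hc' hc fun u hu => (heq u hu).symm⟩
  obtain ⟨θ, hθ⟩ := exists_ratio hzero
  obtain rfl : c' = fun v => θ v * c v := funext hθ
  obtain ⟨T, hT⟩ := exists_character A θ {v | c v = 0} fun e he hAe => by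
    obtain ⟨w, rfl⟩ := hexact e hAe
    exact prod_ratio_eq_one h𝒮 hS hc heq he
  refine ⟨T, fun v => ?_⟩
  by_cases hv : c v = 0
  · rw [hθ, hv, mul_zero, mul_zero]
  · rw [hT v hv]

end Coordinates

variable {k : Type*} [Field k] {r : ℕ} {A : Matrix (Fin r) ν ℤ}

omit [Fintype ν] in
lemma exists_torusTimesAffine_point {C : Type*} [CommRing C] {φ φ' : MvPolynomial ν k →+* C}
    (T : Multiplicative (Fin r → ℤ) →* C)
    (hC : ∀ c, φ' (MvPolynomial.C c) = φ (MvPolynomial.C c))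
    (hX : ∀ v, φ' (MvPolynomial.X v) = T (.ofAdd fun l => A l v) * φ (MvPolynomial.X v)) :
    ∃ ψ : TorusTimesAffine k r ν →+* C,
      ψ.comp (prHom k r ν) = φ ∧ ψ.comp (actHom k A).toRingHom = φ' := by
  let ψ : TorusTimesAffine k r ν →+* C :=
    AddMonoidAlgebra.liftNCRingHom φ T fun _ _ => mul_comm _ _
  have hψ : ∀ χ p, ψ (AddMonoidAlgebra.single χ p) = φ p * T (.ofAdd χ) := fun χ p =>
    AddMonoidAlgebra.liftNCRingHom_single _ _ _ _ _
  refine ⟨ψ, RingHom.ext fun p => ?_, MvPolynomial.ringHom_ext (fun c => ?_) fun v => ?_⟩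
  · refine (hψ 0 p).trans ?_
    rw [ofAdd_zero, map_one, mul_one]
  · refine (congrArg ψ (actHom_C c)).trans ((hψ _ _).trans ?_)
    rw [ofAdd_zero, map_one, mul_one, hC]
  · refine (congrArg ψ (actHom_X v)).trans ((hψ _ _).trans ?_)
    rw [hX, mul_comm]

variable {ι : Type} [Fintype ι] {ρ : Matrix ν ι ℤ} {𝒮 : Set (Set ν)} {S : Set ν}
  {φ φ' : MvPolynomial ν k →+* K}

lemma exists_torus_of_coxHom_eq [IsAlgClosed K] (hexact : ∀ e, A *ᵥ e = 0 → ∃ u, ρ *ᵥ u = e)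
    (h𝒮 : IsSimplicial ρ 𝒮) (hS : S ∈ 𝒮) (hφ : ∀ v ∉ S, φ (MvPolynomial.X v) ≠ 0)
    (hφ' : ∀ v ∉ S, φ' (MvPolynomial.X v) ≠ 0) (h : CoxCompatible ρ (rayCone ρ S) φ)
    (h' : CoxCompatible ρ (rayCone ρ S) φ') (heq : coxHom φ h = coxHom φ' h') :
    ∃ ψ : TorusTimesAffine k r ν →+* K,
      ψ.comp (prHom k r ν) = φ ∧ ψ.comp (actHom k A).toRingHom = φ' := by
  have hC : φ.comp MvPolynomial.C = φ'.comp MvPolynomial.C := by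
    rw [← coxHom_comp_algebraMap h, heq, coxHom_comp_algebraMap]
  obtain ⟨T, hT⟩ := exists_character_of_laurentMonomial_eq hexact h𝒮 hS hφ hφ' fun u hu => by
    simpa only [coxHom_single, map_one, one_mul] using
      DFunLike.congr_fun heq (AddMonoidAlgebra.single ⟨u, hu⟩ 1)
  exact exists_torusTimesAffine_point ((Units.coeHom K).comp T)
    (fun c => (DFunLike.congr_fun hC c).symm) hT

end Orbit

section SpecPoints

lemma hom_ext_of_Spec {P Y : Scheme.{u}} {f g : P ⟶ Y}
    (h : ∀ (C : Type u) [CommRing C] (x : Spec (.of C) ⟶ P), x ≫ f = x ≫ g) : f = g :=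
  Scheme.Cover.hom_ext P.affineCover _ _ fun i => h _ (P.affineCover.f i)

lemma hom_ext_of_span {C : Type u} [CommRing C] {Y : Scheme.{u}} {f g : Spec (.of C) ⟶ Y}
    {ι : Type*} (c : ι → C) (hc : Ideal.span (Set.range c) = ⊤)
    (h : ∀ i, Spec.map (CommRingCat.ofHom (algebraMap C (Localization.Away (c i)))) ≫ f =
      Spec.map (CommRingCat.ofHom (algebraMap C (Localization.Away (c i)))) ≫ g) : f = g :=
  Scheme.Cover.hom_ext (Scheme.affineOpenCoverOfSpanRangeEqTop (R := .of C) c hc).openCover _ _ h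

lemma exists_ringHom {A C : Type u} [CommRing A] [CommRing C] (x : Spec (.of C) ⟶ Spec (.of A)) :
    ∃ φ : A →+* C, x = Spec.map (CommRingCat.ofHom φ) :=
  ⟨(Spec.preimage x).hom, (Spec.map_preimage x).symm⟩

lemma SpecMap_ofHom_injective {A C : Type u} [CommRing A] [CommRing C] {φ ψ : A →+* C}
    (h : Spec.map (CommRingCat.ofHom φ) = Spec.map (CommRingCat.ofHom ψ)) : φ = ψ :=
  congrArg CommRingCat.Hom.hom (Spec.map_injective h)

lemma SpecMap_ofHom_comp {A B C : Type u} [CommRing A] [CommRing B] [CommRing C] (φ : A →+* B)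
    (ψ : B →+* C) : Spec.map (CommRingCat.ofHom (ψ.comp φ)) =
      Spec.map (CommRingCat.ofHom ψ) ≫ Spec.map (CommRingCat.ofHom φ) := by
  rw [CommRingCat.ofHom_comp, Spec.map_comp]

end SpecPoints

section ToricCharts

variable {k : Type u} [Field k] {ι : Type} [Fintype ι] {F : Set (Cone ι)}

variable (k) in
/-- The inclusion of the affine chart `U_σ` into `T(Σ)`. -/
def toricChart (hF : IsFan F) {σ : Cone ι} (hσ : σ ∈ F) :
    Spec (.of (coneAlgebra k σ)) ⟶ (toricVariety k hF).left :=
  haveI := hF.hasColimit k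
  colimit.ι (toricDiagram k F) ⟨σ, hσ⟩

lemma isOpenImmersion_toricChart (hF : IsFan F) {σ : Cone ι} (hσ : σ ∈ F) :
    IsOpenImmersion (toricChart k hF hσ) := by
  have : ∀ {i j : F} (f : i ⟶ j), IsOpenImmersion ((toricDiagram k F).map f) :=
    fun f => hF.isOpenImmersion k f
  have := hF.isLocallyDirected k
  exact inferInstanceAs (IsOpenImmersion (colimit.ι (toricDiagram k F) ⟨σ, hσ⟩))

lemma SpecMap_coneAlgebraMap_toricChart (hF : IsFan F) {τ σ : Cone ι} (hτ : τ ∈ F) (hσ : σ ∈ F)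
    (h : τ ≤ σ) :
    Spec.map (CommRingCat.ofHom (coneAlgebraMap k h).toRingHom) ≫ toricChart k hF hσ =
      toricChart k hF hτ :=
  haveI := hF.hasColimit k
  colimit.w (toricDiagram k F) (homOfLE h : (⟨τ, hτ⟩ : F) ⟶ ⟨σ, hσ⟩)

lemma toricChart_hom (hF : IsFan F) {σ : Cone ι} (hσ : σ ∈ F) :
    toricChart k hF hσ ≫ (toricVariety k hF).hom =
      Spec.map (CommRingCat.ofHom (algebraMap k (coneAlgebra k σ))) :=
  haveI := hF.hasColimit k
  colimit.ι_desc (toricCocone k F) ⟨σ, hσ⟩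

lemma exists_toricChart_eq (hF : IsFan F) (y : (toricVariety k hF).left) :
    ∃ (σ : Cone ι) (hσ : σ ∈ F) (z : Spec (.of (coneAlgebra k σ))), toricChart k hF hσ z = y := by
  have : ∀ {i j : F} (f : i ⟶ j), IsOpenImmersion ((toricDiagram k F).map f) :=
    fun f => hF.isOpenImmersion k f
  have := hF.isLocallyDirected k
  obtain ⟨⟨σ, hσ⟩, z, hz⟩ := Scheme.IsLocallyDirected.ι_jointly_surjective (toricDiagram k F) y
  exact ⟨σ, hσ, z, hz⟩

lemma notMem_of_toricChart_eq (hF : IsFan F) {σ σ' : Cone ι} (hσ : σ ∈ F) (hσ' : σ' ∈ F)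
    {z : Spec (.of (coneAlgebra k σ))} {z' : Spec (.of (coneAlgebra k σ'))}
    (h : toricChart k hF hσ z = toricChart k hF hσ' z') {u : ι → ℤ} (hu : u ∈ dualMonoid σ)
    (hface : ∀ v, v ∈ σ ⊓ σ' ↔ v ∈ σ ∧ pairing u v = 0) :
    AddMonoidAlgebra.single (⟨u, hu⟩ : dualMonoid σ) (1 : k) ∉ PrimeSpectrum.asIdeal z := by
  have : ∀ {i j : F} (f : i ⟶ j), IsOpenImmersion ((toricDiagram k F).map f) :=
    fun f => hF.isOpenImmersion k f
  have := hF.isLocallyDirected k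
  obtain ⟨τ, f, g, t, rfl, -⟩ := (Scheme.IsLocallyDirected.ι_eq_ι_iff (toricDiagram k F)
    (i := ⟨σ, hσ⟩) (j := ⟨σ', hσ'⟩) (xi := z) (xj := z')).1 h
  have hle : τ.1 ≤ σ ⊓ σ' := le_inf (leOfHom f) (leOfHom g)
  have hunit : IsUnit (coneAlgebraMap k (leOfHom f)
      (AddMonoidAlgebra.single (⟨u, hu⟩ : dualMonoid σ) (1 : k))) := by
    rw [coneAlgebraMap_single]
    have hnu : -u ∈ dualMonoid τ.1 := fun v hv => by
      rw [pairing_neg, ((hface v).1 (hle hv)).2, neg_zero]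
    refine IsUnit.of_mul_eq_one (AddMonoidAlgebra.single (⟨-u, hnu⟩ : dualMonoid τ.1) (1 : k)) ?_
    rw [AddMonoidAlgebra.single_mul_single, one_mul, AddMonoidAlgebra.one_def]
    congr 1
    exact Subtype.ext (add_neg_cancel u)
  exact fun hmem => (PrimeSpectrum.isPrime t).ne_top (Ideal.eq_top_of_isUnit_mem _ hmem hunit)

end ToricCharts

section CoxPoints

open scoped Matrix

variable {k : Type u} [Field k] {ν ι : Type} {ρ : Matrix ν ι ℤ} {𝒮 : Set (Set ν)} {S T : Set ν}
  {C D : Type u} [CommRing C] [CommRing D] {φ ψ : MvPolynomial ν k →+* C}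

lemma rayCone_mem_rayFan (hS : S ∈ 𝒮) : rayCone ρ S ∈ rayFan ρ 𝒮 := Set.mem_image_of_mem _ hS

variable [Fintype ν]

lemma coxCompatible_rayCone (h : IsUnit (φ (chartVar k S))) : CoxCompatible ρ (rayCone ρ S) φ :=
  CoxCompatible.of_isUnit (isUnit_chartVar_iff.1 h)

variable [Fintype ι]

/-- The point of `T(Σ)` with Cox coordinates `φ`, for `φ` in the chart of `S`. -/
def coxPoint (hF : IsFan (rayFan ρ 𝒮)) (φ : MvPolynomial ν k →+* C) (hS : S ∈ 𝒮)
    (h : IsUnit (φ (chartVar k S))) : Spec (.of C) ⟶ (toricVariety k hF).left :=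
  Spec.map (CommRingCat.ofHom (coxHom φ (coxCompatible_rayCone h))) ≫
    toricChart k hF (rayCone_mem_rayFan hS)

variable (hF : IsFan (rayFan ρ 𝒮)) (hS : S ∈ 𝒮) (hT : T ∈ 𝒮)

lemma coxPoint_congr (e : φ = ψ) (h : IsUnit (φ (chartVar k S))) (h' : IsUnit (ψ (chartVar k S))) :
    coxPoint hF φ hS h = coxPoint hF ψ hS h' := by
  subst e
  rfl

lemma coxPoint_eq_of_compatible (h : IsUnit (φ (chartVar k S))) {τ : Cone ι} (hτ : τ ∈ rayFan ρ 𝒮)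
    (hφ : CoxCompatible ρ τ φ) (hle : τ ≤ rayCone ρ S) :
    coxPoint hF φ hS h = Spec.map (CommRingCat.ofHom (coxHom φ hφ)) ≫ toricChart k hF hτ := by
  rw [coxPoint, ← SpecMap_coneAlgebraMap_toricChart hF hτ (rayCone_mem_rayFan hS) hle,
    ← Category.assoc, ← SpecMap_ofHom_comp, coxHom_comp_coneAlgebraMap]

lemma coxPoint_eq (h : IsUnit (φ (chartVar k S))) (h' : IsUnit (φ (chartVar k T))) :
    coxPoint hF φ hS h = coxPoint hF φ hT h' := by
  have hSmem : rayCone ρ S ∈ rayFan ρ 𝒮 := rayCone_mem_rayFan hS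
  have hτ : rayCone ρ S ⊓ rayCone ρ T ∈ rayFan ρ 𝒮 :=
    hF.face_mem _ hSmem _ (hF.inter_face _ hSmem _ (rayCone_mem_rayFan hT)).1
  have hφ : CoxCompatible ρ (rayCone ρ S ⊓ rayCone ρ T) φ := fun v =>
    (coxCompatible_rayCone h v).elim .inl fun hv =>
      (coxCompatible_rayCone h' v).imp_right fun hv' => ⟨hv, hv'⟩
  rw [coxPoint_eq_of_compatible hF hS h hτ hφ inf_le_left,
    coxPoint_eq_of_compatible hF hT h' hτ hφ inf_le_right]

lemma SpecMap_coxPoint (f : C →+* D) (h : IsUnit (φ (chartVar k S))) :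
    Spec.map (CommRingCat.ofHom f) ≫ coxPoint hF φ hS h =
      coxPoint hF (f.comp φ) hS (h.map f) := by
  rw [coxPoint, ← Category.assoc, ← SpecMap_ofHom_comp, comp_coxHom]
  rfl

lemma coxPoint_hom (h : IsUnit (φ (chartVar k S))) :
    coxPoint hF φ hS h ≫ (toricVariety k hF).hom =
      Spec.map (CommRingCat.ofHom (φ.comp MvPolynomial.C)) := by
  rw [coxPoint, Category.assoc, toricChart_hom, ← SpecMap_ofHom_comp, coxHom_comp_algebraMap]

lemma coxHom_eq_of_coxPoint_eq (h : IsUnit (φ (chartVar k S))) (h' : IsUnit (ψ (chartVar k S)))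
    (e : coxPoint hF φ hS h = coxPoint hF ψ hS h') :
    coxHom (ρ := ρ) φ (coxCompatible_rayCone h) = coxHom ψ (coxCompatible_rayCone h') := by
  have := isOpenImmersion_toricChart (k := k) hF (rayCone_mem_rayFan hS)
  exact SpecMap_ofHom_injective ((cancel_mono _).1 e)

lemma ne_zero_of_coxPoint_mem (h𝒮 : IsSimplicial ρ 𝒮) {K : Type u} [Field K]
    {φ : MvPolynomial ν k →+* K} (h : IsUnit (φ (chartVar k S))) (x : Spec (.of K))
    (hx : coxPoint hF φ hS h x ∈
      Set.range (toricChart k hF (rayCone_mem_rayFan hT))) :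
    ∀ v ∉ T, φ (MvPolynomial.X v) ≠ 0 := by
  have hSmem : rayCone ρ S ∈ rayFan ρ 𝒮 := rayCone_mem_rayFan hS
  obtain ⟨z, hz⟩ := hx
  obtain ⟨u, hu, hface⟩ :=
    (hF.inter_face _ hSmem _ (rayCone_mem_rayFan hT)).1
  have hnotMem := notMem_of_toricChart_eq hF hSmem _
    (z := Spec.map (CommRingCat.ofHom (coxHom φ (coxCompatible_rayCone h))) x) hz.symm hu hface
  have hne : laurentMonomial (fun v => φ (MvPolynomial.X v)) (ρ *ᵥ u) ≠ 0 := fun h0 => by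
    apply hnotMem
    change coxHom φ (coxCompatible_rayCone h) _ ∈ PrimeSpectrum.asIdeal x
    rw [coxHom_single, h0, mul_zero]
    exact zero_mem _
  rw [laurentMonomial_ne_zero_iff ((coxCompatible_rayCone h).isUnit_or_nonneg hu)] at hne
  intro v hv
  by_cases hvS : v ∈ S
  · refine (hne v).resolve_right fun hv0 => hv ?_
    have hmem : latticeVec (ρ v) ∈ rayCone ρ S ⊓ rayCone ρ T := by
      rw [hface, pairing_latticeVec_row, hv0]
      exact ⟨latticeVec_mem_rayCone hvS, Int.cast_zero⟩
    exact h𝒮.mem_of_latticeVec_mem hS hT hvS hmem.2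
  · exact (isUnit_chartVar_iff.1 h v hvS).ne_zero

end CoxPoints

section IrrelevantIdeal

variable {k : Type u} [Field k] {ν : Type}

/-- The points outside `V(I)` are those lying in the chart `x_v ≠ 0` for all `v ∉ S`, for some
`S ∈ 𝒮`; up to radical this makes `I` the irrelevant ideal of the fan with cones indexed by `𝒮`. -/
def IsIrrelevantIdeal (𝒮 : Set (Set ν)) (I : Ideal (MvPolynomial ν k)) : Prop :=
  ∀ P : Spec (.of (MvPolynomial ν k)), P ∈ complement I ↔
    ∃ S ∈ 𝒮, ∀ v ∉ S, MvPolynomial.X v ∉ P.asIdeal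

variable [Fintype ν] {𝒮 : Set (Set ν)} {I : Ideal (MvPolynomial ν k)} {S : Set ν}

lemma chartVar_notMem_iff {P : Ideal (MvPolynomial ν k)} [P.IsPrime] :
    chartVar k S ∉ P ↔ ∀ v ∉ S, MvPolynomial.X v ∉ P := by
  simp [chartVar, Ideal.IsPrime.prod_mem_iff]

lemma IsIrrelevantIdeal.mem_complement_iff (hI : IsIrrelevantIdeal 𝒮 I)
    (P : Spec (.of (MvPolynomial ν k))) :
    P ∈ complement I ↔ ∃ S ∈ 𝒮, chartVar k S ∉ P.asIdeal := by
  have := PrimeSpectrum.isPrime P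
  rw [hI P]
  exact exists_congr fun S => and_congr_right fun _ => chartVar_notMem_iff.symm

end IrrelevantIdeal

section CoxSpace

variable {k : Type u} [Field k] {ν : Type} [Fintype ν] {𝒮 : Set (Set ν)}
  {I : Ideal (MvPolynomial ν k)} {S T : Set ν} {C D : Type u} [CommRing C] [CommRing D]
  {φ : MvPolynomial ν k →+* C}

lemma range_SpecMap_subset (hI : IsIrrelevantIdeal 𝒮 I) (hS : S ∈ 𝒮)
    (h : IsUnit (φ (chartVar k S))) :
    Set.range (Spec.map (CommRingCat.ofHom φ)) ⊆ Set.range (complement I).ι := by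
  rintro _ ⟨z, rfl⟩
  rw [Scheme.Opens.range_ι]
  exact (hI.mem_complement_iff _).2 ⟨S, hS, fun hz =>
    (PrimeSpectrum.isPrime z).ne_top (Ideal.eq_top_of_isUnit_mem _ hz h)⟩

/-- The point of `𝔸^ν ∖ V(I)` with coordinates `φ`. -/
def spacePoint (hI : IsIrrelevantIdeal 𝒮 I) (hS : S ∈ 𝒮) (φ : MvPolynomial ν k →+* C)
    (h : IsUnit (φ (chartVar k S))) : Spec (.of C) ⟶ (complement I).toScheme :=
  IsOpenImmersion.lift (complement I).ι (Spec.map (CommRingCat.ofHom φ))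
    (range_SpecMap_subset hI hS h)

variable (hI : IsIrrelevantIdeal 𝒮 I) (hS : S ∈ 𝒮) (hT : T ∈ 𝒮)

lemma spacePoint_ι (h : IsUnit (φ (chartVar k S))) :
    spacePoint hI hS φ h ≫ (complement I).ι = Spec.map (CommRingCat.ofHom φ) :=
  IsOpenImmersion.lift_fac _ _ _

lemma eq_spacePoint (h : IsUnit (φ (chartVar k S))) {x : Spec (.of C) ⟶ (complement I).toScheme}
    (hx : x ≫ (complement I).ι = Spec.map (CommRingCat.ofHom φ)) : x = spacePoint hI hS φ h := by
  rw [← cancel_mono (complement I).ι, hx, spacePoint_ι]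

include hI in
lemma exists_eq_spacePoint {K : Type u} [Field K] (x : Spec (.of K) ⟶ (complement I).toScheme) :
    ∃ (φ : MvPolynomial ν k →+* K) (S : Set ν) (hS : S ∈ 𝒮) (h : IsUnit (φ (chartVar k S))),
      x = spacePoint hI hS φ h := by
  obtain ⟨φ, hφ⟩ := exists_ringHom (x ≫ (complement I).ι)
  let p : Spec (.of K) := (⊥ : PrimeSpectrum K)
  obtain ⟨S, hS, hnotMem⟩ := (hI.mem_complement_iff _).1 (x p).2
  change chartVar k S ∉ PrimeSpectrum.asIdeal ((complement I).ι (x p)) at hnotMem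
  rw [← Scheme.Hom.comp_apply, hφ] at hnotMem
  have h : IsUnit (φ (chartVar k S)) := isUnit_iff_ne_zero.2 hnotMem
  exact ⟨φ, S, hS, h, eq_spacePoint hI hS h hφ⟩

variable (k S) in
/-- The coordinate ring of the chart of `S`. -/
abbrev chartRing : Type u := Localization.Away (chartVar k S)

variable (k S) in
lemma isUnit_algebraMap_chartVar :
    IsUnit (algebraMap (MvPolynomial ν k) (chartRing k S) (chartVar k S)) :=
  IsLocalization.Away.algebraMap_isUnit (chartVar k S)

/-- The inclusion of the chart of `S` into `𝔸^ν ∖ V(I)`. -/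
def spaceChart : Spec (.of (chartRing k S)) ⟶ (complement I).toScheme :=
  spacePoint hI hS (algebraMap (MvPolynomial ν k) (chartRing k S)) (isUnit_algebraMap_chartVar k S)

instance isOpenImmersion_spaceChart : IsOpenImmersion (spaceChart hI hS) := by
  have : IsOpenImmersion (spaceChart hI hS ≫ (complement I).ι) := by
    rw [spaceChart, spacePoint_ι]
    exact IsOpenImmersion.of_isLocalization (chartVar k S)
  exact IsOpenImmersion.of_comp _ (complement I).ι

lemma mem_range_spaceChart {x : (complement I).toScheme}
    (hx : chartVar k S ∉ PrimeSpectrum.asIdeal ((complement I).ι x)) :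
    x ∈ Set.range (spaceChart hI hS) := by
  obtain ⟨z, hz⟩ :=
    (PrimeSpectrum.localization_away_comap_range (chartRing k S) (chartVar k S)).ge hx
  let z' : Spec (.of (chartRing k S)) := z
  refine ⟨z', (complement I).ι.isOpenEmbedding.injective ?_⟩
  rw [← Scheme.Hom.comp_apply, spaceChart, spacePoint_ι]
  exact hz

lemma exists_spacePoint_eq_comp_spaceChart (h : IsUnit (φ (chartVar k S))) :
    ∃ f : chartRing k S →+* C, f.comp (algebraMap (MvPolynomial ν k) _) = φ ∧
      spacePoint hI hS φ h = Spec.map (CommRingCat.ofHom f) ≫ spaceChart hI hS := by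
  have hf := IsLocalization.Away.lift_comp (S := chartRing k S) (chartVar k S) h
  refine ⟨IsLocalization.Away.lift (S := chartRing k S) (chartVar k S) h, hf, ?_⟩
  symm
  apply eq_spacePoint
  rw [Category.assoc, spaceChart, spacePoint_ι, ← SpecMap_ofHom_comp, hf]

/-- The open cover of `𝔸^ν ∖ V(I)` by the charts of the members of `𝒮`. -/
def spaceCover : (complement I).toScheme.OpenCover :=
  Scheme.Cover.mkOfCovers 𝒮 (fun S => Spec (.of (chartRing k S.1)))
    (fun S => spaceChart hI S.2)
    (fun x => by
      obtain ⟨S, hS, hx⟩ := (hI.mem_complement_iff _).1 x.2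
      obtain ⟨z, hz⟩ := mem_range_spaceChart hI hS hx
      exact ⟨⟨S, hS⟩, z, hz⟩)
    fun S => isOpenImmersion_spaceChart hI S.2

variable {ι : Type} [Fintype ι] {ρ : Matrix ν ι ℤ} (hF : IsFan (rayFan ρ 𝒮))

lemma comp_coxPoint_eq {P : Scheme.{u}} (p : P ⟶ Spec (.of (chartRing k S)))
    (p' : P ⟶ Spec (.of (chartRing k T))) (e : p ≫ spaceChart hI hS = p' ≫ spaceChart hI hT) :
    p ≫ coxPoint hF (algebraMap (MvPolynomial ν k) (chartRing k S)) hS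
        (isUnit_algebraMap_chartVar k S) =
      p' ≫ coxPoint hF (algebraMap (MvPolynomial ν k) (chartRing k T)) hT
        (isUnit_algebraMap_chartVar k T) :=
  hom_ext_of_Spec fun C _ x => by
    obtain ⟨f, hf⟩ := exists_ringHom (x ≫ p)
    obtain ⟨g, hg⟩ := exists_ringHom (x ≫ p')
    have hfg : f.comp (algebraMap (MvPolynomial ν k) (chartRing k S)) =
        g.comp (algebraMap (MvPolynomial ν k) (chartRing k T)) := by
      apply SpecMap_ofHom_injective
      rw [SpecMap_ofHom_comp _ f, SpecMap_ofHom_comp _ g,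
        ← spacePoint_ι hI hS (isUnit_algebraMap_chartVar k S),
        ← spacePoint_ι hI hT (isUnit_algebraMap_chartVar k T), ← hf, ← hg]
      change (x ≫ p) ≫ spaceChart hI hS ≫ _ = (x ≫ p') ≫ spaceChart hI hT ≫ _
      rw [Category.assoc, Category.assoc, reassoc_of% e]
    have hu : IsUnit (f.comp (algebraMap (MvPolynomial ν k) (chartRing k S)) (chartVar k T)) := by
      rw [hfg]
      exact (isUnit_algebraMap_chartVar k T).map g
    rw [← Category.assoc, ← Category.assoc, hf, hg, SpecMap_coxPoint, SpecMap_coxPoint,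
      coxPoint_eq hF hS hT _ hu]
    exact coxPoint_congr hF hT hfg _ _

/-- The morphism from `𝔸^ν ∖ V(I)` to `T(Σ)`. -/
def coxMap : (complement I).toScheme ⟶ (toricVariety k hF).left :=
  Scheme.Cover.glueMorphisms (spaceCover hI)
    (fun S => coxPoint hF (algebraMap (MvPolynomial ν k) (chartRing k S.1)) S.2
      (isUnit_algebraMap_chartVar k S.1))
    fun _ _ => comp_coxPoint_eq hI _ _ hF _ _ pullback.condition

lemma spaceChart_coxMap :
    spaceChart hI hS ≫ coxMap hI hF =
      coxPoint hF (algebraMap (MvPolynomial ν k) (chartRing k S)) hS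
        (isUnit_algebraMap_chartVar k S) :=
  Scheme.Cover.ι_glueMorphisms (spaceCover hI) _ _ ⟨S, hS⟩

lemma spaceChart_coxMap_eq_chartInvariants :
    spaceChart hI hS ≫ coxMap hI hF =
      Spec.map (CommRingCat.ofHom (chartInvariants ρ (chartRing k S) S)) ≫
        toricChart k hF (rayCone_mem_rayFan hS) :=
  spaceChart_coxMap hI hS hF

lemma spacePoint_coxMap (h : IsUnit (φ (chartVar k S))) :
    spacePoint hI hS φ h ≫ coxMap hI hF = coxPoint hF φ hS h := by
  obtain ⟨f, hf, e⟩ := exists_spacePoint_eq_comp_spaceChart hI hS h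
  rw [e, Category.assoc, spaceChart_coxMap, SpecMap_coxPoint]
  exact coxPoint_congr hF hS hf _ _

lemma coxMap_hom : coxMap hI hF ≫ (toricVariety k hF).hom = (complementOver I).hom :=
  Scheme.Cover.hom_ext (spaceCover hI) _ _ fun S => by
    change spaceChart hI S.2 ≫ _ = spaceChart hI S.2 ≫ (complement I).ι ≫ Spec.map _
    rw [← Category.assoc, spaceChart_coxMap, coxPoint_hom, ← Category.assoc, spaceChart,
      spacePoint_ι, SpecMap_ofHom_comp]
    rfl

/-- The morphism from `𝔸^ν ∖ V(I)` to `T(Σ)`, over `k`. -/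
def coxMapOver : complementOver I ⟶ toricVariety k hF :=
  Over.homMk (coxMap hI hF) (coxMap_hom hI hF)

lemma mem_range_spaceChart_of_coxMap_mem (h𝒮 : IsSimplicial ρ 𝒮) {x : (complement I).toScheme}
    (hx : coxMap hI hF x ∈ Set.range (toricChart k hF (rayCone_mem_rayFan hS))) :
    x ∈ Set.range (spaceChart hI hS) := by
  let K := (complement I).toScheme.residueField x
  let p : Spec K := (⊥ : PrimeSpectrum K)
  have hp : (complement I).toScheme.fromSpecResidueField x p = x :=
    Scheme.fromSpecResidueField_apply _ _
  obtain ⟨φ, T, hT, h, e⟩ := exists_eq_spacePoint hI (K := K)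
    ((complement I).toScheme.fromSpecResidueField x)
  have hp' : spacePoint hI hT φ h p = x := by rw [← e, hp]
  rw [← hp', ← Scheme.Hom.comp_apply, spacePoint_coxMap] at hx
  have hne := ne_zero_of_coxPoint_mem hF hT hS h𝒮 h p hx
  have hι : (complement I).ι x = Spec.map (CommRingCat.ofHom φ) p := by
    rw [← spacePoint_ι hI hT h, Scheme.Hom.comp_apply, hp']
  apply mem_range_spaceChart
  rw [hι]
  exact (isUnit_chartVar_iff.2 fun v hv => (hne v hv).isUnit).ne_zero

end CoxSpace

section BasicCharts

variable {k : Type u} [Field k] {ι : Type} [Fintype ι] {F : Set (Cone ι)} (hF : IsFan F)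
  {σ : Cone ι} (hσ : σ ∈ F)

/-- The basic open subset `D(f)` of the affine chart `U_σ` of `T(Σ)`. -/
def basicChart (f : coneAlgebra k σ) :
    Spec (.of (Localization.Away f)) ⟶ (toricVariety k hF).left :=
  Spec.map (CommRingCat.ofHom (algebraMap _ (Localization.Away f))) ≫
    toricChart k hF hσ

instance isOpenImmersion_basicChart (f : coneAlgebra k σ) :
    IsOpenImmersion (basicChart hF hσ f) := by
  have := isOpenImmersion_toricChart (k := k) hF hσ
  have : IsOpenImmersion (Spec.map (CommRingCat.ofHom (algebraMap _ (Localization.Away f)))) :=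
    IsOpenImmersion.of_isLocalization f
  rw [basicChart]
  infer_instance

lemma range_basicChart (f : coneAlgebra k σ) :
    Set.range (basicChart hF hσ f) = toricChart k hF hσ ''
      (PrimeSpectrum.basicOpen f : Set (PrimeSpectrum (coneAlgebra k σ))) := by
  rw [← PrimeSpectrum.localization_away_comap_range (Localization.Away f) f]
  exact Set.range_comp (toricChart k hF hσ)
    (Spec.map (CommRingCat.ofHom (algebraMap _ (Localization.Away f))))

lemma exists_basicChart {V : (toricVariety k hF).left.Opens} {y : (toricVariety k hF).left}
    (hy : y ∈ V) : ∃ (σ : Cone ι) (hσ : σ ∈ F) (f : coneAlgebra k σ),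
      y ∈ Set.range (basicChart hF hσ f) ∧ Set.range (basicChart hF hσ f) ⊆ V := by
  obtain ⟨σ, hσ, z, rfl⟩ := exists_toricChart_eq hF y
  have hopen : IsOpen (toricChart k hF hσ ⁻¹' (V : Set _)) :=
    V.isOpen.preimage (toricChart k hF hσ).continuous
  obtain ⟨_, ⟨f, rfl⟩, hf, hfV⟩ :=
    PrimeSpectrum.isTopologicalBasis_basic_opens.exists_subset_of_mem_open (a := z) hy hopen
  refine ⟨σ, hσ, f, ?_, ?_⟩
  · rw [range_basicChart]
    exact ⟨z, hf, rfl⟩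
  · rw [range_basicChart]
    exact Set.image_subset_iff.2 hfV

end BasicCharts

section Action

open scoped Matrix

variable {k : Type u} [Field k] {ν : Type} {r : ℕ} {A : Matrix (Fin r) ν ℤ}
  {I : Ideal (MvPolynomial ν k)} {C : Type u} [CommRing C]

variable (r I) in
/-- The open subset `𝔾_m^r × (𝔸^ν ∖ V(I))` of `𝔾_m^r × 𝔸^ν`. -/
abbrev actionOpen : (Spec (.of (TorusTimesAffine k r ν))).Opens :=
  affinePr k r ν ⁻¹ᵁ complement I

/-- The torus coordinates of a point of `𝔾_m^r × 𝔸^ν`, as a character. -/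
def torusPart (ψ : TorusTimesAffine k r ν →+* C) : Multiplicative (Fin r → ℤ) →* C :=
  ψ.toMonoidHom.comp (AddMonoidAlgebra.of _ _)

lemma map_actHom_X (ψ : TorusTimesAffine k r ν →+* C) (v : ν) :
    ψ (actHom k A (MvPolynomial.X v)) =
      torusUnit (torusPart ψ) (fun l => A l v) * ψ (prHom k r ν (MvPolynomial.X v)) := by
  have htorus : torusUnit (torusPart ψ) (fun l => A l v) =
      ψ (AddMonoidAlgebra.single (fun l => A l v) 1) := rfl
  have hpr : prHom k r ν (MvPolynomial.X v) =
      AddMonoidAlgebra.single 0 (MvPolynomial.X v) := rfl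
  rw [actHom_X, htorus, hpr, ← map_mul, AddMonoidAlgebra.single_mul_single, add_zero, one_mul]

section Points

variable {x : Spec (.of C) ⟶ (actionOpen r I).toScheme} {ψ : TorusTimesAffine k r ν →+* C}

lemma comp_complementPr_ι (hx : x ≫ (actionOpen r I).ι = Spec.map (CommRingCat.ofHom ψ)) :
    (x ≫ complementPr r I) ≫ (complement I).ι =
      Spec.map (CommRingCat.ofHom (ψ.comp (prHom k r ν))) := by
  have hι : complementPr r I ≫ (complement I).ι = (actionOpen r I).ι ≫ affinePr k r ν :=
    morphismRestrict_ι _ _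
  rw [Category.assoc, hι, ← Category.assoc, hx, affinePr, ← SpecMap_ofHom_comp]

lemma comp_complementAct_ι (hst : IsStable A I)
    (hx : x ≫ (actionOpen r I).ι = Spec.map (CommRingCat.ofHom ψ)) :
    (x ≫ complementAct hst) ≫ (complement I).ι =
      Spec.map (CommRingCat.ofHom (ψ.comp (actHom k A).toRingHom)) := by
  have hι : complementAct hst ≫ (complement I).ι = (actionOpen r I).ι ≫ affineAct k A :=
    Scheme.Hom.resLE_comp_ι _ _
  rw [Category.assoc, hι, ← Category.assoc, hx, affineAct, ← SpecMap_ofHom_comp]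

end Points

variable [Fintype ν] {𝒮 : Set (Set ν)} {S : Set ν} {ψ : TorusTimesAffine k r ν →+* C}

lemma isUnit_actHom_chartVar (h : IsUnit (ψ.comp (prHom k r ν) (chartVar k S))) :
    IsUnit (ψ.comp (actHom k A).toRingHom (chartVar k S)) := by
  refine isUnit_chartVar_iff.2 fun v hv => ?_
  refine (map_actHom_X (A := A) ψ v).symm ▸ ?_
  exact (Units.isUnit _).mul (isUnit_chartVar_iff.1 h v hv)

lemma exists_actionPoint (hI : IsIrrelevantIdeal 𝒮 I) (hS : S ∈ 𝒮)
    (h : IsUnit (ψ.comp (prHom k r ν) (chartVar k S))) :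
    ∃ x : Spec (.of C) ⟶ (actionOpen r I).toScheme,
      x ≫ (actionOpen r I).ι = Spec.map (CommRingCat.ofHom ψ) := by
  refine ⟨IsOpenImmersion.lift _ (Spec.map (CommRingCat.ofHom ψ)) ?_,
    IsOpenImmersion.lift_fac _ _ _⟩
  rintro _ ⟨z, rfl⟩
  have hz := range_SpecMap_subset hI hS h ⟨z, rfl⟩
  rw [Scheme.Opens.range_ι, SpecMap_ofHom_comp] at hz
  rwa [Scheme.Opens.range_ι]

lemma exists_actionPoint_spacePoint (hI : IsIrrelevantIdeal 𝒮 I) (hS : S ∈ 𝒮) (hst : IsStable A I)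
    {φ : MvPolynomial ν k →+* C} (h : IsUnit (φ (chartVar k S))) :
    ∃ J : Spec (.of (AddMonoidAlgebra C (Fin r → ℤ))) ⟶ (actionOpen r I).toScheme,
      J ≫ complementPr r I =
          Spec.map (CommRingCat.ofHom AddMonoidAlgebra.singleZeroRingHom) ≫
            spacePoint hI hS φ h ∧
        J ≫ complementAct hst = spacePoint hI hS (coaction A φ) (isUnit_coaction_chartVar h) := by
  let ψ : TorusTimesAffine k r ν →+* AddMonoidAlgebra C (Fin r → ℤ) :=
    AddMonoidAlgebra.mapRingHom _ φ
  have hψ : ψ.comp (prHom k r ν) = AddMonoidAlgebra.singleZeroRingHom.comp φ :=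
    RingHom.ext fun _ => AddMonoidAlgebra.mapRingHom_single _ _ _
  obtain ⟨J, hJ⟩ := exists_actionPoint hI hS (ψ := ψ) (by
    rw [hψ]
    exact h.map (AddMonoidAlgebra.singleZeroRingHom : C →+* AddMonoidAlgebra C (Fin r → ℤ)))
  refine ⟨J, ?_, eq_spacePoint hI hS _ (comp_complementAct_ι hst hJ)⟩
  rw [← cancel_mono (complement I).ι, comp_complementPr_ι hJ, hψ, Category.assoc, spacePoint_ι,
    SpecMap_ofHom_comp]

end Action

section CoxQuotient

open scoped Matrix

/-- `A` and `ρ` are Gale dual: `0 → M → ℤ^ν → ℤ^r` is exact, where `M` is the dual lattice of the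
fan and the maps are multiplication by the matrix `ρ` of rays and by the matrix `A` of weights. -/
structure IsGaleDual {κ ν ι : Type*} [Fintype ν] [Fintype ι] (A : Matrix κ ν ℤ)
    (ρ : Matrix ν ι ℤ) : Prop where
  mulVec_injective : Function.Injective ρ.mulVec
  mul_eq_zero : A * ρ = 0
  exists_mulVec_eq : ∀ e, A *ᵥ e = 0 → ∃ u, ρ *ᵥ u = e

variable {k : Type u} [Field k] {ν ι : Type} [Fintype ν] [Fintype ι] {r : ℕ}
  {A : Matrix (Fin r) ν ℤ} {ρ : Matrix ν ι ℤ} {I : Ideal (MvPolynomial ν k)} {𝒮 : Set (Set ν)}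
  {S : Set ν} {C : Type u} [CommRing C]

section Invariance

variable (hI : IsIrrelevantIdeal 𝒮 I) (hF : IsFan (rayFan ρ 𝒮)) (hst : IsStable A I)

lemma coxHom_prHom_eq_actHom (hA : A * ρ = 0) (ψ : TorusTimesAffine k r ν →+* C) {τ : Cone ι}
    (h : CoxCompatible ρ τ (ψ.comp (prHom k r ν)))
    (h' : CoxCompatible ρ τ (ψ.comp (actHom k A).toRingHom)) :
    coxHom (ψ.comp (prHom k r ν)) h = coxHom (ψ.comp (actHom k A).toRingHom) h' :=
  coxHom_eq_of_torus hA (torusPart ψ) (fun c => congrArg ψ (actHom_C c)) (map_actHom_X ψ) h h'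

lemma comp_complementPr_coxMap (hA : A * ρ = 0) (hS : S ∈ 𝒮)
    {x : Spec (.of C) ⟶ (actionOpen r I).toScheme} {ψ : TorusTimesAffine k r ν →+* C}
    (hx : x ≫ (actionOpen r I).ι = Spec.map (CommRingCat.ofHom ψ))
    (h : IsUnit (ψ.comp (prHom k r ν) (chartVar k S))) :
    (x ≫ complementPr r I) ≫ coxMap hI hF = (x ≫ complementAct hst) ≫ coxMap hI hF := by
  have h' : IsUnit (ψ.comp (actHom k A).toRingHom (chartVar k S)) := isUnit_actHom_chartVar h
  rw [eq_spacePoint hI hS h (comp_complementPr_ι hx),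
    eq_spacePoint hI hS h' (comp_complementAct_ι hst hx), spacePoint_coxMap, spacePoint_coxMap,
    coxPoint, coxPoint, coxHom_prHom_eq_actHom hA ψ _ (coxCompatible_rayCone h')]

include hI in
lemma span_chartVar_eq_top {x : Spec (.of C) ⟶ (complement I).toScheme}
    {φ : MvPolynomial ν k →+* C} (hx : x ≫ (complement I).ι = Spec.map (CommRingCat.ofHom φ)) :
    Ideal.span (Set.range fun S : 𝒮 => φ (chartVar k S.1)) = ⊤ := by
  by_contra hne
  obtain ⟨M, hM, hle⟩ := Ideal.exists_le_maximal _ hne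
  let z : Spec (.of C) := (⟨M, hM.isPrime⟩ : PrimeSpectrum C)
  obtain ⟨S, hS, hnotMem⟩ := (hI.mem_complement_iff _).1 (x z).2
  change chartVar k S ∉ PrimeSpectrum.asIdeal ((complement I).ι (x z)) at hnotMem
  rw [← Scheme.Hom.comp_apply, hx] at hnotMem
  exact hnotMem (hle (Ideal.subset_span ⟨⟨S, hS⟩, rfl⟩))

lemma complementPr_coxMap (hA : A * ρ = 0) :
    complementPr r I ≫ coxMap hI hF = complementAct hst ≫ coxMap hI hF :=
  hom_ext_of_Spec fun C _ x => by
    obtain ⟨ψ, hψ⟩ := exists_ringHom (x ≫ (actionOpen r I).ι)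
    refine hom_ext_of_span _ (span_chartVar_eq_top hI (comp_complementPr_ι hψ)) fun S => ?_
    let c : C := ψ.comp (prHom k r ν) (chartVar k S.1)
    let g : C →+* Localization.Away c := algebraMap C (Localization.Away c)
    have hx : (Spec.map (CommRingCat.ofHom g) ≫ x) ≫ (actionOpen r I).ι =
        Spec.map (CommRingCat.ofHom (g.comp ψ)) := by
      rw [Category.assoc, hψ, SpecMap_ofHom_comp ψ g]
    simpa only [Category.assoc] using comp_complementPr_coxMap hI hF hst hA S.2 hx
      (IsLocalization.Away.algebraMap_isUnit c)

end Invariance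

variable (hI : IsIrrelevantIdeal 𝒮 I) (hF : IsFan (rayFan ρ 𝒮)) (h𝒮 : IsSimplicial ρ 𝒮)
  (hAρ : IsGaleDual A ρ) (hst : IsStable A I) (hS : S ∈ 𝒮)

include h𝒮 hAρ in
lemma exists_actionPoint_of_coxMap_eq {K : Type u} [Field K] [IsAlgClosed K]
    {x y : Spec (.of K) ⟶ (complement I).toScheme} (e : x ≫ coxMap hI hF = y ≫ coxMap hI hF) :
    ∃ g : Spec (.of K) ⟶ (actionOpen r I).toScheme,
      g ≫ complementPr r I = x ∧ g ≫ complementAct hst = y := by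
  obtain ⟨φ, S, hS, h, rfl⟩ := exists_eq_spacePoint hI x
  obtain ⟨φ', T, hT, h', rfl⟩ := exists_eq_spacePoint hI y
  rw [spacePoint_coxMap, spacePoint_coxMap] at e
  let p : Spec (.of K) := (⊥ : PrimeSpectrum K)
  have hne : ∀ v ∉ S, φ' (MvPolynomial.X v) ≠ 0 := by
    refine ne_zero_of_coxPoint_mem hF hT hS h𝒮 h' p ?_
    rw [← e, coxPoint, Scheme.Hom.comp_apply]
    exact Set.mem_range_self _
  have hunit : IsUnit (φ' (chartVar k S)) := isUnit_chartVar_iff.2 fun v hv => (hne v hv).isUnit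
  rw [coxPoint_eq hF hT hS h' hunit] at e
  obtain ⟨ψ, hpr, hact⟩ := exists_torus_of_coxHom_eq hAρ.exists_mulVec_eq h𝒮 hS
    (fun v hv => (isUnit_chartVar_iff.1 h v hv).ne_zero) hne _ _
    (coxHom_eq_of_coxPoint_eq hF hS h hunit e)
  obtain ⟨g, hg⟩ := exists_actionPoint hI hS (ψ := ψ) (by rw [hpr]; exact h)
  refine ⟨g, eq_spacePoint hI hS h ?_, eq_spacePoint hI hT h' ?_⟩
  · rw [comp_complementPr_ι hg, hpr]
  · rw [comp_complementAct_ι hst hg, hact]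

section Topology

include h𝒮 hAρ hS in
lemma isGradedChart_chartRing :
    IsGradedChart (chartInvariants (k := k) ρ (chartRing k S) S)
      (chartAct (k := k) A (chartRing k S) S) :=
  isGradedChart S hAρ.mulVec_injective hAρ.mul_eq_zero hAρ.exists_mulVec_eq h𝒮 hS

include h𝒮 hAρ in
lemma coxMap_surjective : Function.Surjective (coxMap hI hF) := by
  intro y
  obtain ⟨_, ⟨S, hS, rfl⟩, z, rfl⟩ := exists_toricChart_eq hF y
  obtain ⟨w, rfl⟩ := (isGradedChart_chartRing (k := k) h𝒮 hAρ hS).comap_surjective z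
  let w' : Spec (.of (chartRing k S)) := w
  refine ⟨spaceChart hI hS w', ?_⟩
  rw [← Scheme.Hom.comp_apply, spaceChart_coxMap_eq_chartInvariants, Scheme.Hom.comp_apply]
  rfl

include h𝒮 hAρ in
lemma isOpenMap_spaceChart_coxMap : IsOpenMap (spaceChart hI hS ≫ coxMap hI hF) := by
  have := isOpenImmersion_toricChart (k := k) hF (rayCone_mem_rayFan hS)
  rw [spaceChart_coxMap_eq_chartInvariants, Scheme.Hom.comp_base, TopCat.coe_comp]
  exact (toricChart k hF (rayCone_mem_rayFan hS)).isOpenEmbedding.isOpenMap.comp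
    (isGradedChart_chartRing (k := k) h𝒮 hAρ hS).isOpenMap_comap

include h𝒮 hAρ in
lemma isOpenMap_coxMap : IsOpenMap (coxMap hI hF) := by
  intro U hU
  have himage : coxMap hI hF '' U = ⋃ S : 𝒮, (spaceChart hI S.2 ≫ coxMap hI hF) ''
      (spaceChart hI S.2 ⁻¹' U) := by
    ext y
    simp only [Set.mem_iUnion]
    constructor
    · rintro ⟨x, hx, rfl⟩
      obtain ⟨S, hS, hxS⟩ := (hI.mem_complement_iff _).1 x.2
      obtain ⟨z, rfl⟩ := mem_range_spaceChart hI hS hxS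
      exact ⟨⟨S, hS⟩, z, hx, Scheme.Hom.comp_apply _ _ _⟩
    · rintro ⟨S, z, hz, rfl⟩
      exact ⟨_, hz, (Scheme.Hom.comp_apply _ _ _).symm⟩
  rw [himage]
  exact isOpen_iUnion fun S => isOpenMap_spaceChart_coxMap hI hF h𝒮 hAρ S.2 _
    (hU.preimage (spaceChart hI S.2).continuous)

end Topology

section Sections

variable (f : coneAlgebra k (rayCone ρ S))

variable (B' : Type u) [CommRing B'] [Algebra (chartRing k S) B']
  [IsLocalization.Away (chartInvariants ρ (chartRing k S) S f) B']

include h𝒮 in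
lemma mem_range_of_coxMap_mem_range_basicChart {x : (complement I).toScheme}
    (hx : coxMap hI hF x ∈ Set.range (basicChart hF (rayCone_mem_rayFan hS) f)) :
    x ∈ Set.range (Spec.map (CommRingCat.ofHom (algebraMap (chartRing k S) B')) ≫
      spaceChart hI hS) := by
  rw [range_basicChart] at hx
  obtain ⟨z, hz, hzx⟩ := hx
  obtain ⟨w, rfl⟩ := mem_range_spaceChart_of_coxMap_mem hI hS hF h𝒮 ⟨z, hzx⟩
  rw [← Scheme.Hom.comp_apply, spaceChart_coxMap_eq_chartInvariants, Scheme.Hom.comp_apply] at hzx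
  have := isOpenImmersion_toricChart (k := k) hF (rayCone_mem_rayFan hS)
  obtain rfl := (toricChart k hF (rayCone_mem_rayFan hS)).isOpenEmbedding.injective hzx
  obtain ⟨w', rfl⟩ := (PrimeSpectrum.localization_away_comap_range B'
    (chartInvariants ρ (chartRing k S) S f)).ge hz
  exact ⟨w', Scheme.Hom.comp_apply _ _ _⟩

include h𝒮 hAρ in
lemma sectionsAreInvariants_coxMap :
    SectionsAreInvariants (complementPr r I) (complementAct hst) (coxMap hI hF)
      (basicChart hF (rayCone_mem_rayFan hS) f).opensRange := by
  let i := chartInvariants (k := k) ρ (chartRing k S) S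
  let B' := Localization.Away (i f)
  let b : chartRing k S →+* B' := algebraMap _ B'
  let φ : MvPolynomial ν k →+* B' := b.comp (algebraMap (MvPolynomial ν k) (chartRing k S))
  let i' : Localization.Away f →+* B' := IsLocalization.Away.map _ _ i f
  have hi := isGradedChart_chartRing (k := k) h𝒮 hAρ hS
  have hi' : i'.comp (algebraMap _ _) = b.comp i := IsLocalization.map_comp _
  obtain ⟨act', hact'⟩ := hi.exists_act_localization f B'
  have hφ : IsUnit (φ (chartVar k S)) := (isUnit_algebraMap_chartVar k S).map b
  have hj : Spec.map (CommRingCat.ofHom b) ≫ spaceChart hI hS = spacePoint hI hS φ hφ :=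
    eq_spacePoint hI hS hφ (by rw [Category.assoc, spaceChart, spacePoint_ι, ← SpecMap_ofHom_comp])
  have hcoaction : coaction A φ = act'.comp φ := by
    refine RingHom.ext fun x => ?_
    rw [RingHom.comp_apply, RingHom.comp_apply, hact', chartAct_algebraMap, coaction, coaction,
      ← RingHom.comp_apply (AddMonoidAlgebra.mapRingHom _ _), ← RingHom.comp_assoc,
      ← AddMonoidAlgebra.mapRingHom_comp]
  have : IsOpenImmersion (Spec.map (CommRingCat.ofHom b)) := IsOpenImmersion.of_isLocalization (i f)
  obtain ⟨J, hpr, hact⟩ := exists_actionPoint_spacePoint hI hS hst hφ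
  refine sectionsAreInvariants_of_chart (φ := i')
    (j := Spec.map (CommRingCat.ofHom b) ≫ spaceChart hI hS)
    (IsLocalization.map_injective_of_injective _ _ _ hi.injective) ?_
    (fun x hx => mem_range_of_coxMap_mem_range_basicChart hI hF h𝒮 hS f B' hx)
    (hpr.trans (by rw [hj])) (α := act') ?_ fun x hx => hi.mem_range_of_localization
      (A' := Localization.Away f) f (fun a => DFunLike.congr_fun hi' a) hact' hx.symm
  · rw [Category.assoc, spaceChart_coxMap_eq_chartInvariants, basicChart, ← Category.assoc,
      ← Category.assoc, ← SpecMap_ofHom_comp, ← SpecMap_ofHom_comp, hi']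
  · rw [hact, hj, ← cancel_mono (complement I).ι, Category.assoc, spacePoint_ι, spacePoint_ι,
      hcoaction, SpecMap_ofHom_comp]

end Sections

include h𝒮 hAρ in
lemma isQuotientVariety_coxMapOver :
    IsQuotientVariety hst (toricVariety k hF) (coxMapOver hI hF) where
  invariant := complementPr_coxMap hI hF hst hAρ.mul_eq_zero
  isQuotientMap := (isOpenMap_coxMap hI hF h𝒮 hAρ).isQuotientMap (coxMap hI hF).continuous
    (coxMap_surjective hI hF h𝒮 hAρ)
  orbit _ _ _ _ _ e := exists_actionPoint_of_coxMap_eq hI hF h𝒮 hAρ hst e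
  functions := sectionsAreInvariants_of_basis fun V y hy => by
    obtain ⟨_, ⟨S, hS, rfl⟩, f, hyf, hfV⟩ := exists_basicChart hF hy
    exact ⟨(basicChart hF (rayCone_mem_rayFan hS) f).opensRange, hfV, hyf,
      sectionsAreInvariants_coxMap hI hF h𝒮 hAρ hst hS f⟩

end CoxQuotient

section BundleRays

open scoped Matrix

variable {n m : ℕ} {a ω : Fin (m + 1) → ℕ}

variable (n a ω) in
/-- The matrix whose rows are the ray generators `α_0, …, α_n, β_0, …, β_m` of the fan `Σ`, indexed
like the coordinates `x_0, …, x_n, y_0, …, y_m`. -/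
def ray : Matrix (Fin (n + 1) ⊕ Fin (m + 1)) (Fin m ⊕ Fin n) ℤ :=
  Matrix.of (Sum.elim (alpha n a ω) (beta n a))

@[simp] lemma ray_inl_succ (j : Fin n) : ray n a ω (Sum.inl j.succ) = Pi.single (Sum.inr j) 1 :=
  rfl

@[simp] lemma ray_inr_succ (i : Fin m) : ray n a ω (Sum.inr i.succ) = Pi.single (Sum.inl i) 1 :=
  rfl

@[simp] lemma ray_inr_zero_inl (i : Fin m) : ray n a ω (Sum.inr 0) (Sum.inl i) = -a i.succ := by
  simp [ray, beta, Finset.sum_apply, Pi.single_apply]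

@[simp] lemma ray_inr_zero_inr (j : Fin n) : ray n a ω (Sum.inr 0) (Sum.inr j) = 0 := by
  simp [ray, beta, Finset.sum_apply]

@[simp] lemma ray_inl_zero_inl (i : Fin m) :
    ray n a ω (Sum.inl 0) (Sum.inl i) = ω i.succ - ω 0 * a i.succ := by
  simp [ray, alpha, beta, Finset.sum_apply, Pi.single_apply, Fin.sum_univ_succ, neg_add_eq_sub]

@[simp] lemma ray_inl_zero_inr (j : Fin n) : ray n a ω (Sum.inl 0) (Sum.inr j) = -1 := by
  simp [ray, alpha, beta, Finset.sum_apply, Pi.single_apply, Fin.sum_univ_succ]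

section GaleDual

variable (u : Fin m ⊕ Fin n → ℤ) (e : Fin (n + 1) ⊕ Fin (m + 1) → ℤ)

lemma ray_mulVec_inl_succ (j : Fin n) : (ray n a ω *ᵥ u) (Sum.inl j.succ) = u (Sum.inr j) := by
  rw [Matrix.mulVec, ray_inl_succ, single_one_dotProduct]

lemma ray_mulVec_inr_succ (i : Fin m) : (ray n a ω *ᵥ u) (Sum.inr i.succ) = u (Sum.inl i) := by
  rw [Matrix.mulVec, ray_inr_succ, single_one_dotProduct]

lemma ray_mulVec_inr_zero :
    (ray n a ω *ᵥ u) (Sum.inr 0) = -∑ i : Fin m, a i.succ * u (Sum.inl i) := by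
  simp [Matrix.mulVec, dotProduct]

lemma ray_mulVec_inl_zero : (ray n a ω *ᵥ u) (Sum.inl 0) =
    -∑ j, u (Sum.inr j) + ∑ i, ω i * (ray n a ω *ᵥ u) (Sum.inr i) := by
  rw [Fin.sum_univ_succ, ray_mulVec_inr_zero]
  simp only [ray_mulVec_inr_succ]
  simp only [Matrix.mulVec, dotProduct, Fintype.sum_sum_type, ray_inl_zero_inl, ray_inl_zero_inr,
    sub_mul, Finset.sum_sub_distrib, neg_one_mul, Finset.sum_neg_distrib, Finset.mul_sum, mul_assoc,
    mul_neg]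
  ring

lemma weights_mulVec_zero : (weights n a ω *ᵥ e) 0 =
    ∑ j, e (Sum.inl j) - ∑ i, ω i * e (Sum.inr i) := by
  simp [weights, Matrix.mulVec, dotProduct, sub_eq_add_neg]

lemma weights_mulVec_one : (weights n a ω *ᵥ e) 1 = ∑ i, a i * e (Sum.inr i) := by
  simp [weights, Matrix.mulVec, dotProduct]

lemma weights_mulVec_ray_mulVec (ha0 : a 0 = 1) : weights n a ω *ᵥ (ray n a ω *ᵥ u) = 0 := by
  ext t
  fin_cases t
  · change (weights n a ω *ᵥ _) 0 = 0
    rw [weights_mulVec_zero, Fin.sum_univ_succ, ray_mulVec_inl_zero]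
    simp only [ray_mulVec_inl_succ]
    ring
  · change (weights n a ω *ᵥ _) 1 = 0
    rw [weights_mulVec_one, Fin.sum_univ_succ, ray_mulVec_inr_zero, ha0]
    simp only [ray_mulVec_inr_succ]
    ring

variable {e} in
lemma exists_ray_mulVec_eq (ha0 : a 0 = 1) (he : weights n a ω *ᵥ e = 0) :
    ∃ u, ray n a ω *ᵥ u = e := by
  have hx := congrFun he 0
  have hy := congrFun he 1
  rw [weights_mulVec_zero, Pi.zero_apply, sub_eq_zero] at hx
  rw [weights_mulVec_one, Fin.sum_univ_succ, ha0, Pi.zero_apply] at hy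
  let u : Fin m ⊕ Fin n → ℤ := Sum.elim (fun i => e (Sum.inr i.succ)) fun j => e (Sum.inl j.succ)
  have hinr (i : Fin (m + 1)) : (ray n a ω *ᵥ u) (Sum.inr i) = e (Sum.inr i) := by
    induction i using Fin.cases with
    | zero =>
      simp only [ray_mulVec_inr_zero, u, Sum.elim_inl]
      push_cast at hy
      linear_combination -hy
    | succ i => exact ray_mulVec_inr_succ u i
  have hinl (j : Fin (n + 1)) : (ray n a ω *ᵥ u) (Sum.inl j) = e (Sum.inl j) := by
    induction j using Fin.cases with
    | zero =>
      rw [Fin.sum_univ_succ] at hx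
      simp only [ray_mulVec_inl_zero, hinr, ← hx, u, Sum.elim_inr]
      ring
    | succ j => exact ray_mulVec_inl_succ u j
  exact ⟨u, funext (Sum.rec hinl hinr)⟩

lemma isGaleDual_ray (ha0 : a 0 = 1) : IsGaleDual (weights n a ω) (ray n a ω) where
  mulVec_injective u v h := funext <| Sum.rec
    (fun i => by rw [← ray_mulVec_inr_succ (a := a) (ω := ω) u, h, ray_mulVec_inr_succ])
    (fun j => by rw [← ray_mulVec_inl_succ (a := a) (ω := ω) u, h, ray_mulVec_inl_succ])
  mul_eq_zero := Matrix.ext_of_mulVec_single fun i => by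
    rw [← Matrix.mulVec_mulVec, weights_mulVec_ray_mulVec _ ha0, Matrix.zero_mulVec]
  exists_mulVec_eq _ he := exists_ray_mulVec_eq ha0 he

end GaleDual

section AdmissibleSets

variable (n m) in
/-- The sets of rays that generate a cone of `Σ`: those missing some `α_s` and some `β_r`. -/
def bundleCones : Set (Set (Fin (n + 1) ⊕ Fin (m + 1))) :=
  {S | (∃ s, Sum.inl s ∉ S) ∧ ∃ r, Sum.inr r ∉ S}

lemma isLowerSet_bundleCones : IsLowerSet (bundleCones n m) :=
  fun _ _ hTS ⟨⟨s, hs⟩, r, hr⟩ => ⟨⟨s, fun h => hs (hTS h)⟩, r, fun h => hr (hTS h)⟩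

lemma mem_bundleCones_iff_exists_subset {S : Set (Fin (n + 1) ⊕ Fin (m + 1))} :
    S ∈ bundleCones n m ↔ ∃ r s, S ⊆ {Sum.inl s, Sum.inr r}ᶜ := by
  have hsub (r : Fin (m + 1)) (s : Fin (n + 1)) :
      S ⊆ {Sum.inl s, Sum.inr r}ᶜ ↔ Sum.inl s ∉ S ∧ Sum.inr r ∉ S := by
    rw [Set.subset_compl_comm, Set.pair_subset_iff, Set.mem_compl_iff, Set.mem_compl_iff]
  simp only [hsub]
  exact ⟨fun ⟨⟨s, hs⟩, r, hr⟩ => ⟨r, s, hs, hr⟩, fun ⟨r, s, hs, hr⟩ => ⟨⟨s, hs⟩, r, hr⟩⟩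

lemma maximal_bundleCones_iff {S : Set (Fin (n + 1) ⊕ Fin (m + 1))} :
    Maximal (· ∈ bundleCones n m) S ↔ ∃ r s, S = {Sum.inl s, Sum.inr r}ᶜ := by
  constructor
  · intro h
    obtain ⟨r, s, hS⟩ := mem_bundleCones_iff_exists_subset.1 h.prop
    exact ⟨r, s, h.eq_of_subset (mem_bundleCones_iff_exists_subset.2 ⟨r, s, le_rfl⟩) hS⟩
  · rintro ⟨r, s, rfl⟩
    refine ⟨mem_bundleCones_iff_exists_subset.2 ⟨r, s, le_rfl⟩, fun T hT hST => ?_⟩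
    obtain ⟨r', s', hT⟩ := mem_bundleCones_iff_exists_subset.1 hT
    have hsub := Set.compl_subset_compl.1 (hST.trans hT)
    obtain rfl : s' = s := by simpa using hsub (Set.mem_insert _ _)
    obtain rfl : r' = r := by simpa using hsub (Set.mem_insert_of_mem _ rfl)
    exact hT

lemma singleton_mem_bundleCones (hn : n ≠ 0) (hm : m ≠ 0) (v : Fin (n + 1) ⊕ Fin (m + 1)) :
    {v} ∈ bundleCones n m := by
  have : NeZero n := ⟨hn⟩
  have : NeZero m := ⟨hm⟩
  obtain j | i := v
  · obtain ⟨s, hs⟩ := exists_ne j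
    exact ⟨⟨s, by simpa using hs⟩, 0, by simp⟩
  · obtain ⟨r, hr⟩ := exists_ne i
    exact ⟨⟨0, by simp⟩, r, by simpa using hr⟩

lemma isIrrelevantIdeal_irrelevantIdeal (k : Type u) [Field k] :
    IsIrrelevantIdeal (bundleCones n m) (irrelevantIdeal k n m) := by
  refine fun P => (mem_complement_irrelevantIdeal P).trans ⟨?_, ?_⟩
  · rintro ⟨⟨s, hs⟩, r, hr⟩
    refine ⟨{Sum.inl s, Sum.inr r}ᶜ, mem_bundleCones_iff_exists_subset.2 ⟨r, s, le_rfl⟩, ?_⟩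
    intro v hv
    obtain rfl | rfl := not_not.1 hv
    · exact hs
    · exact hr
  · rintro ⟨S, ⟨⟨s, hs⟩, r, hr⟩, hS⟩
    exact ⟨⟨s, hS _ hs⟩, r, hS _ hr⟩

end AdmissibleSets

section Fan

lemma exists_eq_of_rayComb_ray_eq_zero (ha0 : a 0 = 1) {c : Fin (n + 1) ⊕ Fin (m + 1) → ℝ}
    (h : rayComb (ray n a ω) c = 0) :
    ∃ p q : ℝ, (∀ j, c (Sum.inl j) = p) ∧ ∀ i, c (Sum.inr i) = a i * q - ω i * p := by
  have hcoord (l : Fin m ⊕ Fin n) : ∑ v, c v * ray n a ω v l = 0 := by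
    simpa [rayComb, Fintype.linearCombination_apply, latticeVec] using congrFun h l
  refine ⟨c (Sum.inl 0), c (Sum.inr 0) + ω 0 * c (Sum.inl 0), fun j => ?_, fun i => ?_⟩
  · induction j using Fin.cases with
    | zero => rfl
    | succ j =>
      have hj : -c (Sum.inl 0) + c (Sum.inl j.succ) = 0 := by
        simpa [Fin.sum_univ_succ, Pi.single_apply] using hcoord (Sum.inr j)
      linear_combination hj
  · induction i using Fin.cases with
    | zero =>
      rw [ha0]
      push_cast
      ring
    | succ i =>
      have hi : c (Sum.inl 0) * (ω i.succ - ω 0 * a i.succ) +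
          (-(c (Sum.inr 0) * a i.succ) + c (Sum.inr i.succ)) = 0 := by
        simpa [Fin.sum_univ_succ, Pi.single_apply] using hcoord (Sum.inl i)
      linear_combination hi

lemma isSimplicial_ray (ha0 : a 0 = 1) (hpos : ∀ i, 0 < a i) :
    IsSimplicial (ray n a ω) (bundleCones n m) where
  isLowerSet := isLowerSet_bundleCones
  injOn := by
    rintro b ⟨hb, ⟨s, hs⟩, r, hr⟩ c ⟨hc, ⟨s', hs'⟩, r', hr'⟩ hbc
    rw [Function.notMem_support] at hs hr hs' hr'
    have hb (v) : 0 ≤ b v := hb v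
    have hc (v) : 0 ≤ c v := hc v
    -- As `b` and `c` each vanish on some `α` and on some `β`, first `p` and then `q` is both `≤ 0`
    -- and `≥ 0`.
    obtain ⟨p, q, hp, hq⟩ := exists_eq_of_rayComb_ray_eq_zero ha0 (c := b - c)
      (by rw [map_sub, hbc, sub_self])
    simp only [Pi.sub_apply] at hp hq
    have hp₀ : p = 0 := le_antisymm (by linarith [hp s, hc (Sum.inl s)])
      (by linarith [hp s', hb (Sum.inl s')])
    simp only [hp₀, mul_zero, sub_zero] at hp hq
    have ha (i) : (0 : ℝ) < a i := Nat.cast_pos.2 (hpos i)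
    have hq₀ : q = 0 := le_antisymm
      (nonpos_of_mul_nonpos_right (by linarith [hq r, hc (Sum.inr r)]) (ha r))
      (nonneg_of_mul_nonneg_right (by linarith [hq r', hb (Sum.inr r')]) (ha r'))
    simp only [hq₀, mul_zero] at hq
    exact funext <| Sum.rec (fun j => sub_eq_zero.1 (hp j)) fun i => sub_eq_zero.1 (hq i)

lemma sigma_eq_rayCone (r : Fin (m + 1)) (s : Fin (n + 1)) :
    sigma n a ω r s = rayCone (ray n a ω) {Sum.inl s, Sum.inr r}ᶜ := by
  rw [sigma, rayCone]
  congr 1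
  ext v
  constructor
  · rintro (⟨i, hi, rfl⟩ | ⟨j, hj, rfl⟩)
    · exact ⟨Sum.inr i, by simpa using hi, rfl⟩
    · exact ⟨Sum.inl j, by simpa using hj, rfl⟩
  · rintro ⟨j | i, hv, rfl⟩
    · exact Or.inr ⟨j, by simpa using hv, rfl⟩
    · exact Or.inl ⟨i, by simpa using hv, rfl⟩

lemma bundleFan_eq_rayFan (ha0 : a 0 = 1) (hpos : ∀ i, 0 < a i) :
    bundleFan n a ω = rayFan (ray n a ω) (bundleCones n m) := by
  ext τ
  constructor
  · rintro ⟨r, s, h⟩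
    rw [sigma_eq_rayCone] at h
    obtain ⟨T, hT, rfl⟩ := exists_eq_rayCone_of_isFace h
    exact ⟨T, mem_bundleCones_iff_exists_subset.2 ⟨r, s, hT⟩, rfl⟩
  · rintro ⟨S, hS, rfl⟩
    obtain ⟨r, s, hrs⟩ := mem_bundleCones_iff_exists_subset.1 hS
    refine ⟨r, s, ?_⟩
    rw [sigma_eq_rayCone]
    exact (isSimplicial_ray ha0 hpos).isFace_rayCone
      (mem_bundleCones_iff_exists_subset.2 ⟨r, s, le_rfl⟩) hrs

lemma maximal_bundleFan_iff (ha0 : a 0 = 1) (hpos : ∀ i, 0 < a i) (σ : Cone (Fin m ⊕ Fin n)) :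
    Maximal (· ∈ bundleFan n a ω) σ ↔ ∃ r s, σ = sigma n a ω r s := by
  rw [bundleFan_eq_rayFan ha0 hpos, (isSimplicial_ray ha0 hpos).maximal_rayFan_iff]
  simp only [maximal_bundleCones_iff, sigma_eq_rayCone]
  exact ⟨fun ⟨_, ⟨r, s, hS⟩, hσ⟩ => ⟨r, s, hS ▸ hσ⟩, fun ⟨r, s, hσ⟩ => ⟨_, ⟨r, s, rfl⟩, hσ⟩⟩

lemma isPrimitive_ray_inr_zero (hgcd : (Finset.univ.erase 0).gcd a = 1) :
    IsPrimitive (ray n a ω (Sum.inr 0)) := by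
  have hdvd (d : ℤ) (hd : ∀ l, d ∣ ray n a ω (Sum.inr 0) l) : IsUnit d := by
    rw [Int.isUnit_iff_natAbs_eq, ← Nat.dvd_one, ← hgcd]
    refine Finset.dvd_gcd fun i hi => ?_
    obtain ⟨i, rfl⟩ := Fin.exists_succ_eq.2 (Finset.ne_of_mem_erase hi)
    rw [← Int.natCast_dvd_natCast, Int.natAbs_dvd, ← dvd_neg, ← ray_inr_zero_inl (n := n) (ω := ω)]
    exact hd _
  refine ⟨fun h₀ => not_isUnit_zero (hdvd 0 fun l => ?_), fun d w hd => hdvd d fun l => ?_⟩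
  · rw [h₀, Pi.zero_apply]
  · exact ⟨w l, congrFun hd l⟩

lemma isPrimitive_ray (hn : n ≠ 0) (hgcd : (Finset.univ.erase 0).gcd a = 1)
    (v : Fin (n + 1) ⊕ Fin (m + 1)) : IsPrimitive (ray n a ω v) := by
  obtain j | i := v
  · induction j using Fin.cases with
    | zero => exact isPrimitive_of_isUnit (Sum.inr ⟨0, Nat.pos_of_ne_zero hn⟩) (by simp)
    | succ j => exact isPrimitive_of_isUnit (Sum.inr j) (by simp)
  · induction i using Fin.cases with
    | zero => exact isPrimitive_ray_inr_zero hgcd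
    | succ i => exact isPrimitive_of_isUnit (Sum.inl i) (by simp)

lemma setOf_isPrimitive_coneOf_mem_bundleFan (ha0 : a 0 = 1) (hpos : ∀ i, 0 < a i) (hn : n ≠ 0)
    (hgcd : (Finset.univ.erase 0).gcd a = 1) :
    {v | IsPrimitive v ∧ coneOf {v} ∈ bundleFan n a ω} =
      Set.range (alpha n a ω) ∪ Set.range (beta n a) := by
  have hm : m ≠ 0 := by
    rintro rfl
    simp at hgcd
  have hmem : {v | {v} ∈ bundleCones n m} = Set.univ :=
    Set.eq_univ_of_forall (singleton_mem_bundleCones hn hm)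
  rw [bundleFan_eq_rayFan ha0 hpos,
    setOf_isPrimitive_coneOf_mem_rayFan isLowerSet_bundleCones (isPrimitive_ray hn hgcd), hmem,
    Set.image_univ]
  exact Set.Sum.elim_range _ _

end Fan

end BundleRays

end WeightedBundle

end

theorem theorem3p2_general {k : Type u} [Field k] (n m : ℕ) (a ω : Fin (m + 1) → ℕ)
    (ha0 : a 0 = 1) (hpos : ∀ i, 0 < a i) :
    ∃ hF : IsFan (bundleFan n a ω),
      (∀ σ, Maximal (· ∈ bundleFan n a ω) σ ↔ ∃ r s, σ = sigma n a ω r s) ∧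
      (n ≠ 0 → (Finset.univ.erase 0).gcd a = 1 →
        {v | IsPrimitive v ∧ coneOf {v} ∈ bundleFan n a ω} =
          Set.range (alpha n a ω) ∪ Set.range (beta n a)) ∧
      ∃ q : complementOver (irrelevantIdeal k n m) ⟶ toricVariety k hF,
        IsQuotientVariety (isStable k n a ω) (toricVariety k hF) q ∧
        ∀ (X : Over (Spec (.of k))) (π : complementOver (irrelevantIdeal k n m) ⟶ X),
          IsQuotientVariety (isStable k n a ω) X π →
            ∃ e : X ≅ toricVariety k hF, π ≫ e.hom = q := by
  have hmax := maximal_bundleFan_iff (n := n) (ω := ω) ha0 hpos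
  have hrays := setOf_isPrimitive_coneOf_mem_bundleFan (n := n) (ω := ω) ha0 hpos
  rw [bundleFan_eq_rayFan ha0 hpos] at hmax hrays ⊢
  have h𝒮 : IsSimplicial (ray n a ω) (bundleCones n m) := isSimplicial_ray ha0 hpos
  have hq := isQuotientVariety_coxMapOver (isIrrelevantIdeal_irrelevantIdeal k) h𝒮.isFan h𝒮
    (isGaleDual_ray ha0) (isStable k n a ω)
  exact ⟨h𝒮.isFan, hmax, hrays, _, hq, fun X π hπ => exists_iso_of_isGeometricQuotient hπ hq⟩

theorem theorem3p2 {k : Type u} [Field k] [CharZero k] (n m : ℕ) (a ω : Fin (m + 1) → ℕ)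
    (ha0 : a 0 = 1) (ha : IsWellFormed a) :
    ∃ hF : IsFan (bundleFan n a ω),
      -- the maximal cones of `Σ` are the cones `σ_{rs}`
      (∀ σ, Maximal (· ∈ bundleFan n a ω) σ ↔ ∃ r s, σ = sigma n a ω r s) ∧
      -- the primitive ray generators of `Σ` are the `α_j` and the `β_i`
      (n ≠ 0 → {v | IsPrimitive v ∧ coneOf {v} ∈ bundleFan n a ω} =
        Set.range (alpha n a ω) ∪ Set.range (beta n a)) ∧
      -- `T(Σ)` is the quotient, and any variety that is the quotient is isomorphic to `T(Σ)`
      ∃ q : complementOver (irrelevantIdeal k n m) ⟶ toricVariety k hF,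
        IsQuotientVariety (isStable k n a ω) (toricVariety k hF) q ∧
        ∀ (X : Over (Spec (.of k))) (π : complementOver (irrelevantIdeal k n m) ⟶ X),
          IsQuotientVariety (isStable k n a ω) X π →
            ∃ e : X ≅ toricVariety k hF, π ≫ e.hom = q := by
  obtain ⟨hF, hmax, hrays, hquot⟩ := theorem3p2_general (k := k) n m a ω ha0 ha.1
  exact ⟨hF, hmax, fun hn => hrays hn (ha.2 0), hquot⟩
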